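/- Work in the algebra $\mathbb{C}((z^{-1}))$ of formal Laurent series $\sum_{k\le N}a_kz^k$; the order of a nonzero series is its highest exponent. For $m\ge 0$ let $S_m=\{-m,-m+2,\dots,m,m+1,m+2,\dots\}$, and let the Birkhoff stratum $\Sigma_m$ of $\mathrm{Gr}^{(2)}$ be the set of subspaces $V$ with $z^2V\subset V$ whose nonzero elements have exactly the orders in $S_m$. Let $n\ge 2$ and $T=S_{2n}\cap\mathbb{Z}_{\ge0}=\{0,2,\dots,2n,2n+1,2n+2,\dots\}$. For parameters $H=(H^j_k)$ put $$p_j(z)=z^j+\sum_{k:\ -k\notin T,\ -k<j}H^j_kz^{-k}\quad(j\in T),\qquad U_H=\operatorname{span}\{p_j: j\in T\}.$$ Let $W_{2n}$ be the set of all $U_H$ whose parameters satisfy $$H^{2m}_k=0\ (m\ge0;\ k=-2n+1,-2n+3,\dots,-1\text{ and }k=1,2,3,\dots),\qquad H^{2m+1}_{2k}=0\ (m\ge 0,\ k\ge -n),$$ $$H^{2j+1}_{2(l+k)+1}-H^{2(j+k)+1}_{2l+1}-\sum_{s=-n}^{k-n-1}H^{2j+1}_{2s+1}H^{2(k-s)-1}_{2l+1}=0\quad(j\ge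 n,\ k\ge0,\ l\ge-n),$$ $$H^{2j+1}_{2(l+k)+1}+H^{2k+1}_{2(l+j)+1}+\sum_{s=-n}^{-1}H^{2j+1}_{2s+1}H^{2k+1}_{2(l-s)-1}+\sum_{r=-n}^{-1}H^{2k+1}_{2r+1}H^{2j+1}_{2(l-r)-1}+\sum_{s=0}^{l-1}H^{2j+1}_{2s+1}H^{2k+1}_{2(l-s)-1}=0\quad(j,k\ge n,\ l\ge1).$$ 1. Consider the subspaces $U$ of members of $\Sigma_{2n}$ whose nonzero elements have exactly the orders in $T$. Then $W_{2n}$ is the largest set of such subspaces all of whose members satisfy $U\cdot U\subset U$ and $z^2U\subset U$. Moreover, if $U\in W_{2n}$ and $U\subset V\in\Sigma_{2n}$, then $U$ is maximal among the multiplicatively closed subspaces of $V$. The members of $W_{2n}$ are parametrized bijectively by the $2n+1$ arbitrary complex numbers $H^{2n+1}_{-2n+1},H^{2n+1}_{-2n+3},\dots,H^{2n+1}_{2n+1}$. 2. Let $U_H\in W_{2n}$, with $H$ satisfying the constraints. The $p_j$, $j\in T$, form a basis of $U_H$, and $p_{2m}=z^{2m}$. The space $U_H$ is an infinite-dimensional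 commutative associative unital algebra, and $\lambda\mapsto z^2$, $p_{2n+1}\mapsto p_{2n+1}(z)$ induces an isomorphism of algebras $$\mathbb{C}[\lambda,p_{2n+1}]/(C_{2n+1})\cong U_H,\qquad C_{2n+1}=p_{2n+1}^2-P(\lambda),\quad P(\lambda)=\lambda^{2n+1}+\sum_{s=0}^{2n}u_s\lambda^s,$$ $$u_s=2H^{2n+1}_{2(n-s)+1}+\sum_{k=-n}^{n-s-1}H^{2n+1}_{2k+1}H^{2n+1}_{-2(s+k)-1}.$$ 3. For such $H$ there are monic polynomials $\alpha_m\in\mathbb{C}[\lambda]$ of degree $m-n$ ($m>n$) with $p_{2m+1}(z)=\alpha_m(z^2)\,p_{2n+1}(z)$. In the affine space with coordinates $\lambda,p_{2n+1},p_{2n+3},\dots$ (and $p_{2i}:=\lambda^i$) let $\Gamma_{2n}$ be the variety defined by the relations $p_jp_k=\sum_lC^l_{jk}p_l$ ($j,k\in T$), where the constants $C_{jk}^l$ are the structure constants of $U_H$ in the basis $(p_j)$. The ideal $$\langle C_{2n+1},\ p_{2m+1}-\alpha_m(\lambda)p_{2n+1}\ (m>n)\rangle$$ is the ideal generated by these relations,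 the ideal of all polynomials vanishing on $\Gamma_{2n}$, and the ideal of all polynomial relations between the series $z^2,p_{2n+1}(z),p_{2n+3}(z),\dots$. 4. For such $H$ the curve $C_{2n+1}=0$ is integral, its function field is a quadratic extension of $\mathbb{C}(\lambda)$, and its completion, glued from the charts with coordinates $(\lambda,p_{2n+1})$ and $(\lambda^{-1},p_{2n+1}\lambda^{-n-1})$, has arithmetic genus $n$. The affine curve is nonsingular if and only if $P$ is squarefree, and if and only if it is a hyperelliptic curve of (geometric) genus $n$. -/

import Mathlib

noncomputable section

/-! ### Formal Laurent series in `z` with finitely many positive powers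

`LaurentSeries ℂ` is used in the variable `1 / z`: the coefficient of `z ^ k` in `f` is
`f.coeff (-k)`, and the order in `z` of a nonzero `f` is `-f.order`. -/

/-- The usual `ℂ`-algebra structure, by coefficientwise scalar multiplication. (Instance search
would otherwise find the one inherited from power series, whose scalar multiplication is equal to
this one only by a lemma.) -/
instance (priority := high) laurentAlgebra : Algebra ℂ (LaurentSeries ℂ) := HahnSeries.instAlgebra

/-- The monomial `z ^ k`. -/
def zPow (k : ℤ) : LaurentSeries ℂ := HahnSeries.single (-k) 1

/-- The set of orders in `z` of the nonzero elements of a subspace. -/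
def zOrders (V : Submodule ℂ (LaurentSeries ℂ)) : Set ℤ :=
  {k | ∃ f ∈ V, f ≠ 0 ∧ -f.order = k}

/-- `z ^ 2 * V ⊆ V`. -/
def ZSqStable (V : Submodule ℂ (LaurentSeries ℂ)) : Prop := ∀ f ∈ V, zPow 2 * f ∈ V

/-- `S_m = {-m, -m+2, …, m, m+1, m+2, …}`. -/
def orderSet (m : ℕ) : Set ℤ := {k | (m : ℤ) ≤ k ∨ (-(m : ℤ) ≤ k ∧ Even (k + m))}

/-- The Birkhoff stratum `Σ_m` of `Gr⁽²⁾`: the subspaces `V` with `z ^ 2 * V ⊆ V` whose elements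
have exactly the orders `S_m`. -/
def birkhoffStratum (m : ℕ) : Set (Submodule ℂ (LaurentSeries ℂ)) :=
  {V | zOrders V = orderSet m ∧ ZSqStable V}

/-- The nonnegative part `{0, 2, …, 2n, 2n+1, 2n+2, …}` of `S_{2n}`. -/
def nonnegOrders (n : ℕ) : Set ℤ := {k | k ∈ orderSet (2 * n) ∧ 0 ≤ k}

/-- The subspaces of points of `Σ_{2n}` that have one basis element for each nonnegative order of
`S_{2n}` (and no element of negative order). -/
def nonnegParts (n : ℕ) : Set (Submodule ℂ (LaurentSeries ℂ)) :=
  {U | zOrders U = nonnegOrders n ∧ ∃ V ∈ birkhoffStratum (2 * n), U ≤ V}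

/-! ### The canonical basis and its parameters -/

open Classical in
/-- `p_j = z ^ j + ∑ H^j_k z ^ (-k)`, the sum running over all `k` such that `-k < j` and `-k` is
not one of the orders `0, 2, …, 2n, 2n+1, 2n+2, …`; here `H j k` stands for `H^j_k`. -/
def canonicalSeries (n : ℕ) (H : ℤ → ℤ → ℂ) (j : ℤ) : LaurentSeries ℂ :=
  HahnSeries.ofSuppBddBelow
    (fun k : ℤ => if k = -j then 1 else if -k ∉ nonnegOrders n ∧ -k < j then H j k else 0)
    ⟨-j, fun k hk => by
      by_contra hlt
      apply hk
      simp only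
      rw [if_neg (by omega), if_neg (by rintro ⟨-, h⟩; omega)]⟩

/-- The vector space with basis `p_j`, `j = 0, 2, …, 2n, 2n+1, 2n+2, …`. -/
def spanSeries (n : ℕ) (H : ℤ → ℤ → ℂ) : Submodule ℂ (LaurentSeries ℂ) :=
  Submodule.span ℂ (Set.range fun j : nonnegOrders n => canonicalSeries n H j)

/-- The linear constraints: `H^{2m}_k = 0` for `k = -2n+1, -2n+3, …, -1` and `k = 1, 2, 3, …`,
and `H^{2m+1}_{2k} = 0` for `k ≥ -n`. -/
def LinearConstraints (n : ℕ) (H : ℤ → ℤ → ℂ) : Prop :=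
  (∀ m k : ℤ, 0 ≤ m → (1 ≤ k ∨ (-2 * (n : ℤ) + 1 ≤ k ∧ Odd k)) → H (2 * m) k = 0) ∧
  (∀ m k : ℤ, 0 ≤ m → -(n : ℤ) ≤ k → H (2 * m + 1) (2 * k) = 0)

/-- The quadratic constraints on the `H^{2j+1}_{2l+1}`. -/
def QuadraticConstraints (n : ℕ) (H : ℤ → ℤ → ℂ) : Prop :=
  (∀ j k l : ℤ, (n : ℤ) ≤ j → 0 ≤ k → -(n : ℤ) ≤ l →
    H (2 * j + 1) (2 * (l + k) + 1) - H (2 * (j + k) + 1) (2 * l + 1)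
      - ∑ s ∈ Finset.Icc (-(n : ℤ)) (k - n - 1),
          H (2 * j + 1) (2 * s + 1) * H (2 * (k - s) - 1) (2 * l + 1) = 0) ∧
  (∀ j k l : ℤ, (n : ℤ) ≤ j → (n : ℤ) ≤ k → 1 ≤ l →
    H (2 * j + 1) (2 * (l + k) + 1) + H (2 * k + 1) (2 * (l + j) + 1)
      + ∑ s ∈ Finset.Icc (-(n : ℤ)) (-1),
          H (2 * j + 1) (2 * s + 1) * H (2 * k + 1) (2 * (l - s) - 1)
      + ∑ r ∈ Finset.Icc (-(n : ℤ)) (-1),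
          H (2 * k + 1) (2 * r + 1) * H (2 * j + 1) (2 * (l - r) - 1)
      + ∑ s ∈ Finset.Icc (0 : ℤ) (l - 1),
          H (2 * j + 1) (2 * s + 1) * H (2 * k + 1) (2 * (l - s) - 1) = 0)

/-- All constraints. -/
def Admissible (n : ℕ) (H : ℤ → ℤ → ℂ) : Prop :=
  LinearConstraints n H ∧ QuadraticConstraints n H

/-- The subset `W_{2n}`: the spaces `⟨p_j⟩` whose parameters obey the constraints. -/
def hyperellipticSubset (n : ℕ) : Set (Submodule ℂ (LaurentSeries ℂ)) :=
  {U | ∃ H, Admissible n H ∧ U = spanSeries n H}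

/-! ### The curve `C_{2n+1}` -/

/-- The coefficient `u_s`. -/
def uCoeff (n : ℕ) (H : ℤ → ℤ → ℂ) (s : ℕ) : ℂ :=
  2 * H (2 * n + 1) (2 * ((n : ℤ) - s) + 1) +
    ∑ k ∈ Finset.Icc (-(n : ℤ)) ((n : ℤ) - s - 1),
      H (2 * n + 1) (2 * k + 1) * H (2 * n + 1) (-2 * (s + k) - 1)

/-- `λ ^ (2n+1) + ∑_{k ≤ 2n} u_k λ ^ k`. -/
def branchPoly (n : ℕ) (H : ℤ → ℤ → ℂ) : Polynomial ℂ :=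
  Polynomial.X ^ (2 * n + 1) +
    ∑ k ∈ Finset.range (2 * n + 1), Polynomial.C (uCoeff n H k) * Polynomial.X ^ k

/-- `C_{2n+1} = p_{2n+1} ^ 2 - λ ^ (2n+1) - ∑_{k ≤ 2n} u_k λ ^ k` in `ℂ[λ, p_{2n+1}]`, where
`λ = X 0` and `p_{2n+1} = X 1`. -/
def curvePoly (n : ℕ) (H : ℤ → ℤ → ℂ) : MvPolynomial (Fin 2) ℂ :=
  MvPolynomial.X 1 ^ 2 - Polynomial.aeval (MvPolynomial.X 0) (branchPoly n H)

/-- `ℂ[λ, p_{2n+1}] / C_{2n+1}`. -/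
abbrev CurveRing (n : ℕ) (H : ℤ → ℤ → ℂ) : Type :=
  MvPolynomial (Fin 2) ℂ ⧸ Ideal.span {curvePoly n H}

/-- The class of `λ` in the coordinate ring. -/
def CurveRing.lam (n : ℕ) (H : ℤ → ℤ → ℂ) : CurveRing n H :=
  Ideal.Quotient.mk _ (MvPolynomial.X 0)

/-- The class of `p_{2n+1}` in the coordinate ring. -/
def CurveRing.p (n : ℕ) (H : ℤ → ℤ → ℂ) : CurveRing n H :=
  Ideal.Quotient.mk _ (MvPolynomial.X 1)

/-! ### The variety in the affine space with coordinates `λ, p_{2n+1}, p_{2n+3}, …` -/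

/-- The coordinates `λ` and `p_{2m+1}`, `m ≥ n`. -/
inductive Coord (n : ℕ) : Type
  | lam : Coord n
  | odd : {m : ℕ // n ≤ m} → Coord n

/-- The coordinate function of the basis element `p_j`: `λ ^ i` if `j = 2 * i`, and the coordinate
`p_{2m+1}` if `j = 2 * m + 1`. -/
def coordFun (n : ℕ) (j : nonnegOrders n) : MvPolynomial (Coord n) ℂ :=
  if h : Even (j : ℤ) then MvPolynomial.X Coord.lam ^ ((j : ℤ) / 2).toNat
  else MvPolynomial.X (Coord.odd ⟨((j : ℤ) / 2).toNat, by
    obtain ⟨j, hj, h0⟩ := j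
    change ¬ Even j at h
    change n ≤ (j / 2).toNat
    rw [Int.not_even_iff] at h
    rcases hj with hj | ⟨-, hj⟩
    · push_cast at hj; omega
    · rw [Int.even_iff] at hj; push_cast at hj; omega⟩)

/-- The quadrics `p_j p_k - ∑_l C_{jk}^l p_l`, where the constants `C_{jk}^l` are those for which
the Laurent series satisfy `p_j(z) p_k(z) = ∑_l C_{jk}^l p_l(z)`. -/
def relationSet (n : ℕ) (H : ℤ → ℤ → ℂ) : Set (MvPolynomial (Coord n) ℂ) :=
  {F | ∃ (j k : nonnegOrders n) (c : nonnegOrders n →₀ ℂ),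
    canonicalSeries n H j * canonicalSeries n H k =
      c.sum (fun l a => a • canonicalSeries n H l) ∧
    F = coordFun n j * coordFun n k - c.sum (fun l a => a • coordFun n l)}

/-- The variety `Γ_{2n}` at fixed parameters: the common zeros of these quadrics. -/
def gammaVariety (n : ℕ) (H : ℤ → ℤ → ℂ) : Set (Coord n → ℂ) :=
  {x | ∀ F ∈ relationSet n H, MvPolynomial.eval x F = 0}

/-- The values of the coordinates as Laurent series: `λ = z ^ 2`, `p_{2m+1} = p_{2m+1}(z)`. -/
def coordSeries (n : ℕ) (H : ℤ → ℤ → ℂ) : Coord n → LaurentSeries ℂ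
  | Coord.lam => zPow 2
  | Coord.odd m => canonicalSeries n H (2 * (m : ℕ) + 1)

/-- `⟨C_{2n+1}, p_{2m+1} - α_m(λ) p_{2n+1} (m > n)⟩`. -/
def curveIdeal (n : ℕ) (H : ℤ → ℤ → ℂ) (α : ℕ → Polynomial ℂ) :
    Ideal (MvPolynomial (Coord n) ℂ) :=
  Ideal.span
    ({MvPolynomial.X (Coord.odd ⟨n, le_rfl⟩) ^ 2 -
        Polynomial.aeval (MvPolynomial.X Coord.lam) (branchPoly n H)} ∪
      {F | ∃ m : {m : ℕ // n ≤ m}, n < m ∧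
        F = MvPolynomial.X (Coord.odd m) -
          Polynomial.aeval (MvPolynomial.X Coord.lam) (α m) *
            MvPolynomial.X (Coord.odd ⟨n, le_rfl⟩)})

/-! ### Genus -/

/-- The affine plane curve `F = 0` has no singular point. -/
def IsNonsingularCurve (F : MvPolynomial (Fin 2) ℂ) : Prop :=
  ∀ x : Fin 2 → ℂ, MvPolynomial.eval x F = 0 →
    ∃ i, MvPolynomial.eval x (MvPolynomial.pderiv i F) ≠ 0

open scoped KaehlerDifferential in
/-- The everywhere regular differentials of a function field `K` over `ℂ`: those `ω ∈ Ω_{K/ℂ}`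
that lie, for every valuation ring `ℂ ⊆ O ⊆ K`, in the image of `Ω_{O/ℂ}`, the `O`-span of the
differentials of elements of `O`. (For a function field in one variable the rings `O ≠ K` are the
local rings of the points of the smooth projective model.) -/
def regularDifferentials (K : Type*) [Field K] [Algebra ℂ K] : Submodule ℂ (Ω[K⁄ℂ]) where
  carrier := {ω | ∀ O : ValuationSubring K, (∀ c : ℂ, algebraMap ℂ K c ∈ O) →
    ω ∈ Submodule.span O.toSubring (KaehlerDifferential.D ℂ K '' (O : Set K))}
  zero_mem' := fun _ _ => Submodule.zero_mem _
  add_mem' := fun h₁ h₂ O hO => Submodule.add_mem _ (h₁ O hO) (h₂ O hO)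
  smul_mem' := fun c ω h O hO => by
    have := Submodule.smul_mem _ (⟨algebraMap ℂ K c, hO c⟩ : O.toSubring) (h O hO)
    have e : (⟨algebraMap ℂ K c, hO c⟩ : O.toSubring) • ω = c • ω :=
      algebraMap_smul K c ω
    rwa [e] at this

/-- The (geometric) genus of a function field: the dimension of its space of regular
differentials. -/
def geometricGenus (K : Type*) [Field K] [Algebra ℂ K] : ℕ :=
  Module.finrank ℂ (regularDifferentials K)

/-- `K` is the function field of a hyperelliptic curve of genus `g`: `g ≥ 2`, the genus is `g`,
and `K` is a quadratic extension of a rational function field `ℂ(x)`. -/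
def IsHyperellipticOfGenus (K : Type*) [Field K] [Algebra ℂ K] (g : ℕ) : Prop :=
  2 ≤ g ∧ geometricGenus K = g ∧
    ∃ x : K, Transcendental ℂ x ∧ Module.finrank (IntermediateField.adjoin ℂ {x}) K = 2

/-- `dim H¹(X, 𝒪)` of an integral separated curve `X` covered by two affine open subsets, whose
coordinate rings `A` and `B` are given inside the function field: the first Čech cohomology
`𝒪(U ∩ V) / (𝒪(U) + 𝒪(V))`, where `𝒪(U ∩ V)` is generated by `A` and `B`. -/
def cechGenus {K : Type*} [Field K] [Algebra ℂ K] (A B : Subalgebra ℂ K) : ℕ :=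
  Module.finrank ℂ
    ((Subalgebra.toSubmodule (A ⊔ B)) ⧸
      (Subalgebra.toSubmodule A ⊔ Subalgebra.toSubmodule B).submoduleOf
        (Subalgebra.toSubmodule (A ⊔ B)))

/-- The arithmetic genus of the completed curve `y ^ 2 = P(x)`, `deg P ∈ {2n+1, 2n+2}`: its affine
charts have the coordinates `x, y` and `1 / x, y / x ^ (n+1)`. -/
def doubleCoverArithmeticGenus {K : Type*} [Field K] [Algebra ℂ K] (n : ℕ) (x y : K) : ℕ :=
  cechGenus (Algebra.adjoin ℂ {x, y}) (Algebra.adjoin ℂ {x⁻¹, y * x⁻¹ ^ (n + 1)})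

end

/-!
A space `U` with `z² U ⊆ U`, `U U ⊆ U` and orders `T` contains `1`, hence `ℂ[z²]`, so it is
`ℂ[z²] ⊕ ℂ[z²] q` with `q` the reduced series of order `2n + 1`. Splitting `q² ∈ U` into parts even
and odd in `z` forces `q` to be odd, and conversely every odd `q` for which `q²` is a polynomial in
`z²` gives such a space. The constraints on `H` express exactly that: the linear ones give
`p_{2m} = z^{2m}` and the oddness of `q = p_{2n+1}`, the first quadratic family says that the
`p_{2m+1}` are polynomial multiples of `q`, the second that `q²` has no negative powers of `z`.
Writing `q = z^{2n+1} (1 + …)`, the latter determines all coefficients of the square root `q` from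
the first `2n + 1` of them, which are free.

The function field is `ℂ(x, w)` with `w² = P(x)`. Writing `P = R² Q` with `Q` squarefree and
replacing `w` by `w / R`, the ring `ℂ[x, w]` becomes integrally closed, and the regular
differentials are the `a(x) dx / w` with `2 deg a + 2 < deg Q`: regularity over the finite part
bounds the denominator, the same statement in the coordinates `1 / x` bounds the degree. So the
genus is `n - deg R`, and it equals `n` exactly when `P` is squarefree.
-/

section Coefficients

lemma order_eq_of_coeff_ne_zero {Γ R : Type*} [LinearOrder Γ] [Zero Γ] [Zero R]
    {x : HahnSeries Γ R} {a : Γ} (ha : x.coeff a ≠ 0) (h : ∀ k < a, x.coeff k = 0) :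
    x.order = a :=
  le_antisymm (HahnSeries.order_le_of_coeff_ne_zero ha)
    ((HahnSeries.le_order_iff_forall (HahnSeries.ne_zero_of_coeff_ne_zero ha)).2 h)

lemma orderTop_add_eq_min_of_ne {Γ R : Type*} [LinearOrder Γ] [AddMonoid R]
    {x y : HahnSeries Γ R} (h : x.orderTop ≠ y.orderTop) :
    (x + y).orderTop = min x.orderTop y.orderTop := by
  rcases h.lt_or_gt with h | h
  · rw [HahnSeries.orderTop_add_eq_left h, min_eq_left h.le]
  · rw [HahnSeries.orderTop_add_eq_right h, min_eq_right h.le]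

lemma order_add_eq_left_of_orderTop_lt {Γ R : Type*} [LinearOrder Γ] [Zero Γ] [AddMonoid R]
    {x y : HahnSeries Γ R} (h : x.orderTop < y.orderTop) : (x + y).order = x.order := by
  have hadd := HahnSeries.orderTop_add_eq_left h
  have hx : x ≠ 0 := HahnSeries.orderTop_ne_top.1 h.ne_top
  have hxy : x + y ≠ 0 := HahnSeries.orderTop_ne_top.1 (hadd ▸ h.ne_top)
  rw [← HahnSeries.order_eq_orderTop_of_ne_zero hxy,
    ← HahnSeries.order_eq_orderTop_of_ne_zero hx] at hadd
  exact WithTop.coe_injective hadd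

lemma coeff_mul_eq_sum_Icc {R : Type*} [Semiring R] {f g : LaurentSeries R} {a b : ℤ}
    (hf : ∀ k < a, f.coeff k = 0) (hg : ∀ k < b, g.coeff k = 0) (m : ℤ) :
    (f * g).coeff m = ∑ i ∈ Finset.Icc a (m - b), f.coeff i * g.coeff (m - i) := by
  classical
  rw [HahnSeries.coeff_mul]
  refine Finset.sum_of_injOn Prod.fst ?_ ?_ ?_ ?_
  · rintro ⟨i, j⟩ h ⟨i', j'⟩ h' (rfl : i = i')
    simp only [Finset.mem_coe, Finset.mem_antidiagonal] at h h'
    exact Prod.ext rfl (add_left_cancel (h.2.2.trans h'.2.2.symm))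
  · rintro ⟨i, j⟩ h
    simp only [Finset.mem_coe, Finset.mem_antidiagonal, HahnSeries.mem_support] at h
    have hi : a ≤ i := not_lt.1 fun hlt => h.1 (hf i hlt)
    have hj : b ≤ j := not_lt.1 fun hlt => h.2.1 (hg j hlt)
    exact Finset.mem_coe.2 (Finset.mem_Icc.2 ⟨hi, by omega⟩)
  · intro i _ hi
    by_contra hne
    refine hi ⟨(i, m - i), ?_, rfl⟩
    simp only [Finset.mem_coe, Finset.mem_antidiagonal, HahnSeries.mem_support]
    exact ⟨left_ne_zero_of_mul hne, right_ne_zero_of_mul hne, by omega⟩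
  · rintro ⟨i, j⟩ h
    rw [← (Finset.mem_antidiagonal.1 h).2.2, add_sub_cancel_left]

end Coefficients

section Parity

variable {R : Type*} [CommRing R]

lemma bddBelow_support_negOnePow_mul_coeff (f : LaurentSeries R) :
    BddBelow (Function.support fun k : ℤ => ((k.negOnePow : ℤ) : R) * f.coeff k) :=
  ⟨f.order, fun k (hk : ((k.negOnePow : ℤ) : R) * f.coeff k ≠ 0) =>
    HahnSeries.order_le_of_coeff_ne_zero (right_ne_zero_of_mul hk)⟩

/-- The ring endomorphism `f(z) ↦ f(-z)` of Laurent series, whose eigenspaces `f(-z) = f(z)` and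
`f(-z) = -f(z)` are the even and the odd series. -/
noncomputable def evalNeg : LaurentSeries R →+* LaurentSeries R where
  toFun f := HahnSeries.ofSuppBddBelow (fun k : ℤ => ((k.negOnePow : ℤ) : R) * f.coeff k)
    (bddBelow_support_negOnePow_mul_coeff f)
  map_one' := by
    ext k
    rw [HahnSeries.coeff_ofSuppBddBelow, HahnSeries.coeff_one]
    split_ifs with h
    · simp [h]
    · rw [mul_zero]
  map_zero' := by ext k; simp
  map_add' f g := by ext k; simp [mul_add]
  map_mul' f g := by
    have hf : ∀ k < f.order, f.coeff k = 0 := fun _ => HahnSeries.coeff_eq_zero_of_lt_order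
    have hg : ∀ k < g.order, g.coeff k = 0 := fun _ => HahnSeries.coeff_eq_zero_of_lt_order
    ext k
    rw [HahnSeries.coeff_ofSuppBddBelow, coeff_mul_eq_sum_Icc hf hg,
      coeff_mul_eq_sum_Icc (a := f.order) (b := g.order)
        (fun k hk => by rw [HahnSeries.coeff_ofSuppBddBelow, hf k hk, mul_zero])
        (fun k hk => by rw [HahnSeries.coeff_ofSuppBddBelow, hg k hk, mul_zero]),
      Finset.mul_sum]
    refine Finset.sum_congr rfl fun i _ => ?_
    have hsign : k.negOnePow = i.negOnePow * (k - i).negOnePow := by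
      rw [← Int.negOnePow_add, add_sub_cancel]
    simp only [HahnSeries.coeff_ofSuppBddBelow, hsign, Units.val_mul, Int.cast_mul]
    ring

lemma coeff_evalNeg (f : LaurentSeries R) (k : ℤ) :
    (evalNeg f).coeff k = ((k.negOnePow : ℤ) : R) * f.coeff k := rfl

lemma coeff_evalNeg_of_even (f : LaurentSeries R) {k : ℤ} (hk : Even k) :
    (evalNeg f).coeff k = f.coeff k := by
  rw [coeff_evalNeg, Int.negOnePow_even k hk, Units.val_one, Int.cast_one, one_mul]

lemma coeff_evalNeg_of_odd (f : LaurentSeries R) {k : ℤ} (hk : Odd k) :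
    (evalNeg f).coeff k = -f.coeff k := by
  rw [coeff_evalNeg, Int.negOnePow_odd k hk, Units.val_neg, Units.val_one, Int.cast_neg,
    Int.cast_one, neg_one_mul]

lemma evalNeg_eq_self_iff [IsAddTorsionFree R] {f : LaurentSeries R} :
    evalNeg f = f ↔ ∀ k, Odd k → f.coeff k = 0 := by
  refine ⟨fun h k hk => self_eq_neg.1 ?_, fun h => ?_⟩
  · rw [← coeff_evalNeg_of_odd f hk, h]
  · ext k
    rcases Int.even_or_odd k with hk | hk
    · exact coeff_evalNeg_of_even f hk
    · rw [coeff_evalNeg_of_odd f hk, h k hk, neg_zero]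

lemma evalNeg_eq_neg_iff [IsAddTorsionFree R] {f : LaurentSeries R} :
    evalNeg f = -f ↔ ∀ k, Even k → f.coeff k = 0 := by
  refine ⟨fun h k hk => neg_eq_self.1 ?_, fun h => ?_⟩
  · rw [← HahnSeries.coeff_neg, ← h, coeff_evalNeg_of_even f hk]
  · ext k
    rcases Int.even_or_odd k with hk | hk
    · rw [coeff_evalNeg_of_even f hk, HahnSeries.coeff_neg, h k hk, neg_zero]
    · rw [coeff_evalNeg_of_odd f hk, HahnSeries.coeff_neg]

end Parity

section EvenPolynomials

open Polynomial

lemma coeff_zPow (a k : ℤ) : (zPow a).coeff k = if k = -a then 1 else 0 := by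
  rw [zPow, HahnSeries.coeff_single]
  congr

lemma zPow_mul_zPow (a b : ℤ) : zPow a * zPow b = zPow (a + b) := by
  rw [zPow, zPow, zPow, HahnSeries.single_mul_single, one_mul, neg_add]

lemma zPow_zero : zPow 0 = 1 := by
  rw [zPow, neg_zero, HahnSeries.single_zero_one]

lemma zPow_pow (a : ℤ) (m : ℕ) : zPow a ^ m = zPow (a * m) := by
  rw [zPow, zPow, HahnSeries.single_pow, one_pow, nsmul_eq_mul, mul_neg, mul_comm]

lemma coeff_zPow_mul (a : ℤ) (f : LaurentSeries ℂ) (k : ℤ) :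
    (zPow a * f).coeff k = f.coeff (k + a) := by
  rw [zPow, HahnSeries.coeff_single_mul, one_mul, sub_neg_eq_add]

lemma zPow_ne_zero (a : ℤ) : zPow a ≠ 0 := HahnSeries.single_ne_zero one_ne_zero

lemma order_zPow (a : ℤ) : (zPow a).order = -a := HahnSeries.order_single one_ne_zero

lemma aeval_zPow_two_monomial (i : ℕ) (c : ℂ) :
    aeval (zPow 2) (monomial i c) = HahnSeries.single (-(2 * (i : ℤ))) c := by
  rw [aeval_monomial, zPow_pow, ← Algebra.smul_def, zPow]
  ext k
  rw [HahnSeries.coeff_smul, HahnSeries.coeff_single, HahnSeries.coeff_single, smul_eq_mul,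
    mul_ite, mul_one, mul_zero]

lemma coeff_aeval_zPow_two (a : ℂ[X]) (i : ℕ) :
    (aeval (zPow 2) a).coeff (-(2 * (i : ℤ))) = a.coeff i := by
  induction a using Polynomial.induction_on' with
  | add a b ha hb => rw [map_add, HahnSeries.coeff_add, ha, hb, coeff_add]
  | monomial m c =>
    rw [aeval_zPow_two_monomial, coeff_monomial]
    split_ifs with h
    · rw [h, HahnSeries.coeff_single_same]
    · exact HahnSeries.coeff_single_of_ne (by omega)

lemma coeff_aeval_zPow_two_eq_zero (a : ℂ[X]) {k : ℤ} (hk : ∀ i : ℕ, k ≠ -(2 * i)) :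
    (aeval (zPow 2) a).coeff k = 0 := by
  induction a using Polynomial.induction_on' with
  | add a b ha hb => rw [map_add, HahnSeries.coeff_add, ha, hb, add_zero]
  | monomial m c =>
    rw [aeval_zPow_two_monomial, HahnSeries.coeff_single_of_ne (hk m)]

lemma evalNeg_aeval_zPow_two (a : ℂ[X]) : evalNeg (aeval (zPow 2) a) = aeval (zPow 2) a :=
  evalNeg_eq_self_iff.2 fun _ ⟨_, hk⟩ => coeff_aeval_zPow_two_eq_zero a fun _ => by omega

lemma eq_aeval_zPow_two_iff {f : LaurentSeries ℂ} (hf : evalNeg f = f)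
    (hpos : ∀ k : ℤ, 0 < k → f.coeff k = 0) {P : ℂ[X]} :
    f = aeval (zPow 2) P ↔ ∀ i : ℕ, f.coeff (-(2 * (i : ℤ))) = P.coeff i := by
  refine ⟨fun h i => by rw [h, coeff_aeval_zPow_two], fun h => ?_⟩
  ext k
  by_cases hk : ∃ i : ℕ, k = -(2 * i)
  · obtain ⟨i, rfl⟩ := hk
    rw [h, coeff_aeval_zPow_two]
  · push Not at hk
    rw [coeff_aeval_zPow_two_eq_zero P hk]
    rcases Int.even_or_odd' k with ⟨r, rfl | rfl⟩
    · exact hpos _ (not_le.1 fun hr => hk (-r).toNat (by omega))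
    · exact evalNeg_eq_self_iff.1 hf _ (odd_two_mul_add_one r)

lemma exists_eq_aeval_zPow_two {f : LaurentSeries ℂ} (hf : evalNeg f = f)
    (hpos : ∀ k : ℤ, 0 < k → f.coeff k = 0) : ∃ P : ℂ[X], f = aeval (zPow 2) P := by
  refine ⟨∑ i ∈ Finset.range ((-f.order).toNat + 1), monomial i (f.coeff (-(2 * (i : ℤ)))),
    (eq_aeval_zPow_two_iff hf hpos).2 fun i => ?_⟩
  simp only [finsetSum_coeff, coeff_monomial, Finset.sum_ite_eq', Finset.mem_range]
  split_ifs with hi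
  · rfl
  · exact HahnSeries.coeff_eq_zero_of_lt_order (by omega)

lemma order_aeval_zPow_two {a : ℂ[X]} (ha : a ≠ 0) :
    (aeval (zPow 2) a).order = -(2 * (a.natDegree : ℤ)) := by
  refine order_eq_of_coeff_ne_zero ?_ fun k hk => ?_
  · rwa [coeff_aeval_zPow_two, coeff_natDegree, leadingCoeff_ne_zero]
  · by_cases h : ∃ i : ℕ, k = -(2 * i)
    · obtain ⟨i, rfl⟩ := h
      rw [coeff_aeval_zPow_two, coeff_eq_zero_of_natDegree_lt (by omega)]
    · exact coeff_aeval_zPow_two_eq_zero a (not_exists.1 h)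

lemma aeval_zPow_two_ne_zero {a : ℂ[X]} (ha : a ≠ 0) : aeval (zPow 2) a ≠ 0 := fun h =>
  leadingCoeff_ne_zero.2 ha <| by
    rw [← coeff_natDegree, ← coeff_aeval_zPow_two, h, HahnSeries.coeff_zero]

lemma order_aeval_zPow_two_mul {a : ℂ[X]} (ha : a ≠ 0) {f : LaurentSeries ℂ} (hf : f ≠ 0) :
    (aeval (zPow 2) a * f).order = f.order - 2 * a.natDegree := by
  rw [HahnSeries.order_mul (aeval_zPow_two_ne_zero ha) hf, order_aeval_zPow_two ha, neg_add_eq_sub]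

/-- If the orders of `e` and `q` differ in parity, then so do those of `a(z²) e` and `b(z²) q`, so
that there is no cancellation of leading terms. -/
lemma orderTop_aeval_mul_ne {e q : LaurentSeries ℂ} (he : e ≠ 0) (hq : q ≠ 0)
    (hpar : Odd (e.order - q.order)) {a b : ℂ[X]} (hab : a ≠ 0 ∨ b ≠ 0) :
    (aeval (zPow 2) a * e).orderTop ≠ (aeval (zPow 2) b * q).orderTop := by
  by_cases ha : a = 0
  · have hb : b ≠ 0 := hab.resolve_left (not_not.2 ha)
    rw [ha, map_zero, zero_mul, HahnSeries.orderTop_zero]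
    exact (HahnSeries.orderTop_ne_top.2 (mul_ne_zero (aeval_zPow_two_ne_zero hb) hq)).symm
  have hae := mul_ne_zero (aeval_zPow_two_ne_zero ha) he
  by_cases hb : b = 0
  · rw [hb, map_zero, zero_mul, HahnSeries.orderTop_zero]
    exact HahnSeries.orderTop_ne_top.2 hae
  · rw [← HahnSeries.order_eq_orderTop_of_ne_zero hae, ← HahnSeries.order_eq_orderTop_of_ne_zero
      (mul_ne_zero (aeval_zPow_two_ne_zero hb) hq), order_aeval_zPow_two_mul ha he,
      order_aeval_zPow_two_mul hb hq]
    obtain ⟨r, hr⟩ := hpar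
    exact fun h => by have := WithTop.coe_injective h; omega

lemma eq_zero_of_aeval_mul_add_aeval_mul_eq_zero {e q : LaurentSeries ℂ} (he : e ≠ 0) (hq : q ≠ 0)
    (hpar : Odd (e.order - q.order)) {a b : ℂ[X]}
    (h : aeval (zPow 2) a * e + aeval (zPow 2) b * q = 0) : a = 0 ∧ b = 0 := by
  by_contra hab
  have hne := orderTop_aeval_mul_ne he hq hpar (not_and_or.1 hab)
  have hmin := orderTop_add_eq_min_of_ne hne
  rw [h, HahnSeries.orderTop_zero, eq_comm, min_eq_top] at hmin
  exact hne (hmin.1.trans hmin.2.symm)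

end EvenPolynomials

section Orders

lemma eq_zero_of_mem_of_coeff_eq_zero {U : Submodule ℂ (LaurentSeries ℂ)} {f : LaurentSeries ℂ}
    (hf : f ∈ U) (h : ∀ k ∈ zOrders U, f.coeff (-k) = 0) : f = 0 := by
  by_contra hf0
  have hc := h (-f.order) ⟨f, hf, hf0, rfl⟩
  rw [neg_neg] at hc
  exact hf0 (HahnSeries.coeff_order_eq_zero.1 hc)

lemma exists_mem_forall_coeff_sub_eq_zero (U : Submodule ℂ (LaurentSeries ℂ))
    (f : LaurentSeries ℂ) (M : ℤ) :
    ∃ u ∈ U, ∀ k < M, -k ∈ zOrders U → (f - u).coeff k = 0 := by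
  rcases le_total M f.order with hM | hM
  · refine ⟨0, U.zero_mem, fun k hk _ => ?_⟩
    rw [sub_zero, HahnSeries.coeff_eq_zero_of_lt_order (hk.trans_le hM)]
  induction M, hM using Int.leInduction with
  | base =>
    refine ⟨0, U.zero_mem, fun k hk _ => ?_⟩
    rw [sub_zero, HahnSeries.coeff_eq_zero_of_lt_order hk]
  | succ M _ ih =>
    obtain ⟨u, hu, hfu⟩ := ih
    by_cases hM : -M ∈ zOrders U
    · obtain ⟨g, hg, hg0, hgM⟩ := hM
      obtain rfl : g.order = M := neg_injective hgM
      refine ⟨u + ((f - u).coeff g.order / g.coeff g.order) • g,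
        U.add_mem hu (U.smul_mem _ hg), fun k hk hkU => ?_⟩
      rw [← sub_sub, HahnSeries.coeff_sub, HahnSeries.coeff_smul, smul_eq_mul]
      rcases (Int.lt_add_one_iff.1 hk).lt_or_eq with hlt | rfl
      · rw [hfu k hlt hkU, HahnSeries.coeff_eq_zero_of_lt_order hlt, mul_zero, sub_zero]
      · rw [div_mul_cancel₀ _ (HahnSeries.coeff_order_eq_zero.not.2 hg0), sub_self]
    · refine ⟨u, hu, fun k hk hkU => hfu k ((Int.lt_add_one_iff.1 hk).lt_of_ne ?_) hkU⟩
      rintro rfl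
      exact hM hkU

lemma exists_mem_forall_coeff_eq {U : Submodule ℂ (LaurentSeries ℂ)} (hU : BddBelow (zOrders U))
    (f : LaurentSeries ℂ) : ∃ u ∈ U, ∀ k ∈ zOrders U, u.coeff (-k) = f.coeff (-k) := by
  obtain ⟨N, hN⟩ := hU
  obtain ⟨u, hu, h⟩ := exists_mem_forall_coeff_sub_eq_zero U f (-N + 1)
  refine ⟨u, hu, fun k hk => ?_⟩
  have h0 := h (-k) (by have := hN hk; omega) (by rwa [neg_neg])
  rw [HahnSeries.coeff_sub, sub_eq_zero] at h0
  exact h0.symm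

lemma eq_of_le_of_zOrders_subset {U A : Submodule ℂ (LaurentSeries ℂ)} (hUA : U ≤ A)
    (h : zOrders A ⊆ zOrders U) (hU : BddBelow (zOrders U)) : A = U := by
  refine le_antisymm (fun f hf => ?_) hUA
  obtain ⟨u, hu, hfu⟩ := exists_mem_forall_coeff_eq hU f
  have h0 : f - u = 0 := eq_zero_of_mem_of_coeff_eq_zero (A.sub_mem hf (hUA hu)) fun k hk => by
    rw [HahnSeries.coeff_sub, hfu k (h hk), sub_self]
  rwa [sub_eq_zero.1 h0]

end Orders

section ReducedSeries

variable {T : Set ℤ} {j : ℤ} {f g : LaurentSeries ℂ}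

/-- A series `z ^ j + ∑ c_k z ^ k`, where the sum runs over exponents `k < j` outside `T`. The
elements of this kind form the reduced echelon basis of a subspace with set of orders `T`. -/
def IsReducedSeries (T : Set ℤ) (j : ℤ) (f : LaurentSeries ℂ) : Prop :=
  f.coeff (-j) = 1 ∧ (∀ k < -j, f.coeff k = 0) ∧ ∀ i ∈ T, i ≠ j → f.coeff (-i) = 0

lemma IsReducedSeries.ne_zero (hf : IsReducedSeries T j f) : f ≠ 0 :=
  HahnSeries.ne_zero_of_coeff_ne_zero (hf.1.symm ▸ one_ne_zero)

lemma IsReducedSeries.order (hf : IsReducedSeries T j f) : f.order = -j :=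
  order_eq_of_coeff_ne_zero (hf.1.symm ▸ one_ne_zero) hf.2.1

lemma IsReducedSeries.coeff_neg_eq (hf : IsReducedSeries T j f) (hg : IsReducedSeries T j g) {i : ℤ}
    (hi : i ∈ T) : f.coeff (-i) = g.coeff (-i) := by
  obtain rfl | hij := eq_or_ne i j
  · rw [hf.1, hg.1]
  · rw [hf.2.2 i hi hij, hg.2.2 i hi hij]

lemma eq_of_mem_of_isReducedSeries {U : Submodule ℂ (LaurentSeries ℂ)} (hfU : f ∈ U) (hgU : g ∈ U)
    (hf : IsReducedSeries (zOrders U) j f) (hg : IsReducedSeries (zOrders U) j g) : f = g :=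
  sub_eq_zero.1 <| eq_zero_of_mem_of_coeff_eq_zero (U.sub_mem hfU hgU) fun i hi => by
    rw [HahnSeries.coeff_sub, hf.coeff_neg_eq hg hi, sub_self]

lemma exists_mem_isReducedSeries {U : Submodule ℂ (LaurentSeries ℂ)} (hU : BddBelow (zOrders U))
    (hj : j ∈ zOrders U) : ∃ f ∈ U, IsReducedSeries (zOrders U) j f := by
  obtain ⟨f, hf, hfj⟩ := exists_mem_forall_coeff_eq hU (zPow j)
  have h1 : f.coeff (-j) = 1 := by rw [hfj j hj, coeff_zPow, if_pos rfl]
  have hT : ∀ i ∈ zOrders U, i ≠ j → f.coeff (-i) = 0 := fun i hi hij => by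
    rw [hfj i hi, coeff_zPow, if_neg (neg_injective.ne hij)]
  have hf0 : f ≠ 0 := HahnSeries.ne_zero_of_coeff_ne_zero (h1.symm ▸ one_ne_zero)
  have hord : -f.order = j := by
    by_contra hne
    refine HahnSeries.coeff_order_eq_zero.not.2 hf0 ?_
    rw [← neg_neg f.order]
    exact hT _ ⟨f, hf, hf0, rfl⟩ hne
  exact ⟨f, hf, h1, fun k hk => HahnSeries.coeff_eq_zero_of_lt_order (by omega), hT⟩

variable {p : T → LaurentSeries ℂ}

lemma coeff_linearCombination_of_isReducedSeries (hp : ∀ j : T, IsReducedSeries T j (p j))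
    (c : T →₀ ℂ) (i : T) : (Finsupp.linearCombination ℂ p c).coeff (-(i : ℤ)) = c i := by
  rw [Finsupp.linearCombination_apply, Finsupp.sum, HahnSeries.coeff_sum, Finset.sum_eq_single i]
  · rw [HahnSeries.coeff_smul, (hp i).1, smul_eq_mul, mul_one]
  · intro j _ hj
    rw [HahnSeries.coeff_smul, (hp j).2.2 i i.2 (Subtype.coe_ne_coe.2 hj.symm), smul_zero]
  · intro hi
    rw [Finsupp.notMem_support_iff.1 hi, zero_smul, HahnSeries.coeff_zero]

lemma linearIndependent_of_isReducedSeries (hp : ∀ j : T, IsReducedSeries T j (p j)) :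
    LinearIndependent ℂ p := by
  refine linearIndependent_iff.2 fun c hc => Finsupp.ext fun i => ?_
  rw [← coeff_linearCombination_of_isReducedSeries hp c i, hc, HahnSeries.coeff_zero,
    Finsupp.coe_zero, Pi.zero_apply]

lemma zOrders_span_of_isReducedSeries (hp : ∀ j : T, IsReducedSeries T j (p j)) :
    zOrders (Submodule.span ℂ (Set.range p)) = T := by
  refine Set.Subset.antisymm ?_ fun k hk =>
    ⟨p ⟨k, hk⟩, Submodule.subset_span ⟨_, rfl⟩, (hp _).ne_zero, by rw [(hp _).order, neg_neg]⟩
  rintro _ ⟨f, hf, hf0, rfl⟩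
  rw [← Finsupp.range_linearCombination] at hf
  obtain ⟨c, rfl⟩ := hf
  have hc : c.support.Nonempty :=
    Finsupp.support_nonempty_iff.2 fun h => hf0 (by rw [h, map_zero])
  obtain ⟨i, hi, hmax⟩ := c.support.exists_max_image (fun j => (j : ℤ)) hc
  have hord : (Finsupp.linearCombination ℂ p c).order = -(i : ℤ) := by
    refine order_eq_of_coeff_ne_zero ?_ fun k hk => ?_
    · rw [coeff_linearCombination_of_isReducedSeries hp]
      exact Finsupp.mem_support_iff.1 hi
    · rw [Finsupp.linearCombination_apply, Finsupp.sum, HahnSeries.coeff_sum]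
      refine Finset.sum_eq_zero fun j hj => ?_
      rw [HahnSeries.coeff_smul, (hp j).2.1 k (by have := hmax j hj; omega), smul_zero]
  rw [hord, neg_neg]
  exact i.2

end ReducedSeries

section CanonicalSeries

variable {n : ℕ} {H : ℤ → ℤ → ℂ} {j : ℤ}

lemma mem_nonnegOrders {k : ℤ} : k ∈ nonnegOrders n ↔ 0 ≤ k ∧ (2 * (n : ℤ) ≤ k ∨ Even k) := by
  simp only [nonnegOrders, orderSet, Set.mem_ofPred_eq, Nat.cast_mul, Nat.cast_ofNat,
    Int.even_iff]
  omega

lemma two_mul_mem_nonnegOrders (n m : ℕ) : (2 * (m : ℤ)) ∈ nonnegOrders n :=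
  mem_nonnegOrders.2 ⟨by omega, Or.inr (even_two_mul _)⟩

lemma two_mul_add_one_mem_nonnegOrders {m : ℕ} (h : n ≤ m) :
    (2 * (m : ℤ) + 1) ∈ nonnegOrders n :=
  mem_nonnegOrders.2 ⟨by omega, Or.inl (by omega)⟩

lemma eq_two_mul_or_eq_two_mul_add_one_of_mem_nonnegOrders (hj : j ∈ nonnegOrders n) :
    (∃ m : ℕ, j = 2 * m) ∨ ∃ m : ℕ, n ≤ m ∧ j = 2 * m + 1 := by
  rw [mem_nonnegOrders, Int.even_iff] at hj
  rcases Int.even_or_odd' j with ⟨m, rfl | rfl⟩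
  · exact Or.inl ⟨m.toNat, by omega⟩
  · exact Or.inr ⟨m.toNat, by omega, by omega⟩

lemma bddBelow_nonnegOrders (n : ℕ) : BddBelow (nonnegOrders n) := ⟨0, fun _ hk => hk.2⟩

lemma coeff_canonicalSeries (n : ℕ) (H : ℤ → ℤ → ℂ) (j k : ℤ)
    [Decidable (-k ∉ nonnegOrders n ∧ -k < j)] :
    (canonicalSeries n H j).coeff k =
      if k = -j then 1 else if -k ∉ nonnegOrders n ∧ -k < j then H j k else 0 := by
  change (if k = -j then 1 else _) = _
  congr

lemma isReducedSeries_canonicalSeries (n : ℕ) (H : ℤ → ℤ → ℂ) (j : ℤ) :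
    IsReducedSeries (nonnegOrders n) j (canonicalSeries n H j) := by
  classical
  refine ⟨?_, fun k hk => ?_, fun i hi hij => ?_⟩
  · rw [coeff_canonicalSeries, if_pos rfl]
  · rw [coeff_canonicalSeries, if_neg hk.ne, if_neg (by omega)]
  · rw [coeff_canonicalSeries, if_neg (neg_injective.ne hij), neg_neg, if_neg fun h => h.1 hi]

lemma IsReducedSeries.eq_canonicalSeries {f : LaurentSeries ℂ}
    (hf : IsReducedSeries (nonnegOrders n) j f)
    (h : ∀ k, -k ∉ nonnegOrders n → -k < j → f.coeff k = H j k) : f = canonicalSeries n H j := by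
  classical
  ext k
  rw [coeff_canonicalSeries]
  split_ifs with hkj hk
  · rw [hkj, hf.1]
  · exact h k hk.1 hk.2
  · rcases lt_or_ge k (-j) with hlt | hle
    · exact hf.2.1 k hlt
    · have hkT : -k ∈ nonnegOrders n := by_contra fun hkT => hk ⟨hkT, by omega⟩
      rw [← neg_neg k]
      exact hf.2.2 _ hkT (by omega)

lemma canonicalSeries_mem_spanSeries (hj : j ∈ nonnegOrders n) :
    canonicalSeries n H j ∈ spanSeries n H :=
  Submodule.subset_span ⟨⟨j, hj⟩, rfl⟩

lemma linearIndependent_canonicalSeries (n : ℕ) (H : ℤ → ℤ → ℂ) :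
    LinearIndependent ℂ (fun j : nonnegOrders n => canonicalSeries n H j) :=
  linearIndependent_of_isReducedSeries fun j => isReducedSeries_canonicalSeries n H j

lemma zOrders_spanSeries (n : ℕ) (H : ℤ → ℤ → ℂ) : zOrders (spanSeries n H) = nonnegOrders n :=
  zOrders_span_of_isReducedSeries fun j => isReducedSeries_canonicalSeries n H j

lemma eq_of_mem_spanSeries {f g : LaurentSeries ℂ} (hf : f ∈ spanSeries n H)
    (hg : g ∈ spanSeries n H) (h : ∀ i ∈ nonnegOrders n, f.coeff (-i) = g.coeff (-i)) : f = g :=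
  sub_eq_zero.1 <| eq_zero_of_mem_of_coeff_eq_zero (Submodule.sub_mem _ hf hg) fun i hi => by
    rw [zOrders_spanSeries] at hi
    rw [HahnSeries.coeff_sub, h i hi, sub_self]

end CanonicalSeries

section QuadSpan

open Polynomial

lemma mul_self_le_iff {U : Submodule ℂ (LaurentSeries ℂ)} :
    U * U ≤ U ↔ ∀ f ∈ U, ∀ g ∈ U, f * g ∈ U :=
  haveI : IsScalarTower ℂ (LaurentSeries ℂ) (LaurentSeries ℂ) :=
    @IsScalarTower.right ℂ (LaurentSeries ℂ) _ _ laurentAlgebra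
  haveI : SMulCommClass ℂ (LaurentSeries ℂ) (LaurentSeries ℂ) :=
    @Algebra.to_smulCommClass ℂ (LaurentSeries ℂ) _ _ laurentAlgebra
  Submodule.mul_le

/-- `Algebra.smul_def` does not rewrite here, because the two scalar multiplications agree only up
to unfolding of instances. -/
lemma smul_eq_algebraMap_mul (c : ℂ) (f : LaurentSeries ℂ) :
    c • f = algebraMap ℂ (LaurentSeries ℂ) c * f :=
  Algebra.smul_def c f

/-- The space `ℂ[z²] e + ℂ[z²] q`. For suitable `e` and `q` these are the algebras of `W_{2n}` and
the points of the Birkhoff strata that contain them. -/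
noncomputable def quadSpan (e q : LaurentSeries ℂ) : Submodule ℂ (LaurentSeries ℂ) where
  carrier := {f | ∃ a b : ℂ[X], f = aeval (zPow 2) a * e + aeval (zPow 2) b * q}
  zero_mem' := ⟨0, 0, by simp only [map_zero, zero_mul, add_zero]⟩
  add_mem' := by
    rintro _ _ ⟨a, b, rfl⟩ ⟨a', b', rfl⟩
    exact ⟨a + a', b + b', by simp only [map_add]; ring⟩
  smul_mem' := by
    rintro c _ ⟨a, b, rfl⟩
    refine ⟨C c * a, C c * b, ?_⟩
    rw [smul_eq_algebraMap_mul, map_mul, map_mul, aeval_C]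
    ring

lemma zSqStable_quadSpan (e q : LaurentSeries ℂ) : ZSqStable (quadSpan e q) := by
  rintro _ ⟨a, b, rfl⟩
  exact ⟨X * a, X * b, by simp only [map_mul, aeval_X]; ring⟩

lemma quadSpan_one_le (q : LaurentSeries ℂ) (n : ℕ) :
    quadSpan 1 q ≤ quadSpan (zPow (-(2 * n))) q := by
  rintro _ ⟨a, b, rfl⟩
  refine ⟨X ^ n * a, b, ?_⟩
  rw [map_mul, map_pow, aeval_X, zPow_pow, mul_one, mul_right_comm, zPow_mul_zPow, add_neg_cancel,
    zPow_zero, one_mul]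

lemma quadSpan_one_mul_le {q : LaurentSeries ℂ} {P : ℂ[X]} (h : q ^ 2 = aeval (zPow 2) P) :
    quadSpan 1 q * quadSpan 1 q ≤ quadSpan 1 q := by
  rw [mul_self_le_iff]
  rintro _ ⟨a, b, rfl⟩ _ ⟨a', b', rfl⟩
  refine ⟨a * a' + b * b' * P, a * b' + a' * b, ?_⟩
  simp only [map_add, map_mul, ← h]
  ring

variable {e q : LaurentSeries ℂ}

lemma zOrders_quadSpan (he : e ≠ 0) (hq : q ≠ 0) (hpar : Odd (e.order - q.order)) :
    zOrders (quadSpan e q) =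
      {k | (∃ i : ℕ, k = 2 * i - e.order) ∨ ∃ i : ℕ, k = 2 * i - q.order} := by
  refine Set.Subset.antisymm ?_ ?_
  · rintro _ ⟨_, ⟨a, b, rfl⟩, hf0, rfl⟩
    have hab : a ≠ 0 ∨ b ≠ 0 := by
      by_contra! h
      exact hf0 (by rw [h.1, h.2, map_zero, zero_mul, zero_mul, add_zero])
    have hne := orderTop_aeval_mul_ne he hq hpar hab
    rcases hne.lt_or_gt with hlt | hlt
    · have ha : a ≠ 0 := by
        rintro rfl
        rw [map_zero, zero_mul, HahnSeries.orderTop_zero] at hlt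
        exact not_top_lt hlt
      refine Or.inl ⟨a.natDegree, ?_⟩
      rw [order_add_eq_left_of_orderTop_lt hlt, order_aeval_zPow_two_mul ha he]
      ring
    · have hb : b ≠ 0 := by
        rintro rfl
        rw [map_zero, zero_mul, HahnSeries.orderTop_zero] at hlt
        exact not_top_lt hlt
      refine Or.inr ⟨b.natDegree, ?_⟩
      rw [add_comm, order_add_eq_left_of_orderTop_lt hlt, order_aeval_zPow_two_mul hb hq]
      ring
  · have hX (i : ℕ) : (X ^ i : ℂ[X]) ≠ 0 := pow_ne_zero i X_ne_zero
    rintro _ (⟨i, rfl⟩ | ⟨i, rfl⟩)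
    · refine ⟨aeval (zPow 2) (X ^ i) * e, ⟨X ^ i, 0, by rw [map_zero, zero_mul, add_zero]⟩,
        mul_ne_zero (aeval_zPow_two_ne_zero (hX i)) he, ?_⟩
      rw [order_aeval_zPow_two_mul (hX i) he, natDegree_X_pow, neg_sub]
    · refine ⟨aeval (zPow 2) (X ^ i) * q, ⟨0, X ^ i, by rw [map_zero, zero_mul, zero_add]⟩,
        mul_ne_zero (aeval_zPow_two_ne_zero (hX i)) hq, ?_⟩
      rw [order_aeval_zPow_two_mul (hX i) hq, natDegree_X_pow, neg_sub]

variable {n : ℕ}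

lemma zOrders_quadSpan_one (hq : IsReducedSeries (nonnegOrders n) (2 * n + 1) q) :
    zOrders (quadSpan 1 q) = nonnegOrders n := by
  have hpar : Odd ((1 : LaurentSeries ℂ).order - q.order) := by
    rw [HahnSeries.order_one, hq.order, Int.odd_iff]
    omega
  rw [zOrders_quadSpan one_ne_zero hq.ne_zero hpar, HahnSeries.order_one, hq.order]
  ext k
  rw [mem_nonnegOrders, Int.even_iff, Set.mem_ofPred_eq]
  constructor
  · rintro (⟨i, rfl⟩ | ⟨i, rfl⟩) <;> omega
  · rintro ⟨h0, h⟩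
    rcases Int.even_or_odd' k with ⟨r, rfl | rfl⟩
    · exact Or.inl ⟨r.toNat, by omega⟩
    · exact Or.inr ⟨(r - n).toNat, by omega⟩

lemma quadSpan_mem_birkhoffStratum (hq : IsReducedSeries (nonnegOrders n) (2 * n + 1) q) :
    quadSpan (zPow (-(2 * n))) q ∈ birkhoffStratum (2 * n) := by
  refine ⟨?_, zSqStable_quadSpan _ _⟩
  have hpar : Odd ((zPow (-(2 * n))).order - q.order) := by
    rw [order_zPow, hq.order, Int.odd_iff]
    omega
  rw [zOrders_quadSpan (zPow_ne_zero _) hq.ne_zero hpar, order_zPow, hq.order]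
  ext k
  simp only [orderSet, Set.mem_ofPred_eq, Nat.cast_mul, Nat.cast_ofNat, Int.even_iff]
  constructor
  · rintro (⟨i, rfl⟩ | ⟨i, rfl⟩) <;> omega
  · intro h
    rcases Int.even_or_odd' k with ⟨r, rfl | rfl⟩
    · exact Or.inl ⟨(r + n).toNat, by omega⟩
    · exact Or.inr ⟨(r - n).toNat, by omega⟩

end QuadSpan

section Constraints

open Polynomial

lemma coeff_mul_of_odd {R : Type*} [Semiring R] {f g : LaurentSeries R}
    (hf : ∀ k, Even k → f.coeff k = 0) (hg : ∀ k, Even k → g.coeff k = 0) {a b : ℤ}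
    (hfa : ∀ l < a, f.coeff (2 * l + 1) = 0) (hgb : ∀ l < b, g.coeff (2 * l + 1) = 0) (l : ℤ) :
    (f * g).coeff (2 * l) =
      ∑ s ∈ Finset.Icc a (l - 1 - b), f.coeff (2 * s + 1) * g.coeff (2 * (l - s) - 1) := by
  have hlow {h : LaurentSeries R} {c : ℤ} (hh : ∀ k, Even k → h.coeff k = 0)
      (hc : ∀ l < c, h.coeff (2 * l + 1) = 0) (k : ℤ) (hk : k < 2 * c + 1) : h.coeff k = 0 := by
    rcases Int.even_or_odd' k with ⟨r, rfl | rfl⟩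
    · exact hh _ (even_two_mul r)
    · exact hc r (by omega)
  rw [coeff_mul_eq_sum_Icc (hlow hf hfa) (hlow hg hgb), eq_comm]
  refine Finset.sum_of_injOn (fun s => 2 * s + 1) ?_ ?_ ?_ ?_
  · intro x _ y _ (h : 2 * x + 1 = 2 * y + 1)
    omega
  · intro s hs
    simp only [Finset.coe_Icc, Set.mem_Icc] at hs ⊢
    omega
  · intro i hi hni
    rcases Int.even_or_odd' i with ⟨r, rfl | rfl⟩
    · rw [hf _ (even_two_mul r), zero_mul]
    · refine absurd ⟨r, ?_, rfl⟩ hni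
      rw [Finset.mem_Icc] at hi
      rw [Finset.mem_coe, Finset.mem_Icc]
      omega
  · intro s _
    rw [show 2 * l - (2 * s + 1) = 2 * (l - s) - 1 by ring]

lemma sum_Icc_mul_eq_add_add {R : Type*} [CommSemiring R] (n : ℕ) {l : ℤ} (hl : 1 ≤ l)
    (F G : ℤ → R) :
    ∑ s ∈ Finset.Icc (-(n : ℤ)) (l - 1 + n), F (2 * s + 1) * G (2 * (l - s) - 1) =
      ∑ s ∈ Finset.Icc (-(n : ℤ)) (-1), F (2 * s + 1) * G (2 * (l - s) - 1) +
      ∑ r ∈ Finset.Icc (-(n : ℤ)) (-1), G (2 * r + 1) * F (2 * (l - r) - 1) +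
      ∑ s ∈ Finset.Icc (0 : ℤ) (l - 1), F (2 * s + 1) * G (2 * (l - s) - 1) := by
  have hIcc : Finset.Icc (-(n : ℤ)) (l - 1 + n) =
      (Finset.Icc (-(n : ℤ)) (-1) ∪ Finset.Icc l (l - 1 + n)) ∪ Finset.Icc (0 : ℤ) (l - 1) := by
    ext s
    simp only [Finset.mem_union, Finset.mem_Icc]
    omega
  have hreflect : ∑ s ∈ Finset.Icc l (l - 1 + n), F (2 * s + 1) * G (2 * (l - s) - 1) =
      ∑ r ∈ Finset.Icc (-(n : ℤ)) (-1), G (2 * r + 1) * F (2 * (l - r) - 1) := by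
    refine Finset.sum_nbij' (fun s => l - 1 - s) (fun s => l - 1 - s) ?_ ?_ ?_ ?_ ?_
    · intro s hs
      rw [Finset.mem_Icc] at hs ⊢
      omega
    · intro s hs
      rw [Finset.mem_Icc] at hs ⊢
      omega
    · exact fun s _ => sub_sub_cancel _ _
    · exact fun s _ => sub_sub_cancel _ _
    · intro s _
      rw [mul_comm, show 2 * (l - s) - 1 = 2 * (l - 1 - s) + 1 by ring,
        show 2 * s + 1 = 2 * (l - (l - 1 - s)) - 1 by ring]
  rw [hIcc, Finset.sum_union, Finset.sum_union, hreflect] <;>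
    · rw [Finset.disjoint_left]
      intro s
      simp only [Finset.mem_union, Finset.mem_Icc]
      omega

variable {n : ℕ} {H : ℤ → ℤ → ℂ}

lemma neg_two_mul_add_one_notMem_nonnegOrders {l : ℤ} (hl : -(n : ℤ) ≤ l) :
    -(2 * l + 1) ∉ nonnegOrders n := by
  rw [mem_nonnegOrders, Int.even_iff]
  omega

lemma coeff_canonicalSeries_odd {j l : ℤ} (hj : (n : ℤ) ≤ j) (hl : -(n : ℤ) ≤ l) :
    (canonicalSeries n H (2 * j + 1)).coeff (2 * l + 1) = H (2 * j + 1) (2 * l + 1) := by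
  classical
  rw [coeff_canonicalSeries, if_neg (by omega),
    if_pos ⟨neg_two_mul_add_one_notMem_nonnegOrders hl, by omega⟩]

lemma coeff_canonicalSeries_odd_of_lt {j l : ℤ} (hl : l < -(n : ℤ)) :
    (canonicalSeries n H (2 * j + 1)).coeff (2 * l + 1) = if l = -j - 1 then 1 else 0 := by
  have hr := isReducedSeries_canonicalSeries n H (2 * j + 1)
  rw [show 2 * l + 1 = -(2 * (-l - 1) + 1) by ring]
  split_ifs with h
  · rw [h, show -(-j - 1) - 1 = j by ring, hr.1]
  · exact hr.2.2 _ (mem_nonnegOrders.2 ⟨by omega, Or.inl (by omega)⟩) (by omega)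

lemma canonicalSeries_two_mul (hH : LinearConstraints n H) (m : ℕ) :
    canonicalSeries n H (2 * m) = zPow (2 * m) := by
  have hz : IsReducedSeries (nonnegOrders n) (2 * m) (zPow (2 * m)) :=
    ⟨by rw [coeff_zPow, if_pos rfl], fun k hk => by rw [coeff_zPow, if_neg hk.ne],
      fun i _ hi => by rw [coeff_zPow, if_neg (neg_injective.ne hi)]⟩
  refine (hz.eq_canonicalSeries fun k hk hlt => ?_).symm
  rw [coeff_zPow, if_neg (by omega), eq_comm]
  refine hH.1 m k (by omega) ?_
  rw [mem_nonnegOrders, Int.even_iff] at hk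
  rw [Int.odd_iff]
  omega

lemma coeff_canonicalSeries_odd_of_even (hH : LinearConstraints n H) {m : ℤ} (hm : 0 ≤ m) {k : ℤ}
    (hk : Even k) : (canonicalSeries n H (2 * m + 1)).coeff k = 0 := by
  classical
  obtain ⟨r, rfl⟩ := hk.exists_two_nsmul
  rw [nsmul_eq_mul, Nat.cast_ofNat, coeff_canonicalSeries, if_neg (by omega)]
  split_ifs with h
  · rw [mem_nonnegOrders, Int.even_iff] at h
    exact hH.2 m r hm (by omega)
  · rfl

lemma evalNeg_canonicalSeries_odd (hH : LinearConstraints n H) {m : ℤ} (hm : 0 ≤ m) :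
    evalNeg (canonicalSeries n H (2 * m + 1)) = -canonicalSeries n H (2 * m + 1) :=
  evalNeg_eq_neg_iff.2 fun _ => coeff_canonicalSeries_odd_of_even hH hm

lemma coeff_canonicalSeries_odd_sub_zPow {j : ℤ} (hj : (n : ℤ) ≤ j) (l : ℤ) :
    (canonicalSeries n H (2 * j + 1) - zPow (2 * j + 1)).coeff (2 * l + 1) =
      if -(n : ℤ) ≤ l then H (2 * j + 1) (2 * l + 1) else 0 := by
  rw [HahnSeries.coeff_sub, coeff_zPow]
  rcases le_or_gt (-(n : ℤ)) l with hl | hl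
  · rw [if_pos hl, coeff_canonicalSeries_odd hj hl, if_neg (by omega), sub_zero]
  · rw [if_neg hl.not_ge, coeff_canonicalSeries_odd_of_lt hl, sub_eq_zero]
    exact if_congr (by omega) rfl rfl

lemma coeff_canonicalSeries_mul (hH : LinearConstraints n H) {j k l : ℤ} (hj : (n : ℤ) ≤ j)
    (hk : (n : ℤ) ≤ k) (hlj : -(n : ℤ) ≤ l + j) (hlk : -(n : ℤ) ≤ l + k) :
    (canonicalSeries n H (2 * j + 1) * canonicalSeries n H (2 * k + 1)).coeff (2 * l) =
      H (2 * j + 1) (2 * (l + k) + 1) + H (2 * k + 1) (2 * (l + j) + 1) +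
        ∑ s ∈ Finset.Icc (-(n : ℤ)) (l - 1 + n),
          H (2 * j + 1) (2 * s + 1) * H (2 * k + 1) (2 * (l - s) - 1) := by
  have hodd {i : ℤ} (hi : (n : ℤ) ≤ i) (r : ℤ) (hr : Even r) :
      (canonicalSeries n H (2 * i + 1) - zPow (2 * i + 1)).coeff r = 0 := by
    rw [Int.even_iff] at hr
    rw [HahnSeries.coeff_sub, coeff_canonicalSeries_odd_of_even hH (by omega) (Int.even_iff.2 hr),
      coeff_zPow, if_neg (by omega), sub_zero]
  have hlow {i : ℤ} (hi : (n : ℤ) ≤ i) (l : ℤ) (hl : l < -(n : ℤ)) :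
      (canonicalSeries n H (2 * i + 1) - zPow (2 * i + 1)).coeff (2 * l + 1) = 0 := by
    rw [coeff_canonicalSeries_odd_sub_zPow hi, if_neg hl.not_ge]
  have hf := coeff_canonicalSeries_odd_sub_zPow (H := H) hj
  have hg := coeff_canonicalSeries_odd_sub_zPow (H := H) hk
  have hfg := coeff_mul_of_odd (hodd hj) (hodd hk) (hlow hj) (hlow hk) l
  generalize hfj : canonicalSeries n H (2 * j + 1) - zPow (2 * j + 1) = f at hf hfg
  generalize hgk : canonicalSeries n H (2 * k + 1) - zPow (2 * k + 1) = g at hg hfg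
  rw [eq_add_of_sub_eq hfj, eq_add_of_sub_eq hgk, add_mul, mul_add, mul_add, zPow_mul_zPow,
    mul_comm f (zPow _), HahnSeries.coeff_add, HahnSeries.coeff_add, HahnSeries.coeff_add,
    coeff_zPow_mul, coeff_zPow_mul, coeff_zPow, if_neg (by omega), add_zero, hfg,
    show 2 * l + (2 * k + 1) = 2 * (l + k) + 1 by ring,
    show 2 * l + (2 * j + 1) = 2 * (l + j) + 1 by ring, hf, hg, if_pos hlk, if_pos hlj,
    sub_neg_eq_add]
  have hsum : ∑ s ∈ Finset.Icc (-(n : ℤ)) (l - 1 + n), f.coeff (2 * s + 1) *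
      g.coeff (2 * (l - s) - 1) = ∑ s ∈ Finset.Icc (-(n : ℤ)) (l - 1 + n),
        H (2 * j + 1) (2 * s + 1) * H (2 * k + 1) (2 * (l - s) - 1) := by
    refine Finset.sum_congr rfl fun s hs => ?_
    rw [Finset.mem_Icc] at hs
    rw [hf, if_pos hs.1, show 2 * (l - s) - 1 = 2 * (l - s - 1) + 1 by ring, hg,
      if_pos (by omega)]
  rw [hsum]
  ring

end Constraints

section Admissible

open Polynomial

variable {n : ℕ} {H : ℤ → ℤ → ℂ}

lemma zPow_two_mul_canonicalSeries (hH : Admissible n H) {j : ℤ} (hj : (n : ℤ) ≤ j) :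
    zPow 2 * canonicalSeries n H (2 * j + 1) = canonicalSeries n H (2 * (j + 1) + 1) +
      H (2 * j + 1) (2 * (-n) + 1) • canonicalSeries n H (2 * n + 1) := by
  ext k
  rw [coeff_zPow_mul, HahnSeries.coeff_add, HahnSeries.coeff_smul, smul_eq_mul]
  rcases Int.even_or_odd' k with ⟨l, rfl | rfl⟩
  · have hl := even_two_mul l
    rw [coeff_canonicalSeries_odd_of_even hH.1 (by omega) (hl.add even_two),
      coeff_canonicalSeries_odd_of_even hH.1 (by omega) hl,
      coeff_canonicalSeries_odd_of_even hH.1 (by omega) hl, mul_zero, add_zero]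
  rw [show 2 * l + 1 + 2 = 2 * (l + 1) + 1 by ring]
  rcases le_or_gt (-(n : ℤ)) l with hl | hl
  · rw [coeff_canonicalSeries_odd hj (by omega), coeff_canonicalSeries_odd (by omega) hl,
      coeff_canonicalSeries_odd le_rfl hl]
    have hquad := hH.2.1 j 1 l hj (by omega) hl
    rw [show (1 : ℤ) - n - 1 = -n by ring, Finset.Icc_self, Finset.sum_singleton,
      show 2 * (1 - -(n : ℤ)) - 1 = 2 * n + 1 by ring] at hquad
    linear_combination hquad
  · rw [coeff_canonicalSeries_odd_of_lt hl, coeff_canonicalSeries_odd_of_lt hl]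
    rcases (show l + 1 ≤ -(n : ℤ) by omega).eq_or_lt with hln | hln
    · rw [hln, coeff_canonicalSeries_odd hj le_rfl, if_neg (by omega), if_pos (by omega), mul_one,
        zero_add]
    · rw [coeff_canonicalSeries_odd_of_lt hln, if_neg (show ¬l = -(n : ℤ) - 1 by omega), mul_zero,
        add_zero]
      exact if_congr (by omega) rfl rfl

/-- The polynomials `α_{n+i}` with `p_{2(n+i)+1}(z) = α_{n+i}(z²) p_{2n+1}(z)`. -/
noncomputable def alphaPoly (n : ℕ) (H : ℤ → ℤ → ℂ) : ℕ → ℂ[X]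
  | 0 => 1
  | i + 1 => X * alphaPoly n H i - C (H (2 * (n + i : ℤ) + 1) (2 * (-n) + 1))

lemma monic_alphaPoly_and_natDegree_alphaPoly (n : ℕ) (H : ℤ → ℤ → ℂ) (i : ℕ) :
    (alphaPoly n H i).Monic ∧ (alphaPoly n H i).natDegree = i := by
  induction i with
  | zero => exact ⟨monic_one, natDegree_one⟩
  | succ i ih =>
    have hm : (X * alphaPoly n H i).Monic := monic_X.mul ih.1
    have hd : (X * alphaPoly n H i).natDegree = i + 1 := by
      rw [natDegree_X_mul ih.1.ne_zero, ih.2]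
    rw [alphaPoly]
    refine ⟨hm.sub_of_left ?_, by rw [natDegree_sub_C, hd]⟩
    rw [degree_eq_natDegree hm.ne_zero, hd]
    exact degree_C_le.trans_lt (WithBot.coe_pos.2 i.succ_pos)

lemma canonicalSeries_eq_aeval_alphaPoly_mul (hH : Admissible n H) (i : ℕ) :
    canonicalSeries n H (2 * (n + i : ℤ) + 1) =
      aeval (zPow 2) (alphaPoly n H i) * canonicalSeries n H (2 * n + 1) := by
  induction i with
  | zero => rw [Nat.cast_zero, add_zero, alphaPoly, map_one, one_mul]
  | succ i ih =>
    have hz := zPow_two_mul_canonicalSeries hH (j := n + i) (by omega)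
    rw [alphaPoly, map_sub, map_mul, aeval_X, aeval_C, sub_mul, mul_assoc, ← ih, hz,
      smul_eq_algebraMap_mul, add_sub_cancel_right, Nat.cast_succ, add_assoc]

lemma coeff_canonicalSeries_mul_eq_zero (hH : Admissible n H) {j k l : ℤ} (hj : (n : ℤ) ≤ j)
    (hk : (n : ℤ) ≤ k) (hl : 1 ≤ l) :
    (canonicalSeries n H (2 * j + 1) * canonicalSeries n H (2 * k + 1)).coeff (2 * l) = 0 := by
  rw [coeff_canonicalSeries_mul hH.1 hj hk (by omega) (by omega), sum_Icc_mul_eq_add_add n hl,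
    ← hH.2.2 j k l hj hk hl]
  ring

lemma coeff_branchPoly (n : ℕ) (H : ℤ → ℤ → ℂ) (i : ℕ) : (branchPoly n H).coeff i =
    if i = 2 * n + 1 then 1 else if i < 2 * n + 1 then uCoeff n H i else 0 := by
  rw [branchPoly, coeff_add, finsetSum_coeff, coeff_X_pow]
  simp only [coeff_C_mul, coeff_X_pow, mul_ite, mul_one, mul_zero, Finset.sum_ite_eq,
    Finset.mem_range]
  split_ifs
  · omega
  · rw [add_zero]
  · rw [zero_add]
  · rw [zero_add]

lemma natDegree_branchPoly (n : ℕ) (H : ℤ → ℤ → ℂ) : (branchPoly n H).natDegree = 2 * n + 1 := by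
  refine natDegree_eq_of_le_of_coeff_ne_zero ?_ ?_
  · rw [natDegree_le_iff_coeff_eq_zero]
    intro i hi
    rw [coeff_branchPoly, if_neg hi.ne', if_neg hi.not_gt]
  · rw [coeff_branchPoly, if_pos rfl]
    exact one_ne_zero

lemma coeff_canonicalSeries_sq (hH : LinearConstraints n H) (i : ℕ) :
    (canonicalSeries n H (2 * n + 1) ^ 2).coeff (-(2 * (i : ℤ))) = (branchPoly n H).coeff i := by
  have hr := isReducedSeries_canonicalSeries n H (2 * n + 1)
  have hlow := coeff_mul_eq_sum_Icc hr.2.1 hr.2.1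
  rw [coeff_branchPoly, sq]
  split_ifs with htop hlt
  · have hi : -(2 * (i : ℤ)) - -(2 * n + 1) = -(2 * n + 1) := by omega
    rw [hlow, hi, Finset.Icc_self, Finset.sum_singleton, hi, hr.1, mul_one]
  · rw [show -(2 * (i : ℤ)) = 2 * (-i) by ring,
      coeff_canonicalSeries_mul hH le_rfl le_rfl (by omega) (by omega), uCoeff,
      show -(i : ℤ) + n = n - i by ring, show -(i : ℤ) - 1 + n = n - i - 1 by ring, ← two_mul]
    refine congrArg _ (Finset.sum_congr rfl fun s _ => ?_)
    rw [show 2 * (-(i : ℤ) - s) - 1 = -2 * (i + s) - 1 by ring]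
  · rw [hlow, Finset.Icc_eq_empty (by omega), Finset.sum_empty]

lemma canonicalSeries_sq (hH : Admissible n H) :
    canonicalSeries n H (2 * n + 1) ^ 2 = aeval (zPow 2) (branchPoly n H) := by
  have heven : evalNeg (canonicalSeries n H (2 * n + 1) ^ 2) =
      canonicalSeries n H (2 * n + 1) ^ 2 := by
    rw [map_pow, evalNeg_canonicalSeries_odd hH.1 (by omega), neg_sq]
  refine (eq_aeval_zPow_two_iff heven fun k hk => ?_).2 (coeff_canonicalSeries_sq hH.1)
  rcases Int.even_or_odd' k with ⟨r, rfl | rfl⟩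
  · rw [sq]
    exact coeff_canonicalSeries_mul_eq_zero hH le_rfl le_rfl (by omega)
  · exact evalNeg_eq_self_iff.1 heven _ (odd_two_mul_add_one r)

lemma spanSeries_eq_quadSpan (hH : Admissible n H) :
    spanSeries n H = quadSpan 1 (canonicalSeries n H (2 * n + 1)) := by
  have hT : zOrders (quadSpan 1 (canonicalSeries n H (2 * n + 1))) = zOrders (spanSeries n H) := by
    rw [zOrders_quadSpan_one (isReducedSeries_canonicalSeries n H _), zOrders_spanSeries]
  refine (eq_of_le_of_zOrders_subset ?_ hT.subset ?_).symm
  · rw [spanSeries, Submodule.span_le]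
    rintro _ ⟨⟨j, hj⟩, rfl⟩
    rcases eq_two_mul_or_eq_two_mul_add_one_of_mem_nonnegOrders hj with ⟨m, rfl⟩ | ⟨m, hm, rfl⟩
    · refine ⟨X ^ m, 0, ?_⟩
      rw [map_pow, aeval_X, map_zero, zPow_pow, mul_one, zero_mul, add_zero]
      exact canonicalSeries_two_mul hH.1 m
    · obtain ⟨i, rfl⟩ := Nat.exists_eq_add_of_le hm
      refine ⟨0, alphaPoly n H i, ?_⟩
      change canonicalSeries n H (2 * ((n + i : ℕ) : ℤ) + 1) = _
      rw [map_zero, zero_mul, zero_add, ← canonicalSeries_eq_aeval_alphaPoly_mul hH, Nat.cast_add]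
  · rw [zOrders_spanSeries]
    exact bddBelow_nonnegOrders n

end Admissible

section Converse

open Polynomial

variable {n : ℕ} {U : Submodule ℂ (LaurentSeries ℂ)} {q : LaurentSeries ℂ}

lemma aeval_zPow_two_mul_mem (hz : ZSqStable U) {f : LaurentSeries ℂ} (hf : f ∈ U) (a : ℂ[X]) :
    aeval (zPow 2) a * f ∈ U := by
  induction a using Polynomial.induction_on' with
  | add a b ha hb =>
    rw [map_add, add_mul]
    exact U.add_mem ha hb
  | monomial m c =>
    rw [aeval_monomial, mul_assoc, ← smul_eq_algebraMap_mul]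
    refine U.smul_mem c ?_
    induction m with
    | zero => rwa [pow_zero, one_mul]
    | succ m ih =>
      rw [pow_succ', mul_assoc]
      exact hz _ ih

lemma one_mem_of_mul_self_le (h0 : IsLeast (zOrders U) 0) (hmul : U * U ≤ U) : 1 ∈ U := by
  obtain ⟨e, he, hr⟩ := exists_mem_isReducedSeries h0.bddBelow h0.1
  have hlow : ∀ k < (0 : ℤ), e.coeff k = 0 := fun k hk => hr.2.1 k (by rwa [neg_zero])
  have hcoeff (k : ℤ) := coeff_mul_eq_sum_Icc hlow hlow k
  have hee : IsReducedSeries (zOrders U) 0 (e * e) := by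
    have hlow' : ∀ k < (0 : ℤ), (e * e).coeff k = 0 := fun k hk => by
      rw [hcoeff, Finset.Icc_eq_empty (by omega), Finset.sum_empty]
    refine ⟨?_, fun k hk => hlow' k (by rwa [neg_zero] at hk), fun i hi hi0 => hlow' _ ?_⟩
    · have h1 := hr.1
      rw [neg_zero] at h1 ⊢
      rw [hcoeff, sub_self, Finset.Icc_self, Finset.sum_singleton, sub_self, h1, one_mul]
    · have := h0.2 hi
      omega
  have heq : e * e = e := eq_of_mem_of_isReducedSeries (mul_self_le_iff.1 hmul e he e he) he hee hr
  rwa [mul_left_cancel₀ hr.ne_zero (heq.trans (mul_one e).symm)] at he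

lemma eq_quadSpan_one (hU : zOrders U = nonnegOrders n) (hz : ZSqStable U) (h1 : 1 ∈ U) (hq : q ∈ U)
    (hr : IsReducedSeries (nonnegOrders n) (2 * n + 1) q) : U = quadSpan 1 q := by
  have hqU := zOrders_quadSpan_one hr
  refine eq_of_le_of_zOrders_subset ?_ (hU.trans hqU.symm).subset (hqU ▸ bddBelow_nonnegOrders n)
  rintro _ ⟨a, b, rfl⟩
  exact U.add_mem (aeval_zPow_two_mul_mem hz h1 a) (aeval_zPow_two_mul_mem hz hq b)

/- If `q² = a(z²) + b(z²) q`, subtracting the same relation for `q(-z)` gives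
`(q(z) - q(-z)) (q(z) + q(-z) - b(z²)) = 0`, and reducedness of `q` forces `b = 0`. -/
lemma evalNeg_eq_neg_of_mul_self_mem (hr : IsReducedSeries (nonnegOrders n) (2 * n + 1) q)
    (hqq : q * q ∈ quadSpan 1 q) : evalNeg q = -q := by
  obtain ⟨a, b, hab⟩ := hqq
  have hab' := congrArg evalNeg hab
  simp only [map_mul, map_add, evalNeg_aeval_zPow_two, map_one] at hab'
  have hne : q - evalNeg q ≠ 0 := sub_ne_zero.2 fun h => one_ne_zero <|
    hr.1.symm.trans (evalNeg_eq_self_iff.1 h.symm _ (odd_two_mul_add_one (n : ℤ)).neg)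
  have hsum : q + evalNeg q = aeval (zPow 2) b := by
    refine mul_left_cancel₀ hne ?_
    linear_combination hab - hab'
  have hb : b = 0 := by
    ext i
    rw [← coeff_aeval_zPow_two, ← hsum, HahnSeries.coeff_add,
      coeff_evalNeg_of_even q (even_two_mul _).neg,
      hr.2.2 _ (two_mul_mem_nonnegOrders n i) (by omega), add_zero, coeff_zero]
  rw [hb, map_zero] at hsum
  exact (neg_eq_of_add_eq_zero_right hsum).symm

lemma exists_eq_quadSpan (hU : zOrders U = nonnegOrders n) (hmul : U * U ≤ U) (hz : ZSqStable U) :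
    ∃ q, IsReducedSeries (nonnegOrders n) (2 * n + 1) q ∧ evalNeg q = -q ∧ U = quadSpan 1 q := by
  have hbdd : BddBelow (zOrders U) := hU ▸ bddBelow_nonnegOrders n
  obtain ⟨q, hq, hr⟩ := exists_mem_isReducedSeries hbdd
    (hU.symm ▸ two_mul_add_one_mem_nonnegOrders (le_refl n))
  rw [hU] at hr
  have h0 : IsLeast (zOrders U) 0 := by
    rw [hU]
    exact ⟨two_mul_mem_nonnegOrders n 0, fun k hk => (mem_nonnegOrders.1 hk).1⟩
  have hUq := eq_quadSpan_one hU hz (one_mem_of_mul_self_le h0 hmul) hq hr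
  have hqq := mul_self_le_iff.1 hmul q hq q hq
  exact ⟨q, hr, evalNeg_eq_neg_of_mul_self_mem hr (hUq ▸ hqq), hUq⟩

lemma evalNeg_eq_neg_of_mem_quadSpan (hq : evalNeg q = -q) {f : LaurentSeries ℂ}
    (hf : f ∈ quadSpan 1 q) (h : ∀ i : ℕ, f.coeff (-(2 * (i : ℤ))) = 0) : evalNeg f = -f := by
  obtain ⟨a, b, rfl⟩ := hf
  have hodd : evalNeg (aeval (zPow 2) b * q) = -(aeval (zPow 2) b * q) := by
    rw [map_mul, evalNeg_aeval_zPow_two, hq, mul_neg]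
  have ha : a = 0 := by
    ext i
    rw [← coeff_aeval_zPow_two, coeff_zero, ← h i, mul_one, HahnSeries.coeff_add,
      evalNeg_eq_neg_iff.1 hodd _ (even_two_mul _).neg, add_zero]
  rw [ha, map_zero, zero_mul, zero_add, hodd]

lemma exists_eq_spanSeries (hU : zOrders U = nonnegOrders n) :
    ∃ H : ℤ → ℤ → ℂ, (∀ j k, H j k ≠ 0 → j ∈ nonnegOrders n ∧ -k ∉ nonnegOrders n ∧ -k < j) ∧
      U = spanSeries n H := by
  classical
  have hbdd : BddBelow (zOrders U) := hU ▸ bddBelow_nonnegOrders n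
  have hex (j : ℤ) (hj : j ∈ nonnegOrders n) : ∃ f ∈ U, IsReducedSeries (nonnegOrders n) j f := by
    have h := exists_mem_isReducedSeries hbdd (hU.symm ▸ hj)
    rwa [hU] at h
  choose! p hpU hp using hex
  let H : ℤ → ℤ → ℂ := fun j k =>
    if j ∈ nonnegOrders n ∧ -k ∉ nonnegOrders n ∧ -k < j then (p j).coeff k else 0
  refine ⟨H, fun j k hjk => of_not_not fun h => hjk (if_neg h), ?_⟩
  refine eq_of_le_of_zOrders_subset ?_ (by rw [hU, zOrders_spanSeries])
    (by rw [zOrders_spanSeries]; exact bddBelow_nonnegOrders n)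
  rw [spanSeries, Submodule.span_le]
  rintro _ ⟨⟨j, hj⟩, rfl⟩
  have hcan : p j = canonicalSeries n H j :=
    (hp j hj).eq_canonicalSeries fun k hk hlt => (if_pos ⟨hj, hk, hlt⟩).symm
  change canonicalSeries n H j ∈ U
  exact hcan ▸ hpU j hj

variable {H : ℤ → ℤ → ℂ}

lemma linearConstraints_of_spanSeries_eq_quadSpan
    (hH : ∀ j k, H j k ≠ 0 → j ∈ nonnegOrders n ∧ -k ∉ nonnegOrders n ∧ -k < j)
    (hq : evalNeg q = -q) (hHq : spanSeries n H = quadSpan 1 q) : LinearConstraints n H := by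
  classical
  have hcoeff {j k : ℤ} (hjk : H j k ≠ 0) : (canonicalSeries n H j).coeff k = H j k := by
    have h := (hH j k hjk).2
    rw [coeff_canonicalSeries, if_neg (by omega), if_pos h]
  refine ⟨fun m k hm _ => ?_, fun m k _ _ => ?_⟩ <;> by_contra hne
  · obtain ⟨hT, -, hlt⟩ := hH _ _ hne
    lift m to ℕ using hm
    have hz : canonicalSeries n H (2 * m) = zPow (2 * m) := by
      refine eq_of_mem_spanSeries (canonicalSeries_mem_spanSeries hT) ?_ fun i hi => ?_
      · rw [hHq]
        refine ⟨X ^ m, 0, ?_⟩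
        rw [map_pow, aeval_X, zPow_pow, map_zero, zero_mul, add_zero, mul_one]
      · have hr := isReducedSeries_canonicalSeries n H (2 * m)
        rw [coeff_zPow]
        split_ifs with him
        · rw [him, hr.1]
        · exact hr.2.2 i hi (neg_injective.ne_iff.1 him)
    rw [← hcoeff hne, hz, coeff_zPow, if_neg (by omega)] at hne
    exact hne rfl
  · obtain ⟨hT, -, -⟩ := hH _ _ hne
    have hodd : evalNeg (canonicalSeries n H (2 * m + 1)) = -canonicalSeries n H (2 * m + 1) := by
      refine evalNeg_eq_neg_of_mem_quadSpan hq (hHq ▸ canonicalSeries_mem_spanSeries hT) fun i => ?_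
      exact (isReducedSeries_canonicalSeries n H _).2.2 _ (two_mul_mem_nonnegOrders n i) (by omega)
    rw [← hcoeff hne] at hne
    exact hne (evalNeg_eq_neg_iff.1 hodd _ (even_two_mul k))

lemma coeff_two_mul_eq_zero_of_mem_spanSeries (hH : LinearConstraints n H) {f : LaurentSeries ℂ}
    (hf : f ∈ spanSeries n H) {l : ℤ} (hl : 1 ≤ l) : f.coeff (2 * l) = 0 := by
  induction hf using Submodule.span_induction with
  | mem f hf =>
    obtain ⟨⟨j, hj⟩, rfl⟩ := hf
    rcases eq_two_mul_or_eq_two_mul_add_one_of_mem_nonnegOrders hj with ⟨m, rfl⟩ | ⟨m, -, rfl⟩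
    · change (canonicalSeries n H (2 * m)).coeff (2 * l) = 0
      rw [canonicalSeries_two_mul hH, coeff_zPow, if_neg (by omega)]
    · exact coeff_canonicalSeries_odd_of_even hH (by omega) (even_two_mul l)
  | zero => exact HahnSeries.coeff_zero
  | add f g _ _ hf hg => rw [HahnSeries.coeff_add, hf, hg, add_zero]
  | smul c f _ hf => rw [HahnSeries.coeff_smul, hf, smul_zero]

lemma canonicalSeries_odd_mem_spanSeries {j : ℤ} (hj : (n : ℤ) ≤ j) :
    canonicalSeries n H (2 * j + 1) ∈ spanSeries n H :=
  canonicalSeries_mem_spanSeries (mem_nonnegOrders.2 ⟨by omega, Or.inl (by omega)⟩)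

lemma zPow_two_mul_mul_canonicalSeries (hH : LinearConstraints n H)
    (hz : ZSqStable (spanSeries n H)) {j : ℤ} (hj : (n : ℤ) ≤ j) (k : ℕ) :
    zPow (2 * k) * canonicalSeries n H (2 * j + 1) = canonicalSeries n H (2 * (j + k) + 1) +
      ∑ s ∈ Finset.Icc (-(n : ℤ)) (k - n - 1),
        H (2 * j + 1) (2 * s + 1) • canonicalSeries n H (2 * (k - s - 1) + 1) := by
  have hmem := aeval_zPow_two_mul_mem hz (canonicalSeries_odd_mem_spanSeries (H := H) hj) (X ^ k)
  rw [map_pow, aeval_X, zPow_pow] at hmem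
  refine eq_of_mem_spanSeries hmem (Submodule.add_mem _ (canonicalSeries_odd_mem_spanSeries
    (by omega)) (Submodule.sum_mem _ fun s hs => ?_)) fun i hi => ?_
  · rw [Finset.mem_Icc] at hs
    exact Submodule.smul_mem _ _ (canonicalSeries_odd_mem_spanSeries (by omega))
  rw [coeff_zPow_mul, HahnSeries.coeff_add, HahnSeries.coeff_sum]
  simp only [HahnSeries.coeff_smul, smul_eq_mul]
  rcases eq_two_mul_or_eq_two_mul_add_one_of_mem_nonnegOrders hi with ⟨m, rfl⟩ | ⟨m, hm, rfl⟩
  · have hm : Even (-(2 * (m : ℤ))) := (even_two_mul _).neg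
    rw [coeff_canonicalSeries_odd_of_even hH (by omega) (hm.add (even_two_mul _)),
      coeff_canonicalSeries_odd_of_even hH (by omega) hm, Finset.sum_eq_zero, add_zero]
    intro s hs
    rw [Finset.mem_Icc] at hs
    rw [coeff_canonicalSeries_odd_of_even hH (by omega) hm, mul_zero]
  · rw [show -(2 * (m : ℤ) + 1) + 2 * k = 2 * (k - m - 1) + 1 by ring,
      show -(2 * (m : ℤ) + 1) = 2 * (-m - 1) + 1 by ring]
    have hlt : -(m : ℤ) - 1 < -n := by omega
    have hiff (s : ℤ) : -(m : ℤ) - 1 = -(k - s - 1) - 1 ↔ k - m - 1 = s := by omega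
    simp only [coeff_canonicalSeries_odd_of_lt hlt, mul_ite, mul_one, mul_zero, hiff,
      Finset.sum_ite_eq, Finset.mem_Icc]
    rcases le_or_gt (-(n : ℤ)) (k - m - 1) with hkm | hkm
    · rw [coeff_canonicalSeries_odd hj hkm, if_neg (by omega), if_pos (by omega), zero_add]
    · rw [coeff_canonicalSeries_odd_of_lt hkm, if_neg (c := _ ∧ _) (by omega), add_zero]
      exact if_congr (by omega) rfl rfl

lemma quadraticConstraints_of_mul_self_le (hH : LinearConstraints n H)
    (hmul : spanSeries n H * spanSeries n H ≤ spanSeries n H) (hz : ZSqStable (spanSeries n H)) :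
    QuadraticConstraints n H := by
  refine ⟨fun j k l hj hk hl => ?_, fun j k l hj hk hl => ?_⟩
  · lift k to ℕ using hk
    have h := congrArg (fun f => HahnSeries.coeff f (2 * l + 1))
      (zPow_two_mul_mul_canonicalSeries hH hz hj k)
    simp only [coeff_zPow_mul, HahnSeries.coeff_add, HahnSeries.coeff_sum, HahnSeries.coeff_smul,
      smul_eq_mul] at h
    rw [show 2 * l + 1 + 2 * k = 2 * (l + k) + 1 by ring, coeff_canonicalSeries_odd hj (by omega),
      coeff_canonicalSeries_odd (by omega) hl] at h
    rw [h, add_sub_cancel_left, sub_eq_zero]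
    refine Finset.sum_congr rfl fun s hs => ?_
    rw [Finset.mem_Icc] at hs
    rw [coeff_canonicalSeries_odd (by omega) hl, show 2 * (k - s - 1) + 1 = 2 * (k - s) - 1 by ring]
  · have h := coeff_two_mul_eq_zero_of_mem_spanSeries hH (mul_self_le_iff.1 hmul _
      (canonicalSeries_odd_mem_spanSeries hj) _ (canonicalSeries_odd_mem_spanSeries hk)) hl
    rw [coeff_canonicalSeries_mul hH hj hk (by omega) (by omega), sum_Icc_mul_eq_add_add n hl] at h
    rw [← h]
    ring

lemma exists_admissible_eq_spanSeries (hU : zOrders U = nonnegOrders n) (hmul : U * U ≤ U)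
    (hz : ZSqStable U) : ∃ H, Admissible n H ∧ U = spanSeries n H := by
  obtain ⟨q, -, hq, hUq⟩ := exists_eq_quadSpan hU hmul hz
  obtain ⟨H, hH, rfl⟩ := exists_eq_spanSeries hU
  have hlin := linearConstraints_of_spanSeries_eq_quadSpan hH hq hUq
  exact ⟨H, ⟨hlin, quadraticConstraints_of_mul_self_le hlin hmul hz⟩, rfl⟩

end Converse

section Greatest

variable {n : ℕ} {U V A : Submodule ℂ (LaurentSeries ℂ)}

lemma spanSeries_mem_nonnegParts {H : ℤ → ℤ → ℂ} (hH : Admissible n H) :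
    spanSeries n H ∈ nonnegParts n := by
  refine ⟨zOrders_spanSeries n H, _,
    quadSpan_mem_birkhoffStratum (isReducedSeries_canonicalSeries n H _), ?_⟩
  rw [spanSeries_eq_quadSpan hH]
  exact quadSpan_one_le _ n

lemma mul_self_le_and_zSqStable_of_mem_hyperellipticSubset (hU : U ∈ hyperellipticSubset n) :
    U * U ≤ U ∧ ZSqStable U := by
  obtain ⟨H, hH, rfl⟩ := hU
  rw [spanSeries_eq_quadSpan hH]
  exact ⟨quadSpan_one_mul_le (canonicalSeries_sq hH), zSqStable_quadSpan _ _⟩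

lemma isGreatest_hyperellipticSubset (n : ℕ) :
    IsGreatest {X | X ⊆ nonnegParts n ∧ ∀ U ∈ X, U * U ≤ U ∧ ZSqStable U}
      (hyperellipticSubset n) := by
  refine ⟨⟨?_, fun U => mul_self_le_and_zSqStable_of_mem_hyperellipticSubset⟩, ?_⟩
  · rintro _ ⟨H, hH, rfl⟩
    exact spanSeries_mem_nonnegParts hH
  · rintro X ⟨hX, hmul⟩ U hU
    exact exists_admissible_eq_spanSeries (hX hU).1 (hmul U hU).1 (hmul U hU).2

lemma nonneg_of_mem_zOrders_of_mul_self_le (hA : BddBelow (zOrders A)) (hmul : A * A ≤ A) {k : ℤ}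
    (hk : k ∈ zOrders A) : 0 ≤ k := by
  obtain ⟨f, hf, hf0, rfl⟩ := hk
  obtain ⟨N, hN⟩ := hA
  have hpow (m : ℕ) : f ^ (m + 1) ∈ A := by
    induction m with
    | zero => rwa [zero_add, pow_one]
    | succ m ih =>
      rw [pow_succ]
      exact mul_self_le_iff.1 hmul _ ih _ hf
  have hle (m : ℕ) : N ≤ -((m + 1) * f.order) := by
    have h := hN ⟨_, hpow m, pow_ne_zero _ hf0, rfl⟩
    rwa [HahnSeries.order_pow, nsmul_eq_mul, Nat.cast_succ] at h
  have hlast := hle N.natAbs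
  have habs : -(N.natAbs : ℤ) ≤ N := by omega
  by_contra! hneg
  nlinarith

lemma eq_of_le_of_mul_self_le (hU : U ∈ hyperellipticSubset n) (hV : V ∈ birkhoffStratum (2 * n))
    (hAV : A ≤ V) (hA : A * A ≤ A) (hUA : U ≤ A) : A = U := by
  obtain ⟨H, -, rfl⟩ := hU
  have horders {k : ℤ} (hk : k ∈ zOrders A) : k ∈ orderSet (2 * n) := by
    obtain ⟨f, hf, hf0, rfl⟩ := hk
    exact hV.1 ▸ ⟨f, hAV hf, hf0, rfl⟩
  have hbdd : BddBelow (zOrders A) :=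
    ⟨-(2 * n : ℕ), fun k hk => (horders hk).elim (by omega) And.left⟩
  refine eq_of_le_of_zOrders_subset hUA ?_ ?_ <;> rw [zOrders_spanSeries]
  · exact fun k hk => ⟨horders hk, nonneg_of_mem_zOrders_of_mul_self_le hbdd hA hk⟩
  · exact bddBelow_nonnegOrders n

end Greatest

section Parametrization

variable {K : Type*} [Field K] {N : ℕ}

/-- The coefficients `w_m` of a series `1 + ∑ w_m t ^ (m + 1)` whose square has no terms
`t ^ (m + 1)` with `m ≥ N`, in terms of the first `N` of them. -/
def sqrtCoeff (v : Fin N → K) (m : ℕ) : K :=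
  if h : m < N then v ⟨m, h⟩ else -2⁻¹ * ∑ i : Fin m, sqrtCoeff v i * sqrtCoeff v (m - 1 - i)
termination_by m
decreasing_by all_goals omega

lemma sqrtCoeff_val (v : Fin N → K) (s : Fin N) : sqrtCoeff v s = v s := by
  rw [sqrtCoeff, dif_pos s.2]

lemma two_mul_sqrtCoeff_add [NeZero (2 : K)] (v : Fin N → K) {m : ℕ} (hm : N ≤ m) :
    2 * sqrtCoeff v m + ∑ i : Fin m, sqrtCoeff v i * sqrtCoeff v (m - 1 - i) = 0 := by
  rw [sqrtCoeff, dif_neg hm.not_gt, neg_mul, mul_neg,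
    mul_inv_cancel_left₀ two_ne_zero, neg_add_cancel]

lemma eq_sqrtCoeff [NeZero (2 : K)] {v : Fin N → K} {w : ℕ → K} (hv : ∀ s : Fin N, w s = v s)
    (hw : ∀ m, N ≤ m → 2 * w m + ∑ i : Fin m, w i * w (m - 1 - i) = 0) (m : ℕ) :
    w m = sqrtCoeff v m := by
  induction m using Nat.strong_induction_on with
  | _ m ih =>
    rcases lt_or_ge m N with hm | hm
    · rw [sqrtCoeff_val v ⟨m, hm⟩, ← hv]
    · have hsum : ∑ i : Fin m, w i * w (m - 1 - i) =
          ∑ i : Fin m, sqrtCoeff v i * sqrtCoeff v (m - 1 - i) :=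
        Finset.sum_congr rfl fun i _ => by rw [ih i i.2, ih (m - 1 - i) (by omega)]
      refine mul_left_cancel₀ (two_ne_zero (α := K)) ?_
      linear_combination hw m hm - hsum - two_mul_sqrtCoeff_add v hm

variable {n : ℕ} {H : ℤ → ℤ → ℂ}

lemma sum_Icc_mul_eq_sum_fin {R : Type*} [NonUnitalNonAssocSemiring R] (n m : ℕ) (F : ℤ → R) :
    ∑ s ∈ Finset.Icc (-(n : ℤ)) (m - n - 1), F s * F (m - 2 * n - s - 1) =
      ∑ i : Fin m, F ((i : ℕ) - n) * F ((m - 1 - i : ℕ) - n) := by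
  symm
  refine Finset.sum_bij (fun i _ => ((i : ℕ) : ℤ) - n) ?_ ?_ ?_ ?_
  · intro i _
    rw [Finset.mem_Icc]
    omega
  · intro i _ j _ h
    omega
  · intro s hs
    rw [Finset.mem_Icc] at hs
    exact ⟨⟨(s + n).toNat, by omega⟩, Finset.mem_univ _, by simp only; omega⟩
  · intro i _
    congr 2
    omega

lemma coeff_canonicalSeries_sq_eq_two_mul_add (hH : LinearConstraints n H) (m : ℕ) :
    (canonicalSeries n H (2 * n + 1) ^ 2).coeff (2 * (m - 2 * n)) =
      2 * H (2 * n + 1) (2 * (m - n) + 1) + ∑ i : Fin m,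
        H (2 * n + 1) (2 * ((i : ℕ) - n) + 1) * H (2 * n + 1) (2 * ((m - 1 - i : ℕ) - n) + 1) := by
  have hsum := sum_Icc_mul_eq_sum_fin n m fun l => H (2 * n + 1) (2 * l + 1)
  rw [sq, coeff_canonicalSeries_mul hH le_rfl le_rfl (by omega) (by omega), ← hsum, ← two_mul,
    show (m : ℤ) - 2 * n + n = m - n by ring, show (m : ℤ) - 2 * n - 1 + n = m - n - 1 by ring]
  refine congrArg _ (Finset.sum_congr rfl fun s _ => ?_)
  rw [show 2 * ((m : ℤ) - 2 * n - s) - 1 = 2 * (m - 2 * n - s - 1) + 1 by ring]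

lemma eq_sqrtCoeff_of_admissible (hH : Admissible n H) {v : Fin (2 * n + 1) → ℂ}
    (hv : ∀ s : Fin (2 * n + 1), H (2 * n + 1) (2 * ((s : ℕ) - (n : ℤ)) + 1) = v s) (m : ℕ) :
    H (2 * n + 1) (2 * (m - n) + 1) = sqrtCoeff v m := by
  refine eq_sqrtCoeff (w := fun m => H (2 * n + 1) (2 * (m - n) + 1)) hv (fun m hm => ?_) m
  rw [← coeff_canonicalSeries_sq_eq_two_mul_add hH.1, sq]
  exact coeff_canonicalSeries_mul_eq_zero hH le_rfl le_rfl (by omega)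

lemma exists_linearConstraints (n : ℕ) (w : ℕ → ℂ) : ∃ H : ℤ → ℤ → ℂ, LinearConstraints n H ∧
    ∀ m : ℕ, H (2 * n + 1) (2 * (m - n) + 1) = w m := by
  classical
  refine ⟨fun j k => if j = 2 * n + 1 ∧ Odd k then w ((k - 1) / 2 + n).toNat else 0,
    ⟨fun m k _ _ => if_neg (by omega), fun m k _ _ => if_neg ?_⟩, fun m => ?_⟩
  · exact fun h => Int.not_odd_iff_even.2 (even_two_mul k) h.2
  · dsimp only
    rw [if_pos ⟨rfl, odd_two_mul_add_one _⟩, add_sub_cancel_right,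
      Int.mul_ediv_cancel_left _ two_ne_zero, sub_add_cancel, Int.toNat_natCast]

lemma exists_admissible_canonicalSeries_eq {q : LaurentSeries ℂ}
    (hr : IsReducedSeries (nonnegOrders n) (2 * n + 1) q) (hq : evalNeg q = -q)
    (hpos : ∀ l : ℤ, 1 ≤ l → (q ^ 2).coeff (2 * l) = 0) :
    ∃ H, Admissible n H ∧ canonicalSeries n H (2 * n + 1) = q := by
  have heven : evalNeg (q ^ 2) = q ^ 2 := by rw [map_pow, hq, neg_sq]
  obtain ⟨P, hP⟩ := exists_eq_aeval_zPow_two heven fun k hk => by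
    rcases Int.even_or_odd' k with ⟨l, rfl | rfl⟩
    · exact hpos l (by omega)
    · exact evalNeg_eq_self_iff.1 heven _ (odd_two_mul_add_one l)
  have hU := zOrders_quadSpan_one hr
  obtain ⟨H, hH, hHq⟩ :=
    exists_admissible_eq_spanSeries hU (quadSpan_one_mul_le hP) (zSqStable_quadSpan 1 q)
  have hmem : q ∈ spanSeries n H := hHq ▸ ⟨0, 1, by simp only [map_zero, map_one, zero_mul,
    zero_add, one_mul]⟩
  refine ⟨H, hH, eq_of_mem_spanSeries (canonicalSeries_mem_spanSeries
    (two_mul_add_one_mem_nonnegOrders le_rfl)) hmem fun i hi => ?_⟩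
  exact (isReducedSeries_canonicalSeries n H _).coeff_neg_eq hr hi

lemma exists_admissible (v : Fin (2 * n + 1) → ℂ) : ∃ H : ℤ → ℤ → ℂ, Admissible n H ∧
    ∀ s : Fin (2 * n + 1), H (2 * n + 1) (2 * ((s : ℕ) - (n : ℤ)) + 1) = v s := by
  obtain ⟨G, hG, hGv⟩ := exists_linearConstraints n (sqrtCoeff v)
  obtain ⟨H, hH, hHG⟩ := exists_admissible_canonicalSeries_eq
    (isReducedSeries_canonicalSeries n G _) (evalNeg_canonicalSeries_odd hG (by omega))
    fun l hl => by
      obtain ⟨m, rfl⟩ : ∃ m : ℕ, l = m - 2 * n := ⟨(l + 2 * n).toNat, by omega⟩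
      simp only [coeff_canonicalSeries_sq_eq_two_mul_add hG, hGv]
      exact two_mul_sqrtCoeff_add v (by omega)
  refine ⟨H, hH, fun s => ?_⟩
  rw [← coeff_canonicalSeries_odd (H := H) le_rfl (by omega), hHG,
    coeff_canonicalSeries_odd le_rfl (by omega), hGv, sqrtCoeff_val]

lemma spanSeries_eq_of_forall_eq {H' : ℤ → ℤ → ℂ} (hH : Admissible n H) (hH' : Admissible n H')
    (h : ∀ s : Fin (2 * n + 1), H (2 * n + 1) (2 * ((s : ℕ) - (n : ℤ)) + 1) =
      H' (2 * n + 1) (2 * ((s : ℕ) - (n : ℤ)) + 1)) :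
    spanSeries n H = spanSeries n H' := by
  rw [spanSeries_eq_quadSpan hH, spanSeries_eq_quadSpan hH']
  congr 1
  ext k
  rcases Int.even_or_odd' k with ⟨l, rfl | rfl⟩
  · rw [coeff_canonicalSeries_odd_of_even hH.1 (by omega) (even_two_mul l),
      coeff_canonicalSeries_odd_of_even hH'.1 (by omega) (even_two_mul l)]
  rcases le_or_gt (-(n : ℤ)) l with hl | hl
  · rw [coeff_canonicalSeries_odd le_rfl hl, coeff_canonicalSeries_odd le_rfl hl]
    obtain ⟨m, rfl⟩ : ∃ m : ℕ, l = m - n := ⟨(l + n).toNat, by omega⟩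
    rw [eq_sqrtCoeff_of_admissible hH h, eq_sqrtCoeff_of_admissible hH' fun _ => rfl]
  · rw [coeff_canonicalSeries_odd_of_lt hl, coeff_canonicalSeries_odd_of_lt hl]

lemma existsUnique_spanSeries (v : Fin (2 * n + 1) → ℂ) :
    ∃! U : Submodule ℂ (LaurentSeries ℂ), ∃ H : ℤ → ℤ → ℂ,
      Admissible n H ∧ U = spanSeries n H ∧
        ∀ s : Fin (2 * n + 1), H (2 * n + 1) (2 * ((s : ℕ) - (n : ℤ)) + 1) = v s := by
  obtain ⟨H, hH, hv⟩ := exists_admissible v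
  refine ⟨_, ⟨H, hH, rfl, hv⟩, ?_⟩
  rintro _ ⟨H', hH', rfl, hv'⟩
  exact spanSeries_eq_of_forall_eq hH' hH fun s => (hv' s).trans (hv s).symm

end Parametrization

section QuadSubalgebra

open Polynomial

variable {R B : Type*} [CommRing R] [CommRing B] [Algebra R B]

/-- The subalgebra `R[x] + R[x] y` generated by two elements related by `y ^ 2 = P(x)`. -/
noncomputable def quadSubalgebra (x y : B) (P : R[X]) (h : y ^ 2 = aeval x P) :
    Subalgebra R B where
  carrier := {f | ∃ a b : R[X], f = aeval x a + aeval x b * y}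
  mul_mem' := by
    rintro _ _ ⟨a, b, rfl⟩ ⟨a', b', rfl⟩
    refine ⟨a * a' + b * b' * P, a * b' + a' * b, ?_⟩
    simp only [map_add, map_mul, ← h]
    ring
  add_mem' := by
    rintro _ _ ⟨a, b, rfl⟩ ⟨a', b', rfl⟩
    exact ⟨a + a', b + b', by simp only [map_add]; ring⟩
  algebraMap_mem' c := ⟨C c, 0, by rw [aeval_C, map_zero, zero_mul, add_zero]⟩

variable {x y : B} {P : R[X]} (h : y ^ 2 = aeval x P)

lemma left_mem_quadSubalgebra : x ∈ quadSubalgebra x y P h :=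
  ⟨X, 0, by rw [aeval_X, map_zero, zero_mul, add_zero]⟩

lemma aeval_mul_right_mem_quadSubalgebra (b : R[X]) : aeval x b * y ∈ quadSubalgebra x y P h :=
  ⟨0, b, by rw [map_zero, zero_add]⟩

lemma right_mem_quadSubalgebra : y ∈ quadSubalgebra x y P h := by
  simpa only [map_one, one_mul] using aeval_mul_right_mem_quadSubalgebra h 1

lemma adjoin_pair_eq_quadSubalgebra : Algebra.adjoin R {x, y} = quadSubalgebra x y P h := by
  apply le_antisymm
  · rw [Algebra.adjoin_le_iff]
    rintro _ (rfl | rfl)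
    · exact left_mem_quadSubalgebra h
    · exact right_mem_quadSubalgebra h
  · rintro _ ⟨a, b, rfl⟩
    have hy : y ∈ Algebra.adjoin R {x, y} := Algebra.subset_adjoin (Or.inr rfl)
    have hp (a : R[X]) : aeval x a ∈ Algebra.adjoin R {x, y} :=
      Algebra.adjoin_mono (Set.singleton_subset_iff.2 (Set.mem_insert x {y}))
        (aeval_mem_adjoin_singleton R x)
    exact add_mem (hp a) (mul_mem (hp b) hy)

lemma algHom_mem_of_forall_X_mem {σ : Type*} (ψ : MvPolynomial σ R →ₐ[R] B)
    {S : Subalgebra R B} (hS : ∀ i, ψ (MvPolynomial.X i) ∈ S) (F : MvPolynomial σ R) :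
    ψ F ∈ S := by
  have hle : ψ.range ≤ S := by
    rw [← Algebra.map_top, ← MvPolynomial.adjoin_range_X, AlgHom.map_adjoin,
      Algebra.adjoin_le_iff]
    rintro _ ⟨_, ⟨i, rfl⟩, rfl⟩
    exact hS i
  exact hle ⟨F, rfl⟩

end QuadSubalgebra

section CoordinateRing

open Polynomial

variable {n : ℕ} {H : ℤ → ℤ → ℂ}

lemma CurveRing.p_sq (n : ℕ) (H : ℤ → ℤ → ℂ) :
    CurveRing.p n H ^ 2 = aeval (CurveRing.lam n H) (branchPoly n H) := by
  have h : Ideal.Quotient.mkₐ ℂ (Ideal.span {curvePoly n H}) (curvePoly n H) = 0 :=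
    Ideal.Quotient.eq_zero_iff_mem.2 (Ideal.subset_span rfl)
  rw [curvePoly, map_sub, map_pow, ← aeval_algHom_apply, sub_eq_zero] at h
  exact h

lemma CurveRing.exists_eq_aeval_add_aeval_mul (f : CurveRing n H) : ∃ a b : ℂ[X],
    f = aeval (CurveRing.lam n H) a + aeval (CurveRing.lam n H) b * CurveRing.p n H := by
  obtain ⟨F, rfl⟩ := Ideal.Quotient.mk_surjective f
  refine algHom_mem_of_forall_X_mem (Ideal.Quotient.mkₐ ℂ (Ideal.span {curvePoly n H}))
    (S := quadSubalgebra _ _ _ (CurveRing.p_sq n H)) (fun i => ?_) F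
  fin_cases i
  · exact left_mem_quadSubalgebra _
  · exact right_mem_quadSubalgebra _

/-- The evaluation `λ ↦ z ^ 2`, `p_{2n+1} ↦ p_{2n+1}(z)`. -/
noncomputable def CurveRing.toLaurent (hH : Admissible n H) :
    CurveRing n H →ₐ[ℂ] LaurentSeries ℂ :=
  Ideal.Quotient.liftₐ _ (MvPolynomial.aeval ![zPow 2, canonicalSeries n H (2 * n + 1)]) (by
    intro F hF
    rw [← RingHom.mem_ker]
    refine (Ideal.span_le.2 ?_) hF
    rintro _ rfl
    rw [SetLike.mem_coe, RingHom.mem_ker, curvePoly, map_sub, map_pow, ← aeval_algHom_apply,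
      MvPolynomial.aeval_X, MvPolynomial.aeval_X]
    exact sub_eq_zero.2 (canonicalSeries_sq hH))

lemma CurveRing.toLaurent_lam (hH : Admissible n H) :
    CurveRing.toLaurent hH (CurveRing.lam n H) = zPow 2 :=
  MvPolynomial.aeval_X (R := ℂ) ![zPow 2, canonicalSeries n H (2 * n + 1)] 0

lemma CurveRing.toLaurent_p (hH : Admissible n H) :
    CurveRing.toLaurent hH (CurveRing.p n H) = canonicalSeries n H (2 * n + 1) :=
  MvPolynomial.aeval_X (R := ℂ) ![zPow 2, canonicalSeries n H (2 * n + 1)] 1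

lemma CurveRing.toLaurent_aeval_add_aeval_mul (hH : Admissible n H) (a b : ℂ[X]) :
    CurveRing.toLaurent hH
      (aeval (CurveRing.lam n H) a + aeval (CurveRing.lam n H) b * CurveRing.p n H) =
      aeval (zPow 2) a + aeval (zPow 2) b * canonicalSeries n H (2 * n + 1) := by
  rw [map_add, map_mul, ← aeval_algHom_apply, ← aeval_algHom_apply, CurveRing.toLaurent_lam,
    CurveRing.toLaurent_p]

lemma eq_zero_of_aeval_add_aeval_mul_canonicalSeries_eq_zero {a b : ℂ[X]}
    (h : aeval (zPow 2) a + aeval (zPow 2) b * canonicalSeries n H (2 * n + 1) = 0) :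
    a = 0 ∧ b = 0 := by
  have hp := isReducedSeries_canonicalSeries n H (2 * n + 1)
  refine eq_zero_of_aeval_mul_add_aeval_mul_eq_zero one_ne_zero hp.ne_zero ?_
    (by rwa [mul_one])
  rw [HahnSeries.order_one, hp.order, Int.odd_iff]
  omega

lemma CurveRing.eq_zero_of_aeval_add_aeval_mul_eq_zero (hH : Admissible n H) {a b : ℂ[X]}
    (h : aeval (CurveRing.lam n H) a + aeval (CurveRing.lam n H) b * CurveRing.p n H = 0) :
    a = 0 ∧ b = 0 := by
  apply eq_zero_of_aeval_add_aeval_mul_canonicalSeries_eq_zero (n := n) (H := H)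
  rw [← CurveRing.toLaurent_aeval_add_aeval_mul hH, h, map_zero]

lemma CurveRing.toLaurent_injective (hH : Admissible n H) :
    Function.Injective (CurveRing.toLaurent hH) := by
  rw [injective_iff_map_eq_zero]
  intro f hf
  obtain ⟨a, b, rfl⟩ := CurveRing.exists_eq_aeval_add_aeval_mul f
  rw [CurveRing.toLaurent_aeval_add_aeval_mul] at hf
  obtain ⟨rfl, rfl⟩ := eq_zero_of_aeval_add_aeval_mul_canonicalSeries_eq_zero hf
  rw [map_zero, zero_mul, add_zero]

lemma CurveRing.toSubmodule_range_toLaurent (hH : Admissible n H) :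
    Subalgebra.toSubmodule (CurveRing.toLaurent hH).range = spanSeries n H := by
  rw [spanSeries_eq_quadSpan hH]
  ext f
  constructor
  · rintro ⟨g, rfl⟩
    obtain ⟨a, b, rfl⟩ := CurveRing.exists_eq_aeval_add_aeval_mul g
    exact ⟨a, b, by rw [mul_one]; exact CurveRing.toLaurent_aeval_add_aeval_mul hH a b⟩
  · rintro ⟨a, b, rfl⟩
    exact ⟨_, (CurveRing.toLaurent_aeval_add_aeval_mul hH a b).trans (by rw [mul_one])⟩

lemma CurveRing.isDomain (hH : Admissible n H) : IsDomain (CurveRing n H) :=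
  (CurveRing.toLaurent_injective hH).isDomain (CurveRing.toLaurent hH).toRingHom

lemma not_finiteDimensional_spanSeries (n : ℕ) (H : ℤ → ℤ → ℂ) :
    ¬ FiniteDimensional ℂ (spanSeries n H) := by
  intro hfin
  have hli : LinearIndependent ℂ (fun j : nonnegOrders n =>
      (⟨canonicalSeries n H j, canonicalSeries_mem_spanSeries j.2⟩ : spanSeries n H)) :=
    LinearIndependent.of_comp (spanSeries n H).subtype (linearIndependent_canonicalSeries n H)
  have : Finite (nonnegOrders n) := hli.finite
  refine not_injective_infinite_finite
    (fun m : ℕ => (⟨2 * (m : ℤ), two_mul_mem_nonnegOrders n m⟩ : nonnegOrders n)) ?_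
  intro a b hab
  have : 2 * (a : ℤ) = 2 * b := congrArg Subtype.val hab
  omega

lemma exists_subalgebra (hH : Admissible n H) :
    ∃ A : Subalgebra ℂ (LaurentSeries ℂ),
      Subalgebra.toSubmodule A = spanSeries n H ∧ ¬ FiniteDimensional ℂ A ∧
      ∃ φ : CurveRing n H ≃ₐ[ℂ] A,
        (φ (CurveRing.lam n H) : LaurentSeries ℂ) = zPow 2 ∧
        (φ (CurveRing.p n H) : LaurentSeries ℂ) = canonicalSeries n H (2 * n + 1) := by
  have hrange := CurveRing.toSubmodule_range_toLaurent hH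
  refine ⟨(CurveRing.toLaurent hH).range, hrange, fun hfin => ?_,
    AlgEquiv.ofInjective _ (CurveRing.toLaurent_injective hH), CurveRing.toLaurent_lam hH,
    CurveRing.toLaurent_p hH⟩
  apply not_finiteDimensional_spanSeries n H
  rwa [← hrange]

end CoordinateRing

section GammaVariety

open Polynomial

variable {n : ℕ} {H : ℤ → ℤ → ℂ}

lemma coordFun_two_mul (n m : ℕ) :
    coordFun n ⟨2 * (m : ℤ), two_mul_mem_nonnegOrders n m⟩ = MvPolynomial.X Coord.lam ^ m := by
  rw [coordFun, dif_pos (even_two_mul _)]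
  congr 1
  simp only
  omega

lemma coordFun_two_mul_add_one {m : ℕ} (h : n ≤ m) :
    coordFun n ⟨2 * (m : ℤ) + 1, two_mul_add_one_mem_nonnegOrders h⟩ =
      MvPolynomial.X (Coord.odd ⟨m, h⟩) := by
  rw [coordFun, dif_neg (by rw [Int.not_even_iff_odd]; exact odd_two_mul_add_one _)]
  congr 3
  simp only
  omega

lemma X_mem_range_coordFun (i : Coord n) : MvPolynomial.X i ∈ Set.range (coordFun n) := by
  rcases i with _ | ⟨m, hm⟩
  · exact ⟨_, (coordFun_two_mul n 1).trans (pow_one _)⟩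
  · exact ⟨_, coordFun_two_mul_add_one hm⟩

lemma aeval_coordFun (hH : Admissible n H) (j : nonnegOrders n) :
    MvPolynomial.aeval (coordSeries n H) (coordFun n j) = canonicalSeries n H j := by
  obtain ⟨j, hj⟩ := j
  rcases eq_two_mul_or_eq_two_mul_add_one_of_mem_nonnegOrders hj with ⟨m, rfl⟩ | ⟨m, hm, rfl⟩
  · rw [coordFun_two_mul, map_pow, MvPolynomial.aeval_X, canonicalSeries_two_mul hH.1,
      coordSeries, zPow_pow]
  · rw [coordFun_two_mul_add_one hm, MvPolynomial.aeval_X, coordSeries]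

lemma aeval_linearCombination_coordFun (hH : Admissible n H) (c : nonnegOrders n →₀ ℂ) :
    MvPolynomial.aeval (coordSeries n H) (Finsupp.linearCombination ℂ (coordFun n) c) =
      Finsupp.linearCombination ℂ (fun j : nonnegOrders n => canonicalSeries n H j) c :=
  (Finsupp.apply_linearCombination ℂ (MvPolynomial.aeval (coordSeries n H)).toLinearMap
    (coordFun n) c).trans
      (congrArg (fun v => Finsupp.linearCombination ℂ v c) (funext (aeval_coordFun hH)))

variable (n H) in
/-- The span of the coordinate functions of the `p_j` modulo the quadrics. It turns out to be the
whole quotient ring. -/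
noncomputable def coordSpan :
    Submodule ℂ (MvPolynomial (Coord n) ℂ ⧸ Ideal.span (relationSet n H)) :=
  (Submodule.span ℂ (Set.range (coordFun n))).map
    (Ideal.Quotient.mkₐ ℂ (Ideal.span (relationSet n H))).toLinearMap

lemma one_mem_coordSpan : 1 ∈ coordSpan n H :=
  ⟨1, Submodule.subset_span ⟨_, (coordFun_two_mul n 0).trans (pow_zero _)⟩, rfl⟩

lemma coordSpan_mul_self_le (hH : Admissible n H) :
    coordSpan n H * coordSpan n H ≤ coordSpan n H := by
  rw [coordSpan, ← Submodule.map_mul, Submodule.span_mul_span, Submodule.map_span,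
    Submodule.span_le]
  rintro _ ⟨_, ⟨_, ⟨j, rfl⟩, _, ⟨k, rfl⟩, rfl⟩, rfl⟩
  have hjk : canonicalSeries n H j * canonicalSeries n H k ∈ spanSeries n H :=
    mul_self_le_iff.1 (mul_self_le_and_zSqStable_of_mem_hyperellipticSubset ⟨H, hH, rfl⟩).1
      _ (canonicalSeries_mem_spanSeries j.2) _ (canonicalSeries_mem_spanSeries k.2)
  obtain ⟨c, hc⟩ := Finsupp.mem_span_range_iff_exists_finsupp.1 hjk
  refine ⟨Finsupp.linearCombination ℂ (coordFun n) c, ?_, ?_⟩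
  · rw [← Finsupp.range_linearCombination]
    exact LinearMap.mem_range_self _ c
  · have hrel : coordFun n j * coordFun n k - Finsupp.linearCombination ℂ (coordFun n) c ∈
        relationSet n H := ⟨j, k, c, hc.symm, rfl⟩
    exact (Ideal.Quotient.eq.2 (Ideal.subset_span hrel)).symm

lemma exists_sub_linearCombination_coordFun_mem (hH : Admissible n H)
    (F : MvPolynomial (Coord n) ℂ) :
    ∃ c : nonnegOrders n →₀ ℂ,
      F - Finsupp.linearCombination ℂ (coordFun n) c ∈ Ideal.span (relationSet n H) := by
  obtain ⟨G, hG, hFG⟩ : Ideal.Quotient.mkₐ ℂ (Ideal.span (relationSet n H)) F ∈ coordSpan n H :=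
    algHom_mem_of_forall_X_mem _ (S := (coordSpan n H).toSubalgebra one_mem_coordSpan
      fun _ _ ha hb =>
        coordSpan_mul_self_le hH (Submodule.mul_mem_mul ha hb))
      (fun i => ⟨_, Submodule.subset_span (X_mem_range_coordFun i), rfl⟩) F
  rw [SetLike.mem_coe, ← Finsupp.range_linearCombination] at hG
  obtain ⟨c, rfl⟩ := hG
  exact ⟨c, Ideal.Quotient.eq.1 hFG.symm⟩

lemma span_relationSet_eq_ker (hH : Admissible n H) :
    Ideal.span (relationSet n H) =
      RingHom.ker (MvPolynomial.aeval (R := ℂ) (coordSeries n H)) := by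
  have hle : Ideal.span (relationSet n H) ≤
      RingHom.ker (MvPolynomial.aeval (R := ℂ) (coordSeries n H)) := by
    rw [Ideal.span_le]
    rintro _ ⟨j, k, c, hc, rfl⟩
    rw [SetLike.mem_coe, RingHom.mem_ker, map_sub, map_mul, aeval_coordFun hH, aeval_coordFun hH,
      hc, sub_eq_zero]
    exact (aeval_linearCombination_coordFun hH c).symm
  refine le_antisymm hle fun F hF => ?_
  obtain ⟨c, hc⟩ := exists_sub_linearCombination_coordFun_mem hH F
  have h0 := hle hc
  rw [RingHom.mem_ker] at hF h0
  rw [map_sub, hF, aeval_linearCombination_coordFun hH, zero_sub, neg_eq_zero] at h0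
  have hc0 := linearIndependent_iff.1 (linearIndependent_canonicalSeries n H) c h0
  rwa [hc0, map_zero, sub_zero] at hc

variable (n H) in
/-- The polynomials `α_m` with `p_{2m+1} = α_m(z ^ 2) p_{2n+1}`, for `m ≥ n`. -/
noncomputable def alphaFamily (m : ℕ) : ℂ[X] := alphaPoly n H (m - n)

lemma alphaFamily_self : alphaFamily n H n = 1 := by
  rw [alphaFamily, Nat.sub_self, alphaPoly]

lemma canonicalSeries_eq_aeval_alphaFamily_mul (hH : Admissible n H) {m : ℕ} (hm : n ≤ m) :
    canonicalSeries n H (2 * m + 1) =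
      aeval (zPow 2) (alphaFamily n H m) * canonicalSeries n H (2 * n + 1) := by
  rw [alphaFamily, ← canonicalSeries_eq_aeval_alphaPoly_mul hH, Nat.cast_sub hm,
    add_sub_cancel]

lemma curveIdeal_le_ker_aeval_iff {B : Type*} [CommRing B] [Algebra ℂ B] (α : ℕ → ℂ[X])
    (x : Coord n → B) :
    curveIdeal n H α ≤ RingHom.ker (MvPolynomial.aeval (R := ℂ) x) ↔
      x (Coord.odd ⟨n, le_rfl⟩) ^ 2 = aeval (x Coord.lam) (branchPoly n H) ∧
      ∀ m : {m : ℕ // n ≤ m}, n < m →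
        x (Coord.odd m) = aeval (x Coord.lam) (α m) * x (Coord.odd ⟨n, le_rfl⟩) := by
  have hsq : MvPolynomial.aeval (R := ℂ) x (MvPolynomial.X (Coord.odd ⟨n, le_rfl⟩) ^ 2 -
      aeval (MvPolynomial.X Coord.lam) (branchPoly n H)) =
      x (Coord.odd ⟨n, le_rfl⟩) ^ 2 - aeval (x Coord.lam) (branchPoly n H) := by
    rw [map_sub, map_pow, ← aeval_algHom_apply, MvPolynomial.aeval_X, MvPolynomial.aeval_X]
  have hlin (m : {m : ℕ // n ≤ m}) : MvPolynomial.aeval (R := ℂ) x (MvPolynomial.X (Coord.odd m) -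
      aeval (MvPolynomial.X Coord.lam) (α m) * MvPolynomial.X (Coord.odd ⟨n, le_rfl⟩)) =
      x (Coord.odd m) - aeval (x Coord.lam) (α m) * x (Coord.odd ⟨n, le_rfl⟩) := by
    rw [map_sub, map_mul, ← aeval_algHom_apply, MvPolynomial.aeval_X, MvPolynomial.aeval_X,
      MvPolynomial.aeval_X]
  rw [curveIdeal, Ideal.span_le]
  constructor
  · intro h
    exact ⟨sub_eq_zero.1 (hsq.symm.trans (h (Or.inl rfl))),
      fun m hm => sub_eq_zero.1 ((hlin m).symm.trans (h (Or.inr ⟨m, hm, rfl⟩)))⟩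
  · rintro ⟨h1, h2⟩ _ (rfl | ⟨m, hm, rfl⟩)
    · exact hsq.trans (sub_eq_zero.2 h1)
    · exact (hlin m).trans (sub_eq_zero.2 (h2 m hm))

lemma exists_sub_mem_curveIdeal (n : ℕ) (H : ℤ → ℤ → ℂ) (F : MvPolynomial (Coord n) ℂ) :
    ∃ a b : ℂ[X], F - (aeval (MvPolynomial.X Coord.lam) a + aeval (MvPolynomial.X Coord.lam) b *
      MvPolynomial.X (Coord.odd ⟨n, le_rfl⟩)) ∈ curveIdeal n H (alphaFamily n H) := by
  set π := Ideal.Quotient.mkₐ ℂ (curveIdeal n H (alphaFamily n H))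
  have hker : RingHom.ker (MvPolynomial.aeval (R := ℂ) (fun i => π (MvPolynomial.X i))) =
      curveIdeal n H (alphaFamily n H) := by
    rw [← Function.comp_def, ← MvPolynomial.aeval_unique]
    exact Ideal.Quotient.mkₐ_ker ℂ _
  obtain ⟨hsq, hlin⟩ := (curveIdeal_le_ker_aeval_iff _ _).1 hker.ge
  obtain ⟨a, b, hab⟩ := algHom_mem_of_forall_X_mem π (S := quadSubalgebra _ _ _ hsq) (fun i => by
    rcases i with _ | m
    · exact left_mem_quadSubalgebra hsq
    · rcases m.2.eq_or_lt with hm | hm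
      · obtain rfl : m = ⟨n, le_rfl⟩ := Subtype.ext hm.symm
        exact right_mem_quadSubalgebra hsq
      · rw [hlin m hm]
        exact aeval_mul_right_mem_quadSubalgebra hsq _) F
  refine ⟨a, b, Ideal.Quotient.eq.1 ?_⟩
  change π F = π _
  rw [hab, map_add, map_mul, ← aeval_algHom_apply, ← aeval_algHom_apply]

lemma ker_eq_curveIdeal (hH : Admissible n H) :
    RingHom.ker (MvPolynomial.aeval (R := ℂ) (coordSeries n H)) =
      curveIdeal n H (alphaFamily n H) := by
  have hle : curveIdeal n H (alphaFamily n H) ≤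
      RingHom.ker (MvPolynomial.aeval (R := ℂ) (coordSeries n H)) :=
    (curveIdeal_le_ker_aeval_iff _ _).2
      ⟨canonicalSeries_sq hH, fun m _ => canonicalSeries_eq_aeval_alphaFamily_mul hH m.2⟩
  refine le_antisymm (fun F hF => ?_) hle
  obtain ⟨a, b, hab⟩ := exists_sub_mem_curveIdeal n H F
  have h0 := hle hab
  rw [RingHom.mem_ker] at hF h0
  rw [map_sub, hF, zero_sub, neg_eq_zero, map_add, map_mul, ← aeval_algHom_apply,
    ← aeval_algHom_apply, MvPolynomial.aeval_X, MvPolynomial.aeval_X] at h0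
  obtain ⟨rfl, rfl⟩ := eq_zero_of_aeval_add_aeval_mul_canonicalSeries_eq_zero h0
  rwa [map_zero, zero_mul, add_zero, sub_zero] at hab

variable (n H) in
/-- The point of the affine space with coordinates `λ, p_{2n+1}, p_{2n+3}, …` that lies on
`Γ_{2n}` over the point `(l, y)` of the plane curve. -/
noncomputable def curvePoint (l y : ℂ) : Coord n → ℂ
  | Coord.lam => l
  | Coord.odd m => (alphaFamily n H m).eval l * y

lemma curvePoint_odd_self (l y : ℂ) : curvePoint n H l y (Coord.odd ⟨n, le_rfl⟩) = y := by
  rw [curvePoint, alphaFamily_self, eval_one, one_mul]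

lemma curvePoint_mem_gammaVariety (hH : Admissible n H) {l y : ℂ}
    (hy : y ^ 2 = (branchPoly n H).eval l) : curvePoint n H l y ∈ gammaVariety n H := by
  have hle : curveIdeal n H (alphaFamily n H) ≤
      RingHom.ker (MvPolynomial.aeval (R := ℂ) (curvePoint n H l y)) := by
    rw [curveIdeal_le_ker_aeval_iff, curvePoint_odd_self]
    exact ⟨hy, fun m _ => rfl⟩
  rw [← ker_eq_curveIdeal hH, ← span_relationSet_eq_ker hH] at hle
  exact fun F hF => hle (Ideal.subset_span hF)

/-- Evaluating at both points `(l, y)` and `(l, -y)` of the curve separates `a` from `b`. -/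
lemma eq_zero_of_forall_eval_add_eval_mul_eq_zero {k : Type*} [Field k] [IsAlgClosed k]
    [NeZero (2 : k)] {P a b : k[X]} (hP : P ≠ 0)
    (h : ∀ l y : k, y ^ 2 = P.eval l → a.eval l + b.eval l * y = 0) : a = 0 ∧ b = 0 := by
  have hroot (l : k) : ∃ y, y ^ 2 = P.eval l := IsAlgClosed.exists_pow_nat_eq _ two_pos
  have ha : a = 0 := Polynomial.funext fun l => by
    obtain ⟨y, hy⟩ := hroot l
    have h2 : 2 * a.eval l = 0 := by
      linear_combination h l y hy + h l (-y) (by rw [neg_sq, hy])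
    rw [(mul_eq_zero.1 h2).resolve_left two_ne_zero, eval_zero]
  have hb : b ^ 2 * P = 0 := Polynomial.funext fun l => by
    obtain ⟨y, hy⟩ := hroot l
    have hby : b.eval l * y = 0 := by rw [← h l y hy, ha, eval_zero, zero_add]
    rw [eval_mul, eval_pow, ← hy, ← mul_pow, hby, eval_zero, zero_pow two_ne_zero]
  exact ⟨ha, pow_eq_zero_iff two_ne_zero |>.1 ((mul_eq_zero.1 hb).resolve_right hP)⟩

lemma branchPoly_ne_zero (n : ℕ) (H : ℤ → ℤ → ℂ) : branchPoly n H ≠ 0 :=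
  ne_zero_of_natDegree_gt (n := 0) (by rw [natDegree_branchPoly]; omega)

lemma vanishingIdeal_gammaVariety (hH : Admissible n H) :
    MvPolynomial.vanishingIdeal ℂ (gammaVariety n H) = curveIdeal n H (alphaFamily n H) := by
  have hle : curveIdeal n H (alphaFamily n H) ≤
      MvPolynomial.vanishingIdeal ℂ (gammaVariety n H) := by
    rw [← ker_eq_curveIdeal hH, ← span_relationSet_eq_ker hH, Ideal.span_le]
    exact fun F hF x hx => hx F hF
  refine le_antisymm (fun F hF => ?_) hle
  obtain ⟨a, b, hab⟩ := exists_sub_mem_curveIdeal n H F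
  have hvanish := (MvPolynomial.vanishingIdeal ℂ (gammaVariety n H)).sub_mem hF (hle hab)
  rw [sub_sub_cancel, MvPolynomial.mem_vanishingIdeal_iff] at hvanish
  have hpt (l y : ℂ) (hy : y ^ 2 = (branchPoly n H).eval l) :
      a.eval l + b.eval l * y = 0 := by
    have h := hvanish _ (curvePoint_mem_gammaVariety hH hy)
    rwa [map_add, map_mul, ← aeval_algHom_apply, ← aeval_algHom_apply, MvPolynomial.aeval_X,
      MvPolynomial.aeval_X, curvePoint_odd_self] at h
  obtain ⟨rfl, rfl⟩ := eq_zero_of_forall_eval_add_eval_mul_eq_zero (branchPoly_ne_zero n H) hpt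
  rwa [map_zero, zero_mul, add_zero, sub_zero] at hab

lemma exists_alpha (hH : Admissible n H) :
    ∃ α : ℕ → Polynomial ℂ,
      (∀ m : ℕ, n < m → (α m).Monic ∧ (α m).natDegree = m - n ∧
        canonicalSeries n H (2 * m + 1) =
          Polynomial.aeval (zPow 2) (α m) * canonicalSeries n H (2 * n + 1)) ∧
      Ideal.span (relationSet n H) = curveIdeal n H α ∧
      MvPolynomial.vanishingIdeal ℂ (gammaVariety n H) = curveIdeal n H α ∧
      RingHom.ker (MvPolynomial.aeval (R := ℂ) (coordSeries n H)) = curveIdeal n H α :=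
  ⟨alphaFamily n H, fun _ hm => ⟨(monic_alphaPoly_and_natDegree_alphaPoly n H _).1,
    (monic_alphaPoly_and_natDegree_alphaPoly n H _).2,
    canonicalSeries_eq_aeval_alphaFamily_mul hH hm.le⟩,
    (span_relationSet_eq_ker hH).trans (ker_eq_curveIdeal hH), vanishingIdeal_gammaVariety hH,
    ker_eq_curveIdeal hH⟩

end GammaVariety

section Nonsingular

open Polynomial

lemma squarefree_iff_forall_eval_derivative_ne_zero {k : Type*} [Field k] [IsAlgClosed k]
    (P : k[X]) : Squarefree P ↔ ∀ l, P.eval l = 0 → (derivative P).eval l ≠ 0 := by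
  rw [← PerfectField.separable_iff_squarefree, Polynomial.Separable,
    isCoprime_iff_aeval_ne_zero_of_isAlgClosed k k]
  simp only [coe_aeval_eq_eval, or_iff_not_imp_left, not_not]

variable {n : ℕ} {H : ℤ → ℤ → ℂ}

lemma eval_aeval_X_zero {R : Type*} [CommSemiring R] (x : Fin 2 → R) (P : R[X]) :
    MvPolynomial.eval x (aeval (MvPolynomial.X 0) P) = P.eval (x 0) := by
  rw [← MvPolynomial.coe_aeval_eq_eval, RingHom.coe_coe, ← aeval_algHom_apply,
    MvPolynomial.aeval_X, coe_aeval_eq_eval]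

lemma eval_curvePoly (x : Fin 2 → ℂ) :
    MvPolynomial.eval x (curvePoly n H) = x 1 ^ 2 - (branchPoly n H).eval (x 0) := by
  rw [curvePoly, map_sub, eval_aeval_X_zero, map_pow, MvPolynomial.eval_X]

lemma eval_pderiv_zero_curvePoly (x : Fin 2 → ℂ) :
    MvPolynomial.eval x (MvPolynomial.pderiv 0 (curvePoly n H)) =
      -(derivative (branchPoly n H)).eval (x 0) := by
  rw [curvePoly, map_sub, Derivation.leibniz_pow, Derivation.map_aeval,
    MvPolynomial.pderiv_X_self, MvPolynomial.pderiv_X_of_ne (by decide), smul_zero, smul_zero,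
    zero_sub, smul_eq_mul, mul_one, map_neg, eval_aeval_X_zero]

lemma eval_pderiv_one_curvePoly (x : Fin 2 → ℂ) :
    MvPolynomial.eval x (MvPolynomial.pderiv 1 (curvePoly n H)) = 2 * x 1 := by
  rw [curvePoly, map_sub, Derivation.leibniz_pow, Derivation.map_aeval,
    MvPolynomial.pderiv_X_self, MvPolynomial.pderiv_X_of_ne (by decide), smul_zero, sub_zero,
    smul_eq_mul, mul_one, pow_one, map_nsmul, MvPolynomial.eval_X, nsmul_eq_mul, Nat.cast_ofNat]

lemma isNonsingularCurve_curvePoly_iff (n : ℕ) (H : ℤ → ℤ → ℂ) :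
    IsNonsingularCurve (curvePoly n H) ↔ Squarefree (branchPoly n H) := by
  rw [squarefree_iff_forall_eval_derivative_ne_zero]
  simp only [IsNonsingularCurve, Fin.exists_fin_two, eval_curvePoly, eval_pderiv_zero_curvePoly,
    eval_pderiv_one_curvePoly, neg_ne_zero]
  constructor
  · intro h l hl
    have := h ![l, 0] (by simp [hl])
    simpa using this
  · intro h x hx
    by_cases hx1 : x 1 = 0
    · exact Or.inl (h _ (by linear_combination x 1 * hx1 - hx))
    · exact Or.inr (mul_ne_zero two_ne_zero hx1)

end Nonsingular

section QuadraticPair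

open Polynomial

variable {k K : Type*} [Field k] [Field K] [Algebra k K]

lemma aeval_inv {x : K} (hx : x ≠ 0) {a : k[X]} {N : ℕ} (ha : a.natDegree ≤ N) :
    aeval x⁻¹ a = aeval x (reflect N a) * x⁻¹ ^ N := by
  let _ : Invertible x⁻¹ := invertibleOfNonzero (inv_ne_zero hx)
  have h := eval₂_reflect_mul_pow (algebraMap k K) x⁻¹ N a ha
  rw [invOf_eq_inv, inv_inv] at h
  exact h.symm

/-- `x` and `w` are coordinates on the double cover `w ^ 2 = Q(x)` of the line, with function field
`K`: the element `x` is transcendental over `k` and `K = k(x) ⊕ k(x) w`. Denominators are cleared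
in `indep` and `span`, so that only polynomials in `x` occur. -/
structure IsQuadraticPair (x w : K) (Q : k[X]) : Prop where
  sq : w ^ 2 = aeval x Q
  indep : ∀ a b : k[X], aeval x a + aeval x b * w = 0 → a = 0 ∧ b = 0
  span : ∀ f : K, ∃ a b c : k[X], c ≠ 0 ∧ f * aeval x c = aeval x a + aeval x b * w

namespace IsQuadraticPair

variable {x w : K} {Q : k[X]}

lemma of_isFractionRing {A : Type*} [CommRing A] [Algebra k A] [Algebra A K] [IsScalarTower k A K]
    [IsFractionRing A K] {x y : A} {P : k[X]} (sq : y ^ 2 = aeval x P)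
    (indep : ∀ a b : k[X], aeval x a + aeval x b * y = 0 → a = 0 ∧ b = 0)
    (span : ∀ f : A, ∃ a b : k[X], f = aeval x a + aeval x b * y) :
    IsQuadraticPair (algebraMap A K x) (algebraMap A K y) P := by
  have hinj := IsFractionRing.injective A K
  have : Nontrivial A := (algebraMap A K).domain_nontrivial
  have indep' (a b : k[X]) (h : aeval (algebraMap A K x) a +
      aeval (algebraMap A K x) b * algebraMap A K y = 0) : a = 0 ∧ b = 0 := by
    rw [aeval_algebraMap_apply, aeval_algebraMap_apply, ← map_mul, ← map_add] at h
    exact indep a b ((map_eq_zero_iff _ hinj).1 h)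
  have sq' : algebraMap A K y ^ 2 = aeval (algebraMap A K x) P := by
    rw [← map_pow, sq, aeval_algebraMap_apply]
  refine ⟨sq', indep', fun f => ?_⟩
  obtain ⟨u, v, hv, rfl⟩ := IsFractionRing.div_surjective (A := A) f
  have hv0 : algebraMap A K v ≠ 0 := (map_ne_zero_iff _ hinj).2 (nonZeroDivisors.ne_zero hv)
  obtain ⟨a, b, rfl⟩ := span u
  obtain ⟨c, d, rfl⟩ := span v
  simp only [map_add, map_mul, ← aeval_algebraMap_apply] at hv0 ⊢
  generalize algebraMap A K x = x, algebraMap A K y = y at *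
  -- The denominator `c + d y` is made rational by multiplying with its conjugate `c - d y`.
  have hnorm : aeval x (c ^ 2 - d ^ 2 * P) =
      (aeval x c + aeval x d * y) * (aeval x c - aeval x d * y) := by
    simp only [map_sub, map_mul, map_pow, ← sq']
    ring
  refine ⟨a * c - b * d * P, b * c - a * d, c ^ 2 - d ^ 2 * P, fun h0 => ?_, ?_⟩
  · rw [h0, map_zero, zero_eq_mul, or_iff_right hv0] at hnorm
    obtain ⟨rfl, hd⟩ := indep' c (-d) (by rw [← hnorm, map_neg]; ring)
    rw [neg_eq_zero] at hd
    exact hv0 (by rw [hd, map_zero, zero_mul, add_zero])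
  · rw [hnorm, ← mul_assoc, div_mul_cancel₀ _ hv0]
    simp only [map_sub, map_mul, ← sq']
    ring

variable (h : IsQuadraticPair x w Q)

include h

lemma aeval_eq_zero {a : k[X]} (ha : aeval x a = 0) : a = 0 :=
  (h.indep a 0 (by rw [ha, map_zero, zero_mul, add_zero])).1

lemma aeval_ne_zero {a : k[X]} (ha : a ≠ 0) : aeval x a ≠ 0 := mt h.aeval_eq_zero ha

lemma transcendental : Transcendental k x := transcendental_iff.2 fun _ => h.aeval_eq_zero

lemma left_ne_zero : x ≠ 0 := fun h0 => X_ne_zero (h.aeval_eq_zero (a := X) (by rw [aeval_X, h0]))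

lemma right_ne_zero : w ≠ 0 := fun h0 =>
  one_ne_zero (h.indep 0 1 (by rw [map_zero, h0, mul_zero, add_zero])).2

lemma polynomial_ne_zero : Q ≠ 0 := by
  rintro rfl
  exact h.right_ne_zero (pow_eq_zero_iff two_ne_zero |>.1 (h.sq.trans (map_zero _)))

lemma exists_mul_aeval_eq_aeval {f : K} (hf : f ∈ IntermediateField.adjoin k {x}) :
    ∃ a c : k[X], c ≠ 0 ∧ f * aeval x c = aeval x a := by
  obtain ⟨r, s, rfl⟩ := (IntermediateField.mem_adjoin_simple_iff k f).1 hf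
  by_cases hs : s = 0
  · exact ⟨0, 1, one_ne_zero, by rw [hs, map_zero, div_zero, zero_mul]⟩
  · exact ⟨r, s, hs, div_mul_cancel₀ _ (h.aeval_ne_zero hs)⟩

lemma linearIndependent_pair :
    LinearIndependent (IntermediateField.adjoin k {x}) ![(1 : K), w] := by
  rw [LinearIndependent.pair_iff]
  rintro ⟨s, hs⟩ ⟨t, ht⟩ hst
  replace hst : s * 1 + t * w = 0 := hst
  obtain ⟨a, c, hc, hsc⟩ := h.exists_mul_aeval_eq_aeval hs
  obtain ⟨b, d, hd, htd⟩ := h.exists_mul_aeval_eq_aeval ht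
  obtain ⟨had, hbc⟩ := h.indep (a * d) (b * c) (by
    rw [map_mul, map_mul, ← hsc, ← htd]
    linear_combination aeval x c * aeval x d * hst)
  rw [(mul_eq_zero.1 had).resolve_right hd, map_zero] at hsc
  rw [(mul_eq_zero.1 hbc).resolve_right hc, map_zero] at htd
  exact ⟨Subtype.ext ((mul_eq_zero.1 hsc).resolve_right (h.aeval_ne_zero hc)),
    Subtype.ext ((mul_eq_zero.1 htd).resolve_right (h.aeval_ne_zero hd))⟩

lemma top_le_span_pair :
    ⊤ ≤ Submodule.span (IntermediateField.adjoin k {x}) (Set.range ![(1 : K), w]) := by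
  have hmem (a : k[X]) : aeval x a ∈ IntermediateField.adjoin k {x} :=
    IntermediateField.algebra_adjoin_le_adjoin k {x} (aeval_mem_adjoin_singleton k x)
  intro f _
  obtain ⟨a, b, c, hc, hf⟩ := h.span f
  rw [Matrix.range_cons_cons_empty, Submodule.mem_span_pair]
  refine ⟨⟨_, div_mem (hmem a) (hmem c)⟩, ⟨_, div_mem (hmem b) (hmem c)⟩, ?_⟩
  change aeval x a / aeval x c * 1 + aeval x b / aeval x c * w = f
  have hc' := h.aeval_ne_zero hc
  field_simp
  linear_combination -hf

lemma finrank_eq_two : Module.finrank (IntermediateField.adjoin k {x}) K = 2 := by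
  rw [Module.finrank_eq_card_basis (Module.Basis.mk h.linearIndependent_pair h.top_le_span_pair),
    Fintype.card_fin]

lemma div_of_eq_sq_mul {R Q' : k[X]} (hQ : Q = R ^ 2 * Q') :
    IsQuadraticPair x (w / aeval x R) Q' := by
  have hR : R ≠ 0 := by
    rintro rfl
    exact h.polynomial_ne_zero (by rw [hQ]; ring)
  have hR' := h.aeval_ne_zero hR
  refine ⟨?_, fun a b hab => ?_, fun f => ?_⟩
  · rw [div_pow, h.sq, hQ, map_mul, map_pow]
    field_simp
  · obtain ⟨haR, hb⟩ := h.indep (a * R) b (by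
      rw [map_mul]
      field_simp at hab
      linear_combination hab)
    exact ⟨(mul_eq_zero.1 haR).resolve_right hR, hb⟩
  · obtain ⟨a, b, c, hc, hf⟩ := h.span f
    refine ⟨a, b * R, c, hc, ?_⟩
    rw [hf, map_mul]
    field_simp

lemma inv {m : ℕ} (hQ : Q.natDegree = 2 * m + 1) :
    IsQuadraticPair x⁻¹ (w * x⁻¹ ^ (m + 1)) (X * Q.reverse) := by
  have hx := h.left_ne_zero
  refine ⟨?_, fun a b hab => ?_, fun f => ?_⟩
  · rw [map_mul, aeval_X, aeval_inv hx (N := 2 * m + 1) (hQ ▸ reverse_natDegree_le Q), ← hQ,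
      reverse, reflect_reflect, mul_pow, h.sq, hQ]
    ring
  · set N := max a.natDegree b.natDegree
    rw [aeval_inv hx (N := N) (le_max_left _ _), aeval_inv hx (N := N) (le_max_right _ _)] at hab
    replace hab : (aeval x (reflect N a) + aeval x (reflect N b) * (w * x⁻¹ ^ (m + 1))) * x⁻¹ ^ N =
        0 := by linear_combination hab
    obtain ⟨ha, hb⟩ := h.indep (reflect N a * X ^ (m + 1)) (reflect N b) (by
      replace hab := (mul_eq_zero.1 hab).resolve_right (pow_ne_zero _ (inv_ne_zero hx))
      rw [map_mul, map_pow, aeval_X]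
      rw [inv_pow] at hab
      field_simp at hab
      linear_combination hab)
    exact ⟨reflect_eq_zero_iff.1 ((mul_eq_zero.1 ha).resolve_right (pow_ne_zero _ X_ne_zero)),
      reflect_eq_zero_iff.1 hb⟩
  · obtain ⟨a, b, c, hc, hf⟩ := h.span f
    set N := max (max a.natDegree b.natDegree) c.natDegree
    refine ⟨reflect N a * X ^ (m + 1), reflect N b, reflect N c * X ^ (m + 1),
      mul_ne_zero (mt reflect_eq_zero_iff.1 hc) (pow_ne_zero _ X_ne_zero), ?_⟩
    have haeval (q : k[X]) (hq : q.natDegree ≤ N) :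
        aeval x⁻¹ (reflect N q) = aeval x q * x⁻¹ ^ N := by
      rw [aeval_inv hx (natDegree_reflect_le.trans (max_le le_rfl hq)), reflect_reflect]
    simp only [map_mul, map_pow, aeval_X]
    rw [haeval a (by grind), haeval b (by grind), haeval c (by grind)]
    linear_combination x⁻¹ ^ N * x⁻¹ ^ (m + 1) * hf

end IsQuadraticPair

end QuadraticPair

section CechGenus

open Polynomial

variable {k K : Type*} [Field k]

lemma aeval_mul_mem_of_forall_pow_mul_mem {R A : Type*} [CommSemiring R] [Semiring A] [Algebra R A]
    {S : Submodule R A} {x c : A} (h : ∀ i : ℕ, x ^ i * c ∈ S) (a : R[X]) : aeval x a * c ∈ S := by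
  rw [aeval_eq_sum_range, Finset.sum_mul]
  exact S.sum_mem fun i _ => smul_mul_assoc (a.coeff i) (x ^ i) c ▸ S.smul_mem _ (h i)

lemma toSubmodule_adjoin_pair_eq_span {R A : Type*} [CommRing R] [CommRing A] [Algebra R A]
    {x y : A} {P : R[X]} (h : y ^ 2 = aeval x P) :
    Subalgebra.toSubmodule (Algebra.adjoin R {x, y}) =
      Submodule.span R (Set.range fun i : ℕ × Fin 2 => x ^ i.1 * y ^ (i.2 : ℕ)) := by
  apply le_antisymm
  · rw [adjoin_pair_eq_quadSubalgebra h]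
    rintro _ ⟨a, b, rfl⟩
    rw [← mul_one (aeval x a)]
    refine Submodule.add_mem _ (aeval_mul_mem_of_forall_pow_mul_mem (fun i => ?_) a)
      (aeval_mul_mem_of_forall_pow_mul_mem (fun i => ?_) b)
    · exact Submodule.subset_span ⟨(i, 0), by simp⟩
    · exact Submodule.subset_span ⟨(i, 1), by simp⟩
  · rw [Submodule.span_le]
    rintro _ ⟨⟨i, e⟩, rfl⟩
    rw [SetLike.mem_coe, Subalgebra.mem_toSubmodule]
    exact mul_mem (pow_mem (Algebra.subset_adjoin (by simp)) _)
      (pow_mem (Algebra.subset_adjoin (by simp)) _)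

lemma finrank_quotient_span_image {ι V : Type*} [AddCommGroup V] [Module k V] {F : ι → V}
    (hF : LinearIndependent k F) (I : Set ι) :
    Module.finrank k (Submodule.span k (Set.range F) ⧸
      (Submodule.span k (F '' I)).submoduleOf (Submodule.span k (Set.range F))) = Iᶜ.ncard := by
  have hsup : Submodule.span k (F '' Iᶜ) ⊔ Submodule.span k (F '' I) =
      Submodule.span k (Set.range F) := by
    rw [← Submodule.span_union, ← Set.image_union, Set.compl_union_self, Set.image_univ]
  have hinf : Submodule.span k (F '' Iᶜ) ⊓ Submodule.span k (F '' I) = ⊥ :=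
    (hF.disjoint_span_image disjoint_compl_left).eq_bot
  have e := LinearMap.quotientInfEquivSupQuotient (Submodule.span k (F '' Iᶜ))
    (Submodule.span k (F '' I))
  rw [← Submodule.comap_inf, hinf, Submodule.comap_bot, Submodule.ker_subtype, hsup] at e
  have hfinrank : Module.finrank k (Submodule.span k (F '' Iᶜ)) = Iᶜ.ncard := by
    rw [Set.image_eq_range, ← Nat.card_coe_set_eq]
    exact Module.finrank_eq_nat_card_basis
      (Module.Basis.span (hF.comp ((↑) : ↥Iᶜ → ι) Subtype.val_injective))
  exact (e.symm.finrank_eq.trans (Submodule.quotEquivOfEqBot _ rfl).finrank_eq).trans hfinrank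

variable [Field K] [Algebra k K] {x y : K} {P : k[X]}

lemma linearIndependent_zpow (hx : Transcendental k x) :
    LinearIndependent k (fun i : ℤ => x ^ i) := by
  have hx0 : x ≠ 0 := fun h0 => hx (h0 ▸ isAlgebraic_zero)
  have hpow : LinearIndependent k (fun i : ℕ => x ^ i) := by
    have := (basisMonomials k).linearIndependent.map_injOn (aeval x).toLinearMap
      (transcendental_iff_injective.1 hx).injOn
    simpa [Function.comp_def] using this
  rw [linearIndependent_iff_finset_linearIndependent]
  intro s
  obtain ⟨N, hN⟩ : ∃ N : ℕ, ∀ i ∈ s, 0 ≤ i + N :=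
    ⟨s.sup Int.natAbs, fun i hi => by
      have := Finset.le_sup (f := Int.natAbs) hi
      omega⟩
  have hinj : Function.Injective fun i : s => (i + N : ℤ).toNat := by
    intro i j hij
    have := hN i i.2
    have := hN j j.2
    exact Subtype.ext (by simp only at hij; omega)
  refine .of_comp (LinearMap.mulRight k (x ^ N)) ?_
  have hshift : (fun i : s => x ^ (i : ℤ) * x ^ N) = fun i : s => x ^ (i + N : ℤ).toNat := by
    funext i
    rw [← zpow_natCast x N, ← zpow_add₀ hx0, ← zpow_natCast, Int.toNat_of_nonneg (hN i i.2)]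
  change LinearIndependent k fun i : s => x ^ (i : ℤ) * x ^ N
  rw [hshift]
  exact hpow.comp _ hinj

/-- The monomials `x ^ i y ^ e`, `e ≤ 1`. On a double cover `y ^ 2 = P(x)` of the line they form a
basis of the ring of functions regular outside the fibres over `x = 0` and `x = ∞`. -/
def doubleCoverMonomial (x y : K) (i : ℤ × Fin 2) : K := x ^ i.1 * y ^ (i.2 : ℕ)

lemma IsQuadraticPair.linearIndependent_doubleCoverMonomial (h : IsQuadraticPair x y P) :
    LinearIndependent k (doubleCoverMonomial x y) := by
  have ht : Transcendental k (IntermediateField.AdjoinSimple.gen k x) := fun ha =>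
    h.transcendental (ha.algebraMap (A := K))
  convert linearIndependent_smul (linearIndependent_zpow ht) h.linearIndependent_pair using 1
  funext ⟨i, e⟩
  rw [doubleCoverMonomial, Algebra.smul_def, map_zpow₀,
    IntermediateField.AdjoinSimple.algebraMap_gen]
  fin_cases e <;> simp

lemma doubleCoverMonomial_mul_mem_span (hx : x ≠ 0) (h : y ^ 2 = aeval x P) (i j : ℤ × Fin 2) :
    doubleCoverMonomial x y i * doubleCoverMonomial x y j ∈
      Submodule.span k (Set.range (doubleCoverMonomial x y)) := by
  obtain ⟨i, d⟩ := i
  obtain ⟨j, e⟩ := j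
  have hmem (l : ℤ) (f : Fin 2) : x ^ l * y ^ (f : ℕ) ∈
    Submodule.span k (Set.range (doubleCoverMonomial x y)) := Submodule.subset_span ⟨(l, f), rfl⟩
  have hmul : doubleCoverMonomial x y (i, d) * doubleCoverMonomial x y (j, e) =
      x ^ (i + j) * y ^ (d + e : ℕ) := by
    rw [doubleCoverMonomial, doubleCoverMonomial, zpow_add₀ hx, pow_add]
    ring
  rw [hmul]
  rcases (by omega : (d + e : ℕ) = 0 ∨ (d + e : ℕ) = 1 ∨ (d + e : ℕ) = 2) with hde | hde | hde <;>
    rw [hde]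
  · exact hmem _ 0
  · exact hmem _ 1
  · rw [h, mul_comm]
    refine aeval_mul_mem_of_forall_pow_mul_mem (fun l => ?_) P
    rw [← zpow_natCast, ← zpow_add₀ hx, ← mul_one (x ^ _), ← pow_zero y]
    exact hmem _ 0

lemma toSubmodule_adjoin_pair_eq_span_doubleCoverMonomial (h : y ^ 2 = aeval x P) :
    Subalgebra.toSubmodule (Algebra.adjoin k {x, y}) =
      Submodule.span k (doubleCoverMonomial x y '' {i | 0 ≤ i.1}) := by
  rw [toSubmodule_adjoin_pair_eq_span h]
  congr 1
  ext f
  constructor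
  · rintro ⟨⟨i, e⟩, rfl⟩
    exact ⟨(i, e), Int.natCast_nonneg i, by rw [doubleCoverMonomial, zpow_natCast]⟩
  · rintro ⟨⟨i, e⟩, hi, rfl⟩
    lift i to ℕ using hi
    exact ⟨(i, e), by rw [doubleCoverMonomial, zpow_natCast]⟩

lemma toSubmodule_adjoin_inv_pair_eq_span_doubleCoverMonomial {n : ℕ} {R : k[X]}
    (h : (y * x⁻¹ ^ (n + 1)) ^ 2 = aeval x⁻¹ R) :
    Subalgebra.toSubmodule (Algebra.adjoin k {x⁻¹, y * x⁻¹ ^ (n + 1)}) =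
      Submodule.span k (doubleCoverMonomial x y '' {i | i.1 ≤ -((n + 1 : ℕ) * (i.2 : ℕ))}) := by
  have hmon (i : ℕ) (e : Fin 2) : x⁻¹ ^ i * (y * x⁻¹ ^ (n + 1)) ^ (e : ℕ) =
      doubleCoverMonomial x y (-(i + (n + 1) * e : ℕ), e) := by
    rw [doubleCoverMonomial, zpow_neg, zpow_natCast, ← inv_pow, mul_pow, ← pow_mul, pow_add]
    ring
  rw [toSubmodule_adjoin_pair_eq_span h]
  congr 1
  ext f
  constructor
  · rintro ⟨⟨i, e⟩, rfl⟩
    refine ⟨_, ?_, (hmon i e).symm⟩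
    simp
  · rintro ⟨⟨i, e⟩, hi, rfl⟩
    obtain ⟨l, hl⟩ := Int.le.dest hi
    refine ⟨(l, e), ?_⟩
    refine (hmon l e).trans (congrArg (fun j => doubleCoverMonomial x y (j, e)) ?_)
    push_cast at hl ⊢
    linear_combination -hl

lemma IsQuadraticPair.toSubmodule_adjoin_sup_adjoin_eq_span (h : IsQuadraticPair x y P) {n : ℕ}
    (hP : P.natDegree = 2 * n + 1) :
    Subalgebra.toSubmodule (Algebra.adjoin k {x, y} ⊔ Algebra.adjoin k {x⁻¹, y * x⁻¹ ^ (n + 1)}) =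
      Submodule.span k (Set.range (doubleCoverMonomial x y)) := by
  apply le_antisymm
  · rw [← Subalgebra.mul_toSubmodule,
      toSubmodule_adjoin_pair_eq_span_doubleCoverMonomial h.sq,
      toSubmodule_adjoin_inv_pair_eq_span_doubleCoverMonomial (h.inv hP).sq,
      Submodule.span_mul_span, Submodule.span_le]
    rintro _ ⟨_, ⟨i, -, rfl⟩, _, ⟨j, -, rfl⟩, rfl⟩
    exact doubleCoverMonomial_mul_mem_span h.left_ne_zero h.sq i j
  · rw [Submodule.span_le]
    rintro _ ⟨⟨i, e⟩, rfl⟩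
    rw [SetLike.mem_coe, Subalgebra.mem_toSubmodule, doubleCoverMonomial]
    have hx : x ∈ Algebra.adjoin k {x, y} := Algebra.subset_adjoin (Set.mem_insert _ _)
    have hy : y ∈ Algebra.adjoin k {x, y} :=
      Algebra.subset_adjoin (Set.mem_insert_of_mem _ (Set.mem_singleton y))
    have hx' : x⁻¹ ∈ Algebra.adjoin k {x⁻¹, y * x⁻¹ ^ (n + 1)} :=
      Algebra.subset_adjoin (Set.mem_insert _ _)
    refine mul_mem ?_ (Algebra.mem_sup_left (pow_mem hy _))
    obtain ⟨l, rfl | rfl⟩ := i.eq_nat_or_neg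
    · exact zpow_natCast x l ▸ Algebra.mem_sup_left (pow_mem hx l)
    · rw [zpow_neg, zpow_natCast, ← inv_pow]
      exact Algebra.mem_sup_right (pow_mem hx' l)

lemma IsQuadraticPair.doubleCoverArithmeticGenus_eq {K : Type*} [Field K] [Algebra ℂ K] {x y : K}
    {P : ℂ[X]} (h : IsQuadraticPair x y P) {n : ℕ} (hP : P.natDegree = 2 * n + 1) :
    doubleCoverArithmeticGenus n x y = n := by
  have hgap : ({i | 0 ≤ i.1} ∪ {i | i.1 ≤ -((n + 1 : ℕ) * (i.2 : ℕ))} : Set (ℤ × Fin 2))ᶜ =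
      ↑(Finset.Ico (-n : ℤ) 0 ×ˢ ({1} : Finset (Fin 2))) := by
    ext ⟨i, e⟩
    fin_cases e <;> simp <;> omega
  rw [doubleCoverArithmeticGenus, cechGenus, h.toSubmodule_adjoin_sup_adjoin_eq_span hP,
    toSubmodule_adjoin_pair_eq_span_doubleCoverMonomial h.sq,
    toSubmodule_adjoin_inv_pair_eq_span_doubleCoverMonomial (h.inv hP).sq,
    ← Submodule.span_union, ← Set.image_union,
    finrank_quotient_span_image h.linearIndependent_doubleCoverMonomial, hgap,
    Set.ncard_coe_finset, Finset.card_product, Int.card_Ico]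
  simp

end CechGenus

section Squarefree

variable {α : Type*} [CommMonoidWithZero α]

lemma dvd_of_sq_dvd_sq_mul_of_squarefree [UniqueFactorizationMonoid α] {b c q : α} (hc : c ≠ 0)
    (hq : Squarefree q) (h : c ^ 2 ∣ b ^ 2 * q) : c ∣ b := by
  obtain ⟨c', b', g, hrel, rfl, rfl⟩ := UniqueFactorizationMonoid.exists_reduced_factors c hc b
  rw [mul_pow, mul_pow, mul_assoc,
    mul_dvd_mul_iff_left (pow_ne_zero 2 (left_ne_zero_of_mul hc))] at h
  have hc'q : c' * c' ∣ q := sq c' ▸ (hrel.pow (m := 2) (n := 2)).dvd_of_dvd_mul_left h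
  exact mul_dvd_mul_left g (hq c' hc'q).dvd

lemma exists_eq_sq_mul_squarefree [WfDvdMonoid α] {p : α} (hp : p ≠ 0) :
    ∃ r q, p = r ^ 2 * q ∧ Squarefree q := by
  induction p using (wellFounded_dvdNotUnit (α := α)).induction with
  | _ p ih =>
    by_cases hsq : Squarefree p
    · exact ⟨1, p, by rw [one_pow, one_mul], hsq⟩
    · obtain ⟨g, ⟨c, rfl⟩, hg⟩ : ∃ g, g * g ∣ p ∧ ¬IsUnit g := by
        simpa only [Squarefree, not_forall, exists_prop] using hsq
      have hc : c ≠ 0 := right_ne_zero_of_mul hp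
      obtain ⟨r, q, rfl, hq⟩ := ih c
        ⟨hc, g * g, mt isUnit_of_mul_isUnit_left hg, mul_comm _ _⟩ hc
      exact ⟨g * r, q, by rw [mul_pow, sq g, mul_assoc _ (r ^ 2)], hq⟩

end Squarefree

section IntegralClosure

open Polynomial

lemma dvd_and_dvd_of_monic_dvd_quadratic {R : Type*} [CommSemiring R] {p : R[X]} (hp : p.Monic)
    (hdeg : 2 ≤ p.natDegree) {α β γ : R} (hα : α ≠ 0) (h : p ∣ C α * X ^ 2 + C β * X + C γ) :
    α ∣ β ∧ α ∣ γ := by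
  have heq := eq_leadingCoeff_mul_of_monic_of_dvd_of_natDegree_le hp h
    ((natDegree_quadratic hα).trans_le hdeg)
  rw [leadingCoeff_quadratic hα] at heq
  have hcoeff (i : ℕ) : (C α * X ^ 2 + C β * X + C γ).coeff i = α * p.coeff i := by
    rw [heq, coeff_C_mul]
  exact ⟨⟨p.coeff 1, by simpa [coeff_X, coeff_C] using hcoeff 1⟩,
    ⟨p.coeff 0, by simpa [coeff_X, coeff_C] using hcoeff 0⟩⟩

variable {k K : Type*} [Field k] [Field K] [Algebra k K] {x w : K} {Q : k[X]}

namespace IsQuadraticPair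

variable [Algebra k[X] K] (hx : ∀ a : k[X], algebraMap k[X] K a = aeval x a)
  (h : IsQuadraticPair x w Q)

include hx h

lemma faithfulSMul : FaithfulSMul k[X] K :=
  (faithfulSMul_iff_algebraMap_injective _ _).2 <| (injective_iff_map_eq_zero _).2 fun a ha =>
    h.aeval_eq_zero (hx a ▸ ha)

lemma isIntegral_right : IsIntegral k[X] w := by
  refine ⟨X ^ 2 - C Q, monic_X_pow_sub_C Q two_ne_zero, ?_⟩
  rw [eval₂_sub, eval₂_X_pow, eval₂_C, hx, h.sq, sub_self]

lemma exists_eq_aeval_add_aeval_mul_of_isIntegral [NeZero (2 : k)] (hQ : Squarefree Q) {f : K}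
    (hf : IsIntegral k[X] f) : ∃ a b : k[X], f = aeval x a + aeval x b * w := by
  have := h.faithfulSMul hx
  obtain ⟨a, b, c, hc, hfc⟩ := h.span f
  have hroot : aeval f (C (c ^ 2) * X ^ 2 + C (-(2 * a * c)) * X + C (a ^ 2 - b ^ 2 * Q)) = 0 := by
    simp only [map_add, map_sub, map_mul, aeval_C, map_pow, aeval_X, hx, map_neg, ← h.sq,
      map_ofNat]
    linear_combination (f * aeval x c - aeval x a + aeval x b * w) * hfc
  by_cases hdeg : (minpoly k[X] f).natDegree = 1
  · obtain ⟨a', rfl⟩ := minpoly.mem_range_of_degree_eq_one k[X] f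
      ((degree_eq_iff_natDegree_eq_of_pos one_pos).2 hdeg)
    exact ⟨a', 0, by rw [hx, map_zero, zero_mul, add_zero]⟩
  have hdeg2 : 2 ≤ (minpoly k[X] f).natDegree := by have := minpoly.natDegree_pos hf; omega
  obtain ⟨h1, h0⟩ := dvd_and_dvd_of_monic_dvd_quadratic (minpoly.monic hf) hdeg2
    (pow_ne_zero 2 hc) (minpoly.isIntegrallyClosed_dvd hf hroot)
  have hca : c ∣ a := by
    rw [dvd_neg, pow_two, mul_dvd_mul_iff_right hc] at h1
    have h2 : IsUnit (2 : k[X]) := isUnit_C.2 (two_ne_zero (α := k)).isUnit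
    exact h2.dvd_mul_left.1 h1
  obtain ⟨b, rfl⟩ := dvd_of_sq_dvd_sq_mul_of_squarefree hc hQ
    ((dvd_sub_right (pow_dvd_pow_of_dvd hca 2)).1 h0)
  obtain ⟨a, rfl⟩ := hca
  refine ⟨a, b, mul_left_cancel₀ (h.aeval_ne_zero hc) ?_⟩
  simp only [map_mul] at hfc
  linear_combination hfc

end IsQuadraticPair

end IntegralClosure

section Kaehler

open Polynomial KaehlerDifferential

variable {k K : Type*} [Field k] [Field K] [Algebra k K] {x w : K} {Q : k[X]}

namespace IsQuadraticPair

variable (h : IsQuadraticPair x w Q)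

include h

lemma finiteDimensional_fractionRing [Algebra k[X] K] [Algebra (FractionRing k[X]) K]
    [IsScalarTower k[X] (FractionRing k[X]) K] (hx : ∀ a : k[X], algebraMap k[X] K a = aeval x a) :
    FiniteDimensional (FractionRing k[X]) K := by
  rw [FiniteDimensional, Module.finite_def, Submodule.fg_def]
  refine ⟨{1, w}, Set.toFinite _, eq_top_iff.2 fun f _ => Submodule.mem_span_pair.2 ?_⟩
  obtain ⟨a, b, c, hc, hf⟩ := h.span f
  have hc' := h.aeval_ne_zero hc
  refine ⟨algebraMap _ _ a / algebraMap _ _ c, algebraMap _ _ b / algebraMap _ _ c, ?_⟩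
  simp only [Algebra.smul_def, map_div₀, ← IsScalarTower.algebraMap_apply, hx]
  field_simp
  exact hf.symm.trans (mul_comm _ _)

lemma exists_linearEquiv_apply_D_eq_one [CharZero k] :
    ∃ e : Ω[K⁄k] ≃ₗ[K] K, e (D k K x) = 1 := by
  let _ : Algebra k[X] K := (aeval x).toRingHom.toAlgebra
  have hx (a : k[X]) : algebraMap k[X] K a = aeval x a := rfl
  have : IsScalarTower k k[X] K := .of_algebraMap_eq fun c => by
    rw [hx, Polynomial.algebraMap_eq, aeval_C]
  have := h.faithfulSMul hx
  let _ : Algebra (FractionRing k[X]) K := FractionRing.liftAlgebra k[X] K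
  have := h.finiteDimensional_fractionRing hx
  have : Algebra.FormallyEtale k[X] (FractionRing k[X]) :=
    .of_isLocalization (nonZeroDivisors k[X])
  have : Algebra.FormallyEtale (FractionRing k[X]) K := .of_isSeparable _ _
  have : Algebra.FormallyEtale k[X] K := .comp k[X] (FractionRing k[X]) K
  -- `k[X] → K` is formally étale, so `Ω[K⁄k] = K ⊗ Ω[k[X]⁄k]`, and `Ω[k[X]⁄k]` is free on `dX`.
  refine ⟨(tensorKaehlerEquivOfFormallyEtale k k[X] K).symm.trans
    ((TensorProduct.AlgebraTensorModule.congr (LinearEquiv.refl K K) (polynomialEquiv k)).trans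
      (TensorProduct.AlgebraTensorModule.rid k[X] K K)), ?_⟩
  have hxX : x = algebraMap k[X] K X := by rw [hx, aeval_X]
  rw [hxX, LinearEquiv.trans_apply, tensorKaehlerEquivOfFormallyEtale_symm_D_algebraMap,
    LinearEquiv.trans_apply, TensorProduct.AlgebraTensorModule.congr_tmul, polynomialEquiv_D,
    derivative_X, TensorProduct.AlgebraTensorModule.rid_tmul, one_smul, LinearEquiv.refl_apply]

end IsQuadraticPair

end Kaehler

section RegularDifferentials

open Polynomial KaehlerDifferential

lemma aeval_mem_of_forall_algebraMap_mem {R A σ : Type*} [CommSemiring R] [Semiring A]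
    [Algebra R A] [SetLike σ A] [SubsemiringClass σ A] {s : σ} (hs : ∀ r, algebraMap R A r ∈ s)
    {x : A} (hx : x ∈ s) (p : R[X]) : aeval x p ∈ s := by
  rw [aeval_eq_sum_range]
  refine sum_mem fun i _ => ?_
  rw [Algebra.smul_def]
  exact mul_mem (hs _) (pow_mem hx i)

lemma valuation_derivation_le_one {R S K : Type*} [CommSemiring R] [CommRing S] [IsDedekindDomain S]
    [Field K] [Algebra S K] [IsFractionRing S K] [Algebra R K]
    (v : IsDedekindDomain.HeightOneSpectrum S) {d : Derivation R K K}
    (hd : ∀ s : S, v.valuation K (d (algebraMap S K s)) ≤ 1) {g : K} (hg : v.valuation K g ≤ 1) :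
    v.valuation K (d g) ≤ 1 := by
  obtain ⟨s, u, hsu⟩ := v.exists_primeCompl_mul_eq_of_integer g hg
  have hu : v.valuation K (algebraMap S K u) = 1 := by
    rw [v.valuation_of_algebraMap]
    exact (v.intValuation_eq_one_iff_mem_primeCompl _).2 u.2
  have hleibniz : d g * algebraMap S K u =
      d (algebraMap S K s) - g * d (algebraMap S K u) := by
    rw [← hsu, d.leibniz, smul_eq_mul, smul_eq_mul]
    ring
  calc
    v.valuation K (d g) = v.valuation K (d (algebraMap S K s) - g * d (algebraMap S K u)) := by
      rw [← hleibniz, map_mul, hu, mul_one]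
    _ ≤ max (v.valuation K (d (algebraMap S K s))) (v.valuation K (g * d (algebraMap S K u))) :=
      Valuation.map_sub _ _ _
    _ ≤ 1 := max_le (hd s) (map_mul (v.valuation K) g _ ▸ mul_le_one' hg (hd u))

variable {k K : Type*} [Field k] [Field K] [Algebra k K] {x w : K} {Q : k[X]}

/-- A differential is regular at the place with valuation ring `O` if it is an `O`-linear
combination of differentials of elements of `O`; `regularDifferentials` imposes this at all places
trivial on the constants. -/
def IsRegularAt (O : ValuationSubring K) (ω : Ω[K⁄k]) : Prop :=
  ω ∈ Submodule.span O.toSubring (D k K '' (O : Set K))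

namespace IsRegularAt

variable {O : ValuationSubring K} {ω η : Ω[K⁄k]}

lemma smul_D {f g : K} (hf : f ∈ O) (hg : g ∈ O) : IsRegularAt O (f • D k K g) :=
  Submodule.smul_mem _ (⟨f, hf⟩ : O.toSubring) (Submodule.subset_span ⟨g, hg, rfl⟩)

lemma add (hω : IsRegularAt O ω) (hη : IsRegularAt O η) : IsRegularAt O (ω + η) :=
  Submodule.add_mem _ hω hη

lemma apply_mem (hω : IsRegularAt O ω) {L : Ω[K⁄k] →ₗ[K] K} (hL : ∀ g ∈ O, L (D k K g) ∈ O) :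
    L ω ∈ O := by
  induction hω using Submodule.span_induction with
  | mem _ hω =>
    obtain ⟨g, hg, rfl⟩ := hω
    exact hL g hg
  | zero => exact map_zero L ▸ O.zero_mem
  | add ω η _ _ hω hη => exact map_add L ω η ▸ O.add_mem _ _ hω hη
  | smul c ω _ hω => exact (L.map_smul (c : K) ω).symm ▸ O.mul_mem _ _ c.2 hω

end IsRegularAt

namespace IsQuadraticPair

variable (h : IsQuadraticPair x w Q)

include h

lemma right_mem {O : ValuationSubring K} (hO : ∀ c : k, algebraMap k K c ∈ O) (hx : x ∈ O) :
    w ∈ O := by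
  refine (O.mem_or_inv_mem w).elim id fun hw => ?_
  have hmem := O.mul_mem _ _ (aeval_mem_of_forall_algebraMap_mem hO hx Q) hw
  rwa [← h.sq, pow_two, mul_inv_cancel_right₀ h.right_ne_zero] at hmem

lemma derivation_right {M : Type*} [AddCommGroup M] [Module K M] [Module k M]
    (d : Derivation k K M) : (2 * w) • d w = aeval x (derivative Q) • d x := by
  have hd := congrArg d h.sq
  rw [Derivation.map_aeval, Derivation.leibniz_pow] at hd
  rw [← hd, Nat.add_one_sub_one, pow_one, mul_smul, ofNat_smul_eq_nsmul]

lemma isRegularAt [PerfectField k] (hQ : Squarefree Q) {O : ValuationSubring K}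
    (hO : ∀ c : k, algebraMap k K c ∈ O) (hx : x ∈ O) (a b : k[X]) :
    IsRegularAt O (((aeval x a + aeval x b * w) / w) • D k K x) := by
  obtain ⟨A, B, hAB⟩ := PerfectField.separable_iff_squarefree.2 hQ
  have hp := aeval_mem_of_forall_algebraMap_mem hO hx
  have hw := h.right_mem hO hx
  have hw0 := h.right_ne_zero
  set f := aeval x a + aeval x b * w
  have hf : f ∈ O := add_mem (hp a) (mul_mem (hp b) hw)
  have hbezout : aeval x A * w ^ 2 + aeval x B * aeval x (derivative Q) = 1 := by
    rw [h.sq, ← map_mul, ← map_mul, ← map_add, hAB, map_one]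
  -- From `A Q + B Q' = 1` and `2 w dw = Q' dx` one gets `dx / w = A w dx + 2 B dw`.
  have hdx : (f / w) • D k K x = (f * aeval x A * w) • D k K x + (f * aeval x B * 2) • D k K w := by
    have hdw : (f * aeval x B * 2) • D k K w =
        (f * aeval x B / w * aeval x (derivative Q)) • D k K x := by
      rw [mul_smul (f * aeval x B / w), ← h.derivation_right, smul_smul]
      congr 1
      field_simp
    rw [hdw, ← add_smul]
    congr 1
    field_simp
    linear_combination -f * hbezout
  rw [hdx]
  exact (IsRegularAt.smul_D (mul_mem (mul_mem hf (hp A)) hw) hx).add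
    (IsRegularAt.smul_D (mul_mem (mul_mem hf (hp B)) (ofNat_mem O 2)) hw)

/-- The normalization `d x = 2 * w` is what makes `d w = Q'(x)` integral. -/
lemma isIntegral_derivation [NeZero (2 : k)] [Algebra k[X] K]
    (hx : ∀ a : k[X], algebraMap k[X] K a = aeval x a) (hQ : Squarefree Q) {d : Derivation k K K}
    (hdx : d x = 2 * w) {f : K} (hf : IsIntegral k[X] f) : IsIntegral k[X] (d f) := by
  have hdw : d w = aeval x (derivative Q) := by
    have h2 : (2 : K) ≠ 0 := map_ofNat (algebraMap k K) 2 ▸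
      (map_ne_zero_iff _ (algebraMap k K).injective).2 two_ne_zero
    refine mul_left_cancel₀ (mul_ne_zero h2 h.right_ne_zero) ?_
    rw [← smul_eq_mul, h.derivation_right d, hdx, smul_eq_mul, mul_comm]
  have hp (a : k[X]) : IsIntegral k[X] (aeval x a) := hx a ▸ isIntegral_algebraMap
  have hw := h.isIntegral_right hx
  have h2w : IsIntegral k[X] (2 * w) := (two_mul w).symm ▸ hw.add hw
  obtain ⟨a, b, rfl⟩ := h.exists_eq_aeval_add_aeval_mul_of_isIntegral hx hQ hf
  rw [map_add, d.leibniz, d.map_aeval, d.map_aeval, hdx, hdw]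
  exact ((hp _).mul h2w).add (((hp _).mul (hp _)).add (hw.mul ((hp _).mul h2w)))

lemma isIntegral_apply_of_forall_isRegularAt [CharZero k] [Algebra k[X] K]
    (hx : ∀ a : k[X], algebraMap k[X] K a = aeval x a) (hQ : Squarefree Q)
    {L : Ω[K⁄k] →ₗ[K] K} (hL : L (D k K x) = 2 * w) {ω : Ω[K⁄k]}
    (hω : ∀ O : ValuationSubring K, (∀ c : k, algebraMap k K c ∈ O) → x ∈ O → IsRegularAt O ω) :
    IsIntegral k[X] (L ω) := by
  have := h.faithfulSMul hx
  let _ : Algebra (FractionRing k[X]) K := FractionRing.liftAlgebra k[X] K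
  have := h.finiteDimensional_fractionRing hx
  have : IsFractionRing (integralClosure k[X] K) K :=
    integralClosure.isFractionRing_of_finite_extension (FractionRing k[X]) K
  have : IsDedekindDomain (integralClosure k[X] K) :=
    integralClosure.isDedekindDomain_fractionRing k[X] K
  suffices L ω ∈ (algebraMap (integralClosure k[X] K) K).range by
    obtain ⟨s, hs⟩ := this
    exact hs ▸ s.2
  refine IsDedekindDomain.HeightOneSpectrum.mem_integers_of_valuation_le_one _ _ fun v => ?_
  have hv {s : K} (hs : IsIntegral k[X] s) : s ∈ (v.valuation K).valuationSubring :=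
    v.valuation_le_one ⟨s, hs⟩
  have hp (a : k[X]) : aeval x a ∈ (v.valuation K).valuationSubring :=
    hv (hx a ▸ isIntegral_algebraMap)
  have hreg := hω _ (fun c => aeval_C x c ▸ hp (C c)) (aeval_X (R := k) x ▸ hp X)
  exact hreg.apply_mem fun g hg => valuation_derivation_le_one v (d := L.compDer (D k K))
    (fun s => hv (h.isIntegral_derivation hx hQ hL s.2)) hg

lemma exists_eq_smul_D_of_forall_isRegularAt [CharZero k] (hQ : Squarefree Q) {ω : Ω[K⁄k]}
    (hω : ∀ O : ValuationSubring K, (∀ c : k, algebraMap k K c ∈ O) → x ∈ O → IsRegularAt O ω) :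
    ∃ a b : k[X], ω = ((aeval x a + aeval x b * w) / w) • D k K x := by
  obtain ⟨e, he⟩ := h.exists_linearEquiv_apply_D_eq_one
  let _ : Algebra k[X] K := (aeval x).toRingHom.toAlgebra
  have hx (a : k[X]) : algebraMap k[X] K a = aeval x a := rfl
  have hintegral := h.isIntegral_apply_of_forall_isRegularAt hx hQ (L := (2 * w) • e.toLinearMap)
    (by rw [LinearMap.smul_apply, LinearEquiv.coe_coe, he, smul_eq_mul, mul_one]) hω
  obtain ⟨a, b, hab⟩ := h.exists_eq_aeval_add_aeval_mul_of_isIntegral hx hQ hintegral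
  replace hab : 2 * w * e ω = aeval x a + aeval x b * w := hab
  refine ⟨C (1 / 2) * a, C (1 / 2) * b, e.injective ?_⟩
  have hhalf : algebraMap k K (1 / 2) * 2 = 1 := by
    rw [← map_ofNat (algebraMap k K) 2, ← map_mul, one_div_mul_cancel two_ne_zero, map_one]
  rw [map_smul, he, smul_eq_mul, mul_one, eq_div_iff h.right_ne_zero]
  simp only [map_mul, aeval_C]
  linear_combination algebraMap k K (1 / 2) * hab - e ω * w * hhalf

end IsQuadraticPair

end RegularDifferentials

section Genus

open Polynomial KaehlerDifferential

lemma reverse_dvd_of_dvd_reverse {R : Type*} [Semiring R] [NoZeroDivisors R] {p q : R[X]}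
    (h : p ∣ q.reverse) : p.reverse ∣ q := by
  obtain ⟨r, hr⟩ := h
  rcases eq_or_ne q.reverse 0 with hq | hq
  · exact (reverse_eq_zero.1 hq) ▸ dvd_zero _
  have hdeg := natDegree_mul (left_ne_zero_of_mul (hr ▸ hq)) (right_ne_zero_of_mul (hr ▸ hq))
  have hle := reverse_natDegree_le q
  rw [hr, hdeg] at hle
  refine ⟨reflect (q.natDegree - p.natDegree) r, ?_⟩
  rw [reverse, ← reflect_mul _ _ le_rfl (by omega), ← hr, Nat.add_sub_cancel' (by omega), reverse,
    reflect_reflect]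

lemma squarefree_reverse {R : Type*} [CommRing R] [IsDomain R] {q : R[X]} (hq : Squarefree q) :
    Squarefree q.reverse := by
  intro g hg
  have hg0 : g.coeff 0 ≠ 0 := fun h0 => by
    have hX : X ∣ q.reverse := (X_dvd_iff.2 h0).trans (dvd_of_mul_left_dvd hg)
    rw [X_dvd_iff, coeff_zero_reverse, leadingCoeff_eq_zero] at hX
    exact hq.ne_zero hX
  have hunit := hq g.reverse (reverse_mul_of_domain g g ▸ reverse_dvd_of_dvd_reverse hg)
  have hdeg := natDegree_eq_zero_of_isUnit hunit
  rw [reverse_natDegree, natTrailingDegree_eq_zero.2 (.inr hg0), Nat.sub_zero] at hdeg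
  rw [eq_C_of_natDegree_eq_zero hdeg] at hunit ⊢
  rwa [reverse_C] at hunit

lemma squarefree_X_mul_reverse {F : Type*} [Field F] {q : F[X]} (hq : Squarefree q) :
    Squarefree (X * q.reverse) := by
  refine squarefree_mul_iff.2 ⟨?_, irreducible_X.squarefree, squarefree_reverse hq⟩
  rw [irreducible_X.isRelPrime_iff_not_dvd, X_dvd_iff, coeff_zero_reverse, leadingCoeff_eq_zero]
  exact hq.ne_zero

lemma mem_degreeLT_of_mul_X_pow_eq {R : Type*} [Semiring R] {p q : R[X]} {i j l : ℕ}
    (h : p * X ^ j = q * X ^ i) (hl : q.natDegree + i < j + l) : p ∈ degreeLT R l := by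
  nontriviality R
  rcases eq_or_ne p 0 with rfl | hp
  · exact zero_mem _
  have hdeg := congrArg natDegree h
  have hle := natDegree_mul_le (p := q) (q := X ^ i)
  rw [natDegree_X_pow] at hle
  rw [natDegree_mul_X_pow _ hp] at hdeg
  rw [mem_degreeLT, degree_eq_natDegree hp]
  exact_mod_cast (by omega : p.natDegree < l)

namespace IsQuadraticPair

section

variable {k K : Type*} [Field k] [Field K] [Algebra k K] {x w : K} {Q : k[X]}
  (h : IsQuadraticPair x w Q)

include h

lemma isRegularAt_of_mem_degreeLT [PerfectField k] (hQ : Squarefree Q) {m : ℕ}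
    (hm : Q.natDegree = 2 * m + 1) {a : k[X]} (ha : a ∈ degreeLT k m) {O : ValuationSubring K}
    (hO : ∀ c : k, algebraMap k K c ∈ O) : IsRegularAt O ((aeval x a / w) • D k K x) := by
  have hx := h.left_ne_zero
  rcases O.mem_or_inv_mem x with hxO | hxO
  · have hreg := h.isRegularAt hQ hO hxO a 0
    rwa [map_zero, zero_mul, add_zero] at hreg
  rcases eq_or_ne a 0 with rfl | ha0
  · rw [map_zero, zero_div, zero_smul]
    exact Submodule.zero_mem _
  have hdeg : a.natDegree < m := by
    rw [mem_degreeLT, degree_eq_natDegree ha0] at ha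
    exact_mod_cast ha
  obtain ⟨l, rfl⟩ : ∃ l, m = l + 1 := ⟨m - 1, by omega⟩
  have hreg := (h.inv hm).isRegularAt (squarefree_X_mul_reverse hQ) hO hxO (-reflect l a) 0
  have ha' := aeval_inv (inv_ne_zero hx) (Nat.lt_succ_iff.1 hdeg)
  rw [inv_inv] at ha'
  convert hreg using 1
  rw [Derivation.leibniz_inv, smul_smul, map_zero, zero_mul, add_zero, map_neg, ha']
  congr 1
  generalize aeval x⁻¹ (reflect l a) = r
  simp only [inv_pow]
  field_simp
  ring

/-- The hypothesis compares the coefficients of `dx` in one differential written in the coordinates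
`x, w` and in the coordinates `x⁻¹, w * x⁻¹ ^ (m + 1)` at infinity. -/
lemma mul_X_pow_eq_neg_reflect {m N : ℕ} {a b a' b' : k[X]} (ha' : a'.natDegree ≤ N)
    (hb' : b'.natDegree ≤ N)
    (heq : (aeval x a + aeval x b * w) / w =
      (aeval x⁻¹ a' + aeval x⁻¹ b' * (w * x⁻¹ ^ (m + 1))) / (w * x⁻¹ ^ (m + 1)) * -x⁻¹ ^ 2) :
    a * X ^ (N + 2) = -reflect N a' * X ^ (m + 1) ∧ b * X ^ (N + 2) = -reflect N b' := by
  have hx := h.left_ne_zero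
  have hw := h.right_ne_zero
  rw [aeval_inv hx ha', aeval_inv hx hb'] at heq
  obtain ⟨ha, hb⟩ := h.indep (a * X ^ (N + 2) + reflect N a' * X ^ (m + 1))
    (b * X ^ (N + 2) + reflect N b') (by
      simp only [map_add, map_mul, map_pow, aeval_X]
      simp only [inv_pow] at heq
      field_simp at heq
      linear_combination heq)
  exact ⟨by linear_combination ha, by linear_combination hb⟩

lemma exists_mem_degreeLT_of_forall_isRegularAt [CharZero k] (hQ : Squarefree Q) {m : ℕ}
    (hm : Q.natDegree = 2 * m + 1) {ω : Ω[K⁄k]}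
    (hω : ∀ O : ValuationSubring K, (∀ c : k, algebraMap k K c ∈ O) → IsRegularAt O ω) :
    ∃ a ∈ degreeLT k m, ω = (aeval x a / w) • D k K x := by
  obtain ⟨a, b, hab⟩ := h.exists_eq_smul_D_of_forall_isRegularAt hQ fun O hO _ => hω O hO
  obtain ⟨a', b', hab'⟩ := (h.inv hm).exists_eq_smul_D_of_forall_isRegularAt
    (squarefree_X_mul_reverse hQ) fun O hO _ => hω O hO
  obtain ⟨e, he⟩ := h.exists_linearEquiv_apply_D_eq_one
  have heq := congrArg e (hab.symm.trans hab')
  simp only [Derivation.leibniz_inv, map_smul, he, smul_eq_mul, mul_one] at heq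
  obtain ⟨N, haN, hbN⟩ : ∃ N, a'.natDegree ≤ N ∧ b'.natDegree ≤ N :=
    ⟨_, le_max_left _ _, le_max_right _ _⟩
  obtain ⟨ha, hb⟩ := h.mul_X_pow_eq_neg_reflect haN hbN heq
  have hdeg (p : k[X]) (hp : p.natDegree ≤ N) : (-reflect N p).natDegree ≤ N := by
    rw [natDegree_neg]
    exact natDegree_reflect_le.trans (max_le le_rfl hp)
  have hb0 : b = 0 := by
    have := hdeg b' hbN
    have hmem : b ∈ degreeLT k 0 := mem_degreeLT_of_mul_X_pow_eq (i := 0) (j := N + 2)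
      (q := -reflect N b') (by rw [hb, pow_zero, mul_one]) (by omega)
    exact degree_eq_bot.1 (Nat.WithBot.lt_zero_iff.1 (mem_degreeLT.1 hmem))
  refine ⟨a, mem_degreeLT_of_mul_X_pow_eq ha ?_, by rw [hab, hb0, map_zero, zero_mul, add_zero]⟩
  have := hdeg a' haN
  omega

end

variable {K : Type*} [Field K] [Algebra ℂ K] {x w : K} {Q : ℂ[X]} (h : IsQuadraticPair x w Q)

include h

lemma mem_regularDifferentials_iff (hQ : Squarefree Q) {m : ℕ} (hm : Q.natDegree = 2 * m + 1)
    {ω : Ω[K⁄ℂ]} :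
    ω ∈ regularDifferentials K ↔ ∃ a ∈ degreeLT ℂ m, ω = (aeval x a / w) • D ℂ K x := by
  refine ⟨h.exists_mem_degreeLT_of_forall_isRegularAt hQ hm, ?_⟩
  rintro ⟨a, ha, rfl⟩ O hO
  exact h.isRegularAt_of_mem_degreeLT hQ hm ha hO

lemma geometricGenus_eq (hQ : Squarefree Q) {m : ℕ} (hm : Q.natDegree = 2 * m + 1) :
    geometricGenus K = m := by
  obtain ⟨e, he⟩ := h.exists_linearEquiv_apply_D_eq_one
  let F : ℂ[X] →ₗ[ℂ] Ω[K⁄ℂ] :=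
    (LinearMap.toSpanSingleton K _ (w⁻¹ • D ℂ K x)).restrictScalars ℂ ∘ₗ (aeval x).toLinearMap
  have hF (a : ℂ[X]) : F a = (aeval x a / w) • D ℂ K x := by
    rw [div_eq_mul_inv, mul_smul]
    rfl
  have hinj : Function.Injective F := (injective_iff_map_eq_zero F).2 fun a ha => by
    have hea := congrArg e ((hF a).symm.trans ha)
    rw [map_smul, he, smul_eq_mul, mul_one, map_zero, div_eq_zero_iff,
      or_iff_left h.right_ne_zero] at hea
    by_contra ha0
    exact h.aeval_ne_zero ha0 hea
  have hmap : (degreeLT ℂ m).map F = regularDifferentials K := by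
    ext ω
    simp only [h.mem_regularDifferentials_iff hQ hm, Submodule.mem_map, hF, eq_comm]
  rw [geometricGenus, ← hmap, ← (Submodule.equivMapOfInjective F hinj _).finrank_eq,
    (degreeLTEquiv ℂ m).finrank_eq, Module.finrank_fin_fun]

end IsQuadraticPair

end Genus

section FunctionField

open Polynomial

lemma CurveRing.isQuadraticPair {n : ℕ} {H : ℤ → ℤ → ℂ} (hH : Admissible n H) (K : Type*) [Field K]
    [Algebra ℂ K] [Algebra (CurveRing n H) K] [IsScalarTower ℂ (CurveRing n H) K]
    [IsFractionRing (CurveRing n H) K] :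
    IsQuadraticPair (algebraMap (CurveRing n H) K (CurveRing.lam n H))
      (algebraMap (CurveRing n H) K (CurveRing.p n H)) (branchPoly n H) :=
  .of_isFractionRing (CurveRing.p_sq n H)
    (fun _ _ => CurveRing.eq_zero_of_aeval_add_aeval_mul_eq_zero hH)
    CurveRing.exists_eq_aeval_add_aeval_mul

lemma IsQuadraticPair.isHyperellipticOfGenus_iff {K : Type*} [Field K] [Algebra ℂ K] {x w : K}
    {P : ℂ[X]} (h : IsQuadraticPair x w P) {n : ℕ} (hn : 2 ≤ n) (hP : P.natDegree = 2 * n + 1) :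
    IsHyperellipticOfGenus K n ↔ Squarefree P := by
  refine ⟨fun ⟨_, hg, _⟩ => ?_, fun hsq =>
    ⟨hn, h.geometricGenus_eq hsq hP, x, h.transcendental, h.finrank_eq_two⟩⟩
  -- If `P = R ^ 2 * Q` with `Q` squarefree, then the genus is `n - deg R`.
  obtain ⟨R, Q, hRQ, hQ⟩ := exists_eq_sq_mul_squarefree h.polynomial_ne_zero
  have h0 : R ^ 2 * Q ≠ 0 := hRQ ▸ h.polynomial_ne_zero
  have hdeg : P.natDegree = 2 * R.natDegree + Q.natDegree := by
    rw [hRQ, natDegree_mul (left_ne_zero_of_mul h0) (right_ne_zero_of_mul h0), natDegree_pow]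
  have hgenus := (h.div_of_eq_sq_mul hRQ).geometricGenus_eq hQ (m := n - R.natDegree) (by omega)
  have hR : IsUnit R := isUnit_iff_degree_eq_zero.2 <| by
    rw [degree_eq_natDegree (ne_zero_of_dvd_ne_zero (left_ne_zero_of_mul h0)
      (dvd_pow_self R two_ne_zero))]
    exact_mod_cast (by omega : R.natDegree = 0)
  exact hRQ ▸ (associated_unit_mul_left Q _ (hR.pow 2)).squarefree_iff.2 hQ

end FunctionField

theorem mainTheorem6 (n : ℕ) (hn : 2 ≤ n) :
    -- `W_{2n}` is the greatest family of multiplicatively closed, `z ^ 2`-stable spaces in `Σ_{2n}`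
    IsGreatest
      {X : Set (Submodule ℂ (LaurentSeries ℂ)) |
        X ⊆ nonnegParts n ∧ ∀ U ∈ X, U * U ≤ U ∧ ZSqStable U}
      (hyperellipticSubset n) ∧
    -- each member is a maximal multiplicatively closed subspace of the points containing it
    (∀ U ∈ hyperellipticSubset n, ∀ V ∈ birkhoffStratum (2 * n), U ≤ V →
      ∀ A : Submodule ℂ (LaurentSeries ℂ), A ≤ V → A * A ≤ A → U ≤ A → A = U) ∧
    -- the members are parametrized by `H^{2n+1}_{-2n+1}, H^{2n+1}_{-2n+3}, …, H^{2n+1}_{2n+1}`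
    (∀ v : Fin (2 * n + 1) → ℂ, ∃! U : Submodule ℂ (LaurentSeries ℂ), ∃ H : ℤ → ℤ → ℂ,
      Admissible n H ∧ U = spanSeries n H ∧
        ∀ s : Fin (2 * n + 1), H (2 * n + 1) (2 * ((s : ℕ) - (n : ℤ)) + 1) = v s) ∧
    ∀ H : ℤ → ℤ → ℂ, Admissible n H →
      -- the algebra structure
      LinearIndependent ℂ (fun j : nonnegOrders n => canonicalSeries n H j) ∧
      (∀ m : ℕ, canonicalSeries n H (2 * m) = zPow 2 ^ m) ∧
      (∃ A : Subalgebra ℂ (LaurentSeries ℂ),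
        Subalgebra.toSubmodule A = spanSeries n H ∧ ¬ FiniteDimensional ℂ A ∧
        ∃ φ : CurveRing n H ≃ₐ[ℂ] A,
          (φ (CurveRing.lam n H) : LaurentSeries ℂ) = zPow 2 ∧
          (φ (CurveRing.p n H) : LaurentSeries ℂ) = canonicalSeries n H (2 * n + 1)) ∧
      -- the ideal of the variety `Γ_{2n}`
      (∃ α : ℕ → Polynomial ℂ,
        (∀ m : ℕ, n < m → (α m).Monic ∧ (α m).natDegree = m - n ∧
          canonicalSeries n H (2 * m + 1) =
            Polynomial.aeval (zPow 2) (α m) * canonicalSeries n H (2 * n + 1)) ∧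
        Ideal.span (relationSet n H) = curveIdeal n H α ∧
        MvPolynomial.vanishingIdeal ℂ (gammaVariety n H) = curveIdeal n H α ∧
        RingHom.ker (MvPolynomial.aeval (R := ℂ) (coordSeries n H)) = curveIdeal n H α) ∧
      -- the curve
      IsDomain (CurveRing n H) ∧
      (IsNonsingularCurve (curvePoly n H) ↔ Squarefree (branchPoly n H)) ∧
      ∀ (K : Type) [Field K] [Algebra ℂ K] [Algebra (CurveRing n H) K]
        [IsScalarTower ℂ (CurveRing n H) K] [IsFractionRing (CurveRing n H) K],
        Module.finrank
          (IntermediateField.adjoin ℂ {algebraMap (CurveRing n H) K (CurveRing.lam n H)}) K = 2 ∧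
        doubleCoverArithmeticGenus n (algebraMap (CurveRing n H) K (CurveRing.lam n H))
          (algebraMap (CurveRing n H) K (CurveRing.p n H)) = n ∧
        (IsHyperellipticOfGenus K n ↔ IsNonsingularCurve (curvePoly n H)) := by
  refine ⟨isGreatest_hyperellipticSubset n, fun U hU V hV _ A hAV hA hUA =>
    eq_of_le_of_mul_self_le hU hV hAV hA hUA, existsUnique_spanSeries, fun H hH =>
    ⟨linearIndependent_canonicalSeries n H, fun m => by rw [canonicalSeries_two_mul hH.1, zPow_pow],
      exists_subalgebra hH, exists_alpha hH, CurveRing.isDomain hH,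
      isNonsingularCurve_curvePoly_iff n H, fun K _ _ _ _ _ => ?_⟩⟩
  have h := CurveRing.isQuadraticPair hH K
  have hd := natDegree_branchPoly n H
  exact ⟨h.finrank_eq_two, h.doubleCoverArithmeticGenus_eq hd,
    (h.isHyperellipticOfGenus_iff hn hd).trans (isNonsingularCurve_curvePoly_iff n H).symm⟩
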